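/- **Theorem 1.1 (Linear enhanced dissipation).** Let $\mathbb T=\mathbb R/2\pi\mathbb Z$, and for $\beta,\nu,\kappa>0$ consider on $(x,y,z)\in\mathbb T\times\mathbb R\times\mathbb T$ the Boussinesq equations linearized around a stably stratified Couette flow, for $u=(u^1,u^2,u^3)$ and $\theta$ real-valued, $$\partial_t u+y\partial_x u+u^2\hat x+2\nabla(-\Delta)^{-1}\partial_x u^2+\beta\nabla(-\Delta)^{-1}\partial_y\theta=\nu\Delta u-\beta\theta\hat y,\qquad \partial_t\theta+y\partial_x\theta-\beta u^2=\kappa\Delta\theta,$$ where $\hat x=(1,0,0)$, $\hat y=(0,1,0)$ and $\nabla(-\Delta)^{-1}\partial_x$, $\nabla(-\Delta)^{-1}\partial_y$ are Fourier multipliers. Write $\varphi_{\neq}=\varphi-\frac1{2\pi}\int_{\mathbb T}\varphi(x,\cdot,\cdot)\,dx$ and $\langle t\rangle=\sqrt{1+t^2}$; $\|\cdot\|_{H^s}$ is the norm with Fourier weight $(1+k^2+\eta^2+l^2)^{s/2}$, $(k,\eta,l)\in\mathbb Z\times\mathbb R\times\mathbb Z$. Let $\beta>1/2$. There is a constant $C>0$,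 depending only on $\beta$, such that the following holds. Let $\nu,\kappa>0$ satisfy $$\frac{\max\{\nu,\kappa\}}{\min\{\nu,\kappa\}}<4\beta-1,$$ and set $$\lambda_{\nu,\kappa}=\min\{\nu,\kappa\}\left(1-\frac1{4\beta}-\frac1{4\beta}\frac{\max\{\nu,\kappa\}}{\min\{\nu,\kappa\}}\right).$$ Then $\lambda_{\nu,\kappa}>0$, and every distributional solution $(u,\theta)\in C([0,\infty);L^2)$ of the system with $u_{\neq}(0),\theta_{\neq}(0)\in H^3$ satisfies, for every $t\ge0$, $$\|(u^1,u^3)_{\neq}(t)\|_{L^2}+\langle t\rangle^{3/2}\|u^2_{\neq}(t)\|_{L^2}+\langle t\rangle^{1/2}\|\theta_{\neq}(t)\|_{L^2}\le C\,e^{-\frac1{24}\lambda_{\nu,\kappa}t^3}\left(\|u_{\neq}(0)\|_{H^3}+\|\theta_{\neq}(0)\|_{H^3}\right).$$ -/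

import Mathlib

open MeasureTheory Set
open scoped ENNReal ContDiff

noncomputable section

namespace Boussinesq

instance fact_two_pi_pos : Fact (0 < 2 * Real.pi) := ⟨Real.two_pi_pos⟩

/-- The torus `𝕋 = ℝ / 2πℤ`, with its Haar measure of total mass `2π`. -/
abbrev Circ : Type := AddCircle (2 * Real.pi)

/-- The spatial domain `𝕋 × ℝ × 𝕋`, with points `(x, y, z)` and its volume `dx dy dz`. -/
abbrev Dom : Type := Circ × ℝ × Circ

/-- Real-valued `L²` functions on `𝕋 × ℝ × 𝕋`. -/
abbrev L2 : Type := Lp ℝ 2 (volume : Measure Dom)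

/-! ### Partial integration over a finite measure space preserves `L²` -/

theorem memLp_integral_fst {α γ E : Type*} [MeasurableSpace α] [MeasurableSpace γ]
    [NormedAddCommGroup E] [NormedSpace ℝ E]
    (μ : Measure α) (ρ : Measure γ) [IsFiniteMeasure μ] [SFinite ρ] {f : α × γ → E}
    (hf : MemLp f 2 (μ.prod ρ)) : MemLp (fun c => ∫ a, f (a, c) ∂μ) 2 ρ := by
  refine ⟨hf.1.prod_swap.integral_prod_right', ?_⟩
  have hfin : ∫⁻ p, ‖f p‖ₑ ^ (2 : ℝ) ∂(μ.prod ρ) < ⊤ := by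
    have h := hf.2
    rw [eLpNorm_lt_top_iff_lintegral_rpow_enorm_lt_top (by norm_num) (by norm_num)] at h
    simpa using h
  have hsw : ∫⁻ c, ∫⁻ a, ‖f (a, c)‖ₑ ^ (2 : ℝ) ∂μ ∂ρ < ⊤ := by
    rw [lintegral_prod_symm _ (hf.1.enorm.pow_const _)] at hfin
    exact hfin
  have hsec : ∀ᵐ c ∂ρ, AEStronglyMeasurable (fun a => f (a, c)) μ :=
    hf.1.prod_swap.prodMk_left
  rw [eLpNorm_lt_top_iff_lintegral_rpow_enorm_lt_top (by norm_num) (by norm_num)]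
  have hbound : ∀ᵐ c ∂ρ, ‖∫ a, f (a, c) ∂μ‖ₑ ^ (2 : ℝ)
      ≤ μ univ * ∫⁻ a, ‖f (a, c)‖ₑ ^ (2 : ℝ) ∂μ := by
    filter_upwards [hsec] with c hc
    have h1 := ENNReal.lintegral_mul_le_Lp_mul_Lq μ Real.HolderConjugate.two_two
      (aemeasurable_const (b := (1 : ℝ≥0∞))) hc.enorm
    simp only [Pi.mul_apply, one_mul, ENNReal.one_rpow, lintegral_one] at h1
    have h2 := (enorm_integral_le_lintegral_enorm (μ := μ) (fun a => f (a, c))).trans h1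
    calc _ ≤ _ := ENNReal.rpow_le_rpow h2 (by norm_num)
      _ = _ := by
        rw [ENNReal.mul_rpow_of_nonneg _ _ (by norm_num), ← ENNReal.rpow_mul,
          ← ENNReal.rpow_mul]
        norm_num
  simp only [ENNReal.toReal_ofNat]
  calc _ ≤ _ := lintegral_mono_ae hbound
    _ = μ univ * ∫⁻ c, ∫⁻ a, ‖f (a, c)‖ₑ ^ (2 : ℝ) ∂μ ∂ρ :=
        lintegral_const_mul' _ _ (measure_ne_top μ univ)
    _ < ⊤ := ENNReal.mul_lt_top (measure_lt_top μ univ) hsw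

/-! ### Zero and nonzero modes in `x` -/

/-- The `x`-average `φ₀ = (1/2π) ∫_𝕋 φ(x, ·, ·) dx`, as a function on the domain. -/
def zeroModeFun (f : Dom → ℝ) : Dom → ℝ :=
  fun p => (2 * Real.pi)⁻¹ * ∫ x : Circ, f (x, p.2)

theorem memLp_zeroModeFun (f : L2) : MemLp (zeroModeFun f) 2 (volume : Measure Dom) := by
  have h := memLp_integral_fst (volume : Measure Circ) (volume : Measure (ℝ × Circ)) (Lp.memLp f)
  exact (h.comp_snd (volume : Measure Circ)).const_mul _

/-- The nonzero modes `φ_≠ = φ - φ₀`. -/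
def nonzeroModes (f : L2) : L2 := f - (memLp_zeroModeFun f).toLp _

/-! ### Fourier transform and Sobolev norms -/

/-- The `(k, l)` Fourier coefficient in `(x, z)`, as a function of `y`:
`(1/4π²) ∫∫ e^{-i(kx + lz)} f(x, y, z) dx dz`. -/
def modeFun (f : Dom → ℝ) (k l : ℤ) : ℝ → ℂ :=
  fun y => (4 * Real.pi ^ 2 : ℂ)⁻¹ *
    ∫ z : Circ, fourier (-l) z * ∫ x : Circ, fourier (-k) x * (f (x, y, z) : ℂ)

theorem memLp_fourier_mul {γ : Type*} [MeasurableSpace γ] (ρ : Measure γ) [SFinite ρ] (k : ℤ)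
    {f : Circ × γ → ℂ} (hf : MemLp f 2 ((volume : Measure Circ).prod ρ)) :
    MemLp (fun p : Circ × γ => fourier k p.1 * f p) 2 ((volume : Measure Circ).prod ρ) := by
  refine hf.of_le (AEStronglyMeasurable.mul ?_ hf.1) (Filter.Eventually.of_forall fun p => ?_)
  · exact ((fourier k : C(Circ, ℂ)).continuous.measurable.comp
      measurable_fst).aestronglyMeasurable
  · rw [norm_mul, fourier_apply, Circle.norm_coe, one_mul]

theorem memLp_modeFun (f : L2) (k l : ℤ) : MemLp (modeFun f k l) 2 (volume : Measure ℝ) := by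
  have h0 : MemLp (fun p : Dom => ((f p : ℝ) : ℂ)) 2
      ((volume : Measure Circ).prod (volume : Measure (ℝ × Circ))) := (Lp.memLp f).ofReal
  have h1 := memLp_integral_fst _ _ (memLp_fourier_mul _ (-k) h0)
  have h2 := h1.comp_measurePreserving
    (Measure.measurePreserving_swap (μ := (volume : Measure Circ)) (ν := (volume : Measure ℝ)))
  have h3 := memLp_integral_fst _ _ (memLp_fourier_mul _ (-l) h2)
  exact h3.const_mul _

/-- The Fourier transform of `f` at `(k, η, l)` with `η = 2πξ`: the `L²` (Plancherel) Fourier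
transform in `y`, `g ↦ ∫ e^{-2πiξy} g(y) dy`, of the `(k, l)` Fourier coefficient of `f`. -/
def fourierL2 (f : L2) (k l : ℤ) : Lp ℂ 2 (volume : Measure ℝ) :=
  Lp.fourierTransformₗᵢ ℝ ℂ ((memLp_modeFun f k l).toLp _)

/-- The wave vector `(k, η, l)`. -/
def wave (k : ℤ) (η : ℝ) (l : ℤ) : Fin 3 → ℝ := ![(k : ℝ), η, (l : ℝ)]

/-- `|k, η, l|² = k² + η² + l²`. -/
def waveSq (k : ℤ) (η : ℝ) (l : ℤ) : ℝ := (k : ℝ) ^ 2 + η ^ 2 + (l : ℝ) ^ 2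

/-- The `H^s` norm `‖⟨(k, η, l)⟩^s f̂‖`, with value `∞` when `f` is not in `H^s`. The factor
`4π²` makes the `H⁰` norm equal to the `L²` norm. -/
def sobolevNorm (s : ℝ) (f : L2) : ℝ≥0∞ :=
  (ENNReal.ofReal (4 * Real.pi ^ 2) * ∑' k : ℤ, ∑' l : ℤ, ∫⁻ ξ : ℝ,
    ENNReal.ofReal ((1 + waveSq k (2 * Real.pi * ξ) l) ^ s) *
      ‖fourierL2 f k l ξ‖ₑ ^ 2) ^ (1 / 2 : ℝ)

/-- The `H^s` norm of a vector field. -/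
def sobolevNormVec (s : ℝ) (v : Fin 3 → L2) : ℝ≥0∞ :=
  (∑ j, sobolevNorm s (v j) ^ 2) ^ (1 / 2 : ℝ)

/-! ### Test functions and weak solutions -/

/-- `∂_x φ`. -/
def dX (φ : Dom → ℂ) : Dom → ℂ :=
  fun p => deriv (fun s : ℝ => φ (p.1 + (s : Circ), p.2.1, p.2.2)) 0

/-- `∂_y φ`. -/
def dY (φ : Dom → ℂ) : Dom → ℂ :=
  fun p => deriv (fun s : ℝ => φ (p.1, s, p.2.2)) p.2.1

/-- `∂_z φ`. -/
def dZ (φ : Dom → ℂ) : Dom → ℂ :=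
  fun p => deriv (fun s : ℝ => φ (p.1, p.2.1, p.2.2 + (s : Circ))) 0

/-- `Δφ`. -/
def lap (φ : Dom → ℂ) : Dom → ℂ :=
  fun p => dX (dX φ) p + dY (dY φ) p + dZ (dZ φ) p

/-- Smooth compactly supported functions on `𝕋 × ℝ × 𝕋`; smoothness is that of the
periodic lift to `ℝ³`. -/
structure IsTest (φ : Dom → ℂ) : Prop where
  smooth : ContDiff ℝ ∞ (fun p : ℝ × ℝ × ℝ => φ ((p.1 : Circ), p.2.1, (p.2.2 : Circ)))
  compact : HasCompactSupport φ

/-- `∫ f φ dx dy dz`. -/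
def pair (f : L2) (φ : Dom → ℂ) : ℂ := ∫ p : Dom, ((f p : ℝ) : ℂ) * φ p

/-- `g` is the `j`-th component of the linearized pressure gradient
`2∇(-Δ)⁻¹∂_x v + β∇(-Δ)⁻¹∂_y θ`, where `∂_j(-Δ)⁻¹∂_m` is the (bounded) Fourier multiplier with
symbol `(i k_j)(i k_m) / |k, η, l|²`. This determines `g` in `L²`. -/
def IsPressureGrad (β : ℝ) (v θ : L2) (j : Fin 3) (g : L2) : Prop :=
  ∀ k l : ℤ, ∀ᵐ ξ : ℝ,
    fourierL2 g k l ξ =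
      -((wave k (2 * Real.pi * ξ) l j / waveSq k (2 * Real.pi * ξ) l : ℝ) : ℂ) *
        (2 * (wave k (2 * Real.pi * ξ) l 0 : ℂ) * fourierL2 v k l ξ +
          β * (wave k (2 * Real.pi * ξ) l 1 : ℂ) * fourierL2 θ k l ξ)

/-- `(u, θ) ∈ C([0, ∞); L²)` is a solution, in the sense of distributions, of
`∂_t u + y∂_x u + u² x̂ + 2∇(-Δ)⁻¹∂_x u² + β∇(-Δ)⁻¹∂_y θ = νΔu - βθ ŷ`,
`∂_t θ + y∂_x θ - βu² = κΔθ`.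
The components `u¹, u², u³` are `u t 0, u t 1, u t 2`. -/
structure IsSolution (β ν κ : ℝ) (u : ℝ → Fin 3 → L2) (θ : ℝ → L2) : Prop where
  continuous_u : ∀ j, ContinuousOn (fun t => u t j) (Ici 0)
  continuous_θ : ContinuousOn θ (Ici 0)
  momentum : ∃ G : ℝ → Fin 3 → L2,
    (∀ t, 0 ≤ t → ∀ j, IsPressureGrad β (u t 1) (θ t) j (G t j)) ∧
    ∀ φ : Dom → ℂ, IsTest φ → ∀ t, 0 ≤ t → ∀ j,
      pair (u t j) φ = pair (u 0 j) φ + ∫ s in (0 : ℝ)..t,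
        (pair (u s j) (fun p => (p.2.1 : ℂ) * dX φ p)
          - (if j = 0 then pair (u s 1) φ else 0)
          - pair (G s j) φ
          + ν * pair (u s j) (lap φ)
          - (if j = 1 then β * pair (θ s) φ else 0))
  temperature : ∀ φ : Dom → ℂ, IsTest φ → ∀ t, 0 ≤ t →
      pair (θ t) φ = pair (θ 0) φ + ∫ s in (0 : ℝ)..t,
        (pair (θ s) (fun p => (p.2.1 : ℂ) * dX φ p)
          + β * pair (u s 1) φ
          + κ * pair (θ s) (lap φ))

/-- `⟨t⟩ = √(1 + t²)`. -/
def bracket (t : ℝ) : ℝ := Real.sqrt (1 + t ^ 2)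

/-- The rate `λ_{ν,κ}`. -/
def rate (β ν κ : ℝ) : ℝ :=
  min ν κ * (1 - 1 / (4 * β) - 1 / (4 * β) * (max ν κ / min ν κ))

end Boussinesq

end

noncomputable section

namespace Boussinesq

open Filter Topology ComplexConjugate
open scoped FourierTransform

/-! On the Fourier side `y ∂_x` transports frequencies, so at fixed `(k, l)` with `k ≠ 0` the system
becomes an ODE along `ξ = η - k s`. Put `r = |k, ξ, l|` and `q = k² + l²`. The pair `(x₂, τ)` is
closed: `x₂' = (2kξ/r²) x₂ - β (q/r²) τ - ν r² x₂` and `τ' = β x₂ - κ r² τ`.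

In the derivative of `r³ x₂² + q r τ²` the `β` couplings cancel, but `kξ r x₂² - (q kξ/r) τ²`
remains, and its relative size is not integrable in time. The cross term `-(kξ r/β) x₂ τ` of
`energy` is chosen to remove exactly this remainder. It is at most the fraction `1/(2β)` of the
diagonal part, so the energy is coercive for `β > 1/2` (`energySum_le`). The cross term leaves
behind a contribution of relative size `k²/r²` and a viscous one that lowers the damping rate from
`min ν κ` to `min ν κ - (ν + κ)/(4β)`, which is `rate`. The components `x₁, x₃` are driven by `x₂,
τ` with relative strength `r^(-3/2)`. Both `k²/r²` and `r^(-3/2)` are at most `(1 + (s -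
η/k)²)^(-3/4)`, whose integral over `s` is bounded independently of the mode. The energy thus grows
by at most a constant factor and is damped by `exp(-λ ∫ r²)`, where `∫ r² ≥ t³/12`
(`energyDeriv_le`, `integral_shear_sq`). Passing from squares to norms halves the exponent to
`1/24`. Finally `⟨t⟩² ≤ 2 r² (1 + k² + η² + l²)` trades the weights of the energy for powers of `t`,
at the price of the `H³` norm (`energyNorm_le`).

Solutions are only weak, so the ODE is first derived for truncated transforms: the solution is
tested against `e^{-i(kx+lz)}` times the conjugate of a modulated cutoff in `y`, the modulation
following the characteristic. This quantity is defined for every frequency and differentiable in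
time, and solves the ODE up to errors controlled by the `L²` norms of the derivatives of the cutoff
(`IsSolution.isApproxMode`). The pressure is nonlocal, and its commutator with the cutoff is small
because its symbol is Lipschitz for `k ≠ 0` (`norm_ip_multiplier_sub_le`). A Grönwall argument
survives the limit of wide cutoffs (`exp_mul_energy_le_of_tendsto`), a subsequence gives almost
every frequency (`exists_seq_tendsto_truncFourier`), and Plancherel sums the modes
(`IsSolution.enorm_nonzeroModes_le`). -/

/-! ### Fourier modes as elements of `L²(ℝ)` -/

/-- The function `e^{-i(kx + lz)} ψ(y)`. -/
def tensor (k l : ℤ) (ψ : ℝ → ℂ) : Dom → ℂ :=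
  fun p => fourier (-k) p.1 * (ψ p.2.1 * fourier (-l) p.2.2)

/-- The `(k, l)` Fourier coefficient of `f` in `(x, z)`, as an element of `L²(ℝ)`. -/
def mode (f : L2) (k l : ℤ) : Lp ℂ 2 (volume : Measure ℝ) := (memLp_modeFun f k l).toLp _

theorem fourierL2_eq (f : L2) (k l : ℤ) :
    fourierL2 f k l = Lp.fourierTransformₗᵢ ℝ ℂ (mode f k l) := rfl

theorem norm_fourier_apply (k : ℤ) (x : Circ) : ‖fourier k x‖ = 1 := by
  rw [fourier_apply, Circle.norm_coe]

theorem continuous_fourier_apply (k : ℤ) : Continuous (fun x : Circ => fourier k x) :=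
  (fourier k : C(Circ, ℂ)).continuous

theorem memLp_tensor (k l : ℤ) {ψ : ℝ → ℂ} (hψ : MemLp ψ 2 (volume : Measure ℝ)) :
    MemLp (tensor k l ψ) 2 (volume : Measure Dom) := by
  have h := (hψ.comp_fst (volume : Measure Circ)).comp_snd (volume : Measure Circ)
  refine MemLp.of_le (f := tensor k l ψ) h ?_ (Eventually.of_forall fun p => ?_)
  · refine AEStronglyMeasurable.mul ?_ (AEStronglyMeasurable.mul h.1 ?_)
    · exact ((continuous_fourier_apply (-k)).comp continuous_fst).aestronglyMeasurable
    · exact ((continuous_fourier_apply (-l)).comp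
        (continuous_snd.comp continuous_snd)).aestronglyMeasurable
  · simp [tensor, norm_fourier_apply, -fourier_apply]

theorem integrable_mul_tensor (f : L2) (k l : ℤ) {ψ : ℝ → ℂ}
    (hψ : MemLp ψ 2 (volume : Measure ℝ)) :
    Integrable (fun p : Dom => ((f p : ℝ) : ℂ) * tensor k l ψ p) :=
  MemLp.integrable_mul (MemLp.ofReal (Lp.memLp f)) (memLp_tensor k l hψ)

theorem integral_dom {g : Dom → ℂ} (hg : Integrable g) :
    ∫ p, g p = ∫ y : ℝ, ∫ z : Circ, ∫ x : Circ, g (x, y, z) := by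
  have h1 : Integrable (fun c : ℝ × Circ => ∫ x : Circ, g (x, c)) :=
    Integrable.integral_prod_right hg
  calc _ = ∫ c : ℝ × Circ, ∫ x : Circ, g (x, c) := integral_prod_symm _ hg
    _ = _ := integral_prod _ h1

theorem pair_tensor (f : L2) (k l : ℤ) {ψ : ℝ → ℂ} (hψ : MemLp ψ 2 (volume : Measure ℝ)) :
    pair f (tensor k l ψ) = (4 * Real.pi ^ 2 : ℂ) * ∫ y, modeFun f k l y * ψ y := by
  rw [pair, integral_dom (integrable_mul_tensor f k l hψ), ← integral_const_mul]
  congr 1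
  ext y
  have hpi : (4 * Real.pi ^ 2 : ℂ) ≠ 0 := by
    have := Real.pi_ne_zero
    norm_num [this]
  rw [modeFun, mul_assoc (_)⁻¹, mul_inv_cancel_left₀ hpi, ← integral_mul_const]
  congr 1
  ext z
  rw [← integral_const_mul, ← integral_mul_const]
  congr 1
  ext x
  simp only [tensor]
  ring

/-- Identities between modes are proved by duality: pairing with an arbitrary `w` avoids handling
the iterated integrals almost everywhere. -/
theorem pair_tensor_inner (f : L2) (k l : ℤ) (w : Lp ℂ 2 (volume : Measure ℝ)) :
    pair f (tensor k l (fun y => conj (w y))) =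
      (4 * Real.pi ^ 2 : ℂ) * inner ℂ w (mode f k l) := by
  have hw : MemLp (fun y => conj (w y)) 2 (volume : Measure ℝ) := (Lp.memLp w).star
  rw [pair_tensor f k l hw, L2.inner_def]
  congr 1
  refine integral_congr_ae ?_
  filter_upwards [(memLp_modeFun f k l).coeFn_toLp] with y hy
  simp only [mode, hy, RCLike.inner_apply]

theorem pair_sub (f g : L2) {φ : Dom → ℂ} (hφ : MemLp φ 2 (volume : Measure Dom)) :
    pair (f - g) φ = pair f φ - pair g φ := by
  have hf : Integrable (fun p : Dom => ((f p : ℝ) : ℂ) * φ p) :=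
    MemLp.integrable_mul (MemLp.ofReal (Lp.memLp f)) hφ
  have hg : Integrable (fun p : Dom => ((g p : ℝ) : ℂ) * φ p) :=
    MemLp.integrable_mul (MemLp.ofReal (Lp.memLp g)) hφ
  rw [pair, pair, pair, ← integral_sub hf hg]
  refine integral_congr_ae ?_
  filter_upwards [Lp.coeFn_sub f g] with p hp
  rw [hp]
  simp [sub_mul]

theorem four_pi_sq_ne_zero : (4 * Real.pi ^ 2 : ℂ) ≠ 0 := by
  have := Real.pi_ne_zero
  norm_num [this]

theorem mode_sub (f g : L2) (k l : ℤ) : mode (f - g) k l = mode f k l - mode g k l := by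
  refine ext_inner_left ℂ fun w => ?_
  have hw : MemLp (fun y => conj (w y)) 2 (volume : Measure ℝ) := (Lp.memLp w).star
  refine mul_left_cancel₀ four_pi_sq_ne_zero ?_
  rw [inner_sub_right, mul_sub, ← pair_tensor_inner, ← pair_tensor_inner, ← pair_tensor_inner,
    pair_sub f g (memLp_tensor k l hw)]

/-! ### Parseval's identity -/

theorem integral_circ_eq (g : Circ → ℂ) (k : ℤ) :
    ∫ x : Circ, fourier (-k) x * g x = (2 * Real.pi : ℝ) * fourierCoeff g k := by
  rw [fourierCoeff, AddCircle.integral_haarAddCircle]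
  have : ((2 * Real.pi : ℝ) : ℂ) ≠ 0 := by exact_mod_cast Real.two_pi_pos.ne'
  simp only [smul_eq_mul, Complex.real_smul, Complex.ofReal_inv]
  field_simp

/-- Parseval is known for the probability Haar measure. Here the coefficients carry an extra `2π`,
hence `(2π)²` in the square, and the integral returns a factor `(2π)⁻¹`. -/
theorem tsum_enorm_sq_circ {g : Circ → ℂ} (hg : MemLp g 2 (volume : Measure Circ)) :
    ∑' k : ℤ, ‖∫ x : Circ, fourier (-k) x * g x‖ₑ ^ 2 =
      ENNReal.ofReal (2 * Real.pi) * ∫⁻ x : Circ, ‖g x‖ₑ ^ 2 := by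
  have hg' : MemLp g 2 AddCircle.haarAddCircle := memLp_haarAddCircle_iff.2 hg
  have h1 := hasSum_sq_fourierCoeff (hg'.toLp g)
  have h2 : ∀ k, fourierCoeff (hg'.toLp g) k = fourierCoeff g k := fun k =>
    congrFun (fourierCoeff_congr_ae hg'.coeFn_toLp) k
  simp only [h2] at h1
  have h3 : ∫ t, ‖(hg'.toLp g) t‖ ^ 2 ∂(AddCircle.haarAddCircle (T := 2 * Real.pi)) =
      (2 * Real.pi)⁻¹ * ∫ t : Circ, ‖g t‖ ^ 2 := by
    have : ∫ t, ‖(hg'.toLp g) t‖ ^ 2 ∂(AddCircle.haarAddCircle (T := 2 * Real.pi)) =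
        ∫ t, ‖g t‖ ^ 2 ∂(AddCircle.haarAddCircle (T := 2 * Real.pi)) := by
      refine integral_congr_ae ?_
      filter_upwards [hg'.coeFn_toLp] with t ht
      rw [ht]
    rw [this, AddCircle.integral_haarAddCircle, smul_eq_mul]
  rw [h3] at h1
  have hint : Integrable (fun t : Circ => ‖g t‖ ^ 2) := hg.integrable_norm_pow (p := 2) (by norm_num)
  have h4 : ∫⁻ x : Circ, ‖g x‖ₑ ^ 2 = ENNReal.ofReal (∫ t : Circ, ‖g t‖ ^ 2) := by
    rw [ofReal_integral_eq_lintegral_ofReal hint (Eventually.of_forall fun _ => by positivity)]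
    refine lintegral_congr fun x => ?_
    rw [ENNReal.ofReal_pow (norm_nonneg _), ofReal_norm]
  have h5 := (h1.mul_left ((2 * Real.pi) ^ 2))
  have h6 : ∀ k : ℤ, ‖∫ x : Circ, fourier (-k) x * g x‖ₑ ^ 2 =
      ENNReal.ofReal ((2 * Real.pi) ^ 2 * ‖fourierCoeff g k‖ ^ 2) := by
    intro k
    rw [integral_circ_eq, ← ofReal_norm, ← ENNReal.ofReal_pow (norm_nonneg _), norm_mul,
      mul_pow, Complex.norm_real, Real.norm_eq_abs, sq_abs]
  rw [tsum_congr h6, ← ENNReal.ofReal_tsum_of_nonneg (fun k => by positivity) h5.summable,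
    h5.tsum_eq, h4, ← ENNReal.ofReal_mul Real.two_pi_pos.le]
  congr 1
  have := Real.two_pi_pos.ne'
  field_simp

theorem lintegral_tsum_enorm_sq_circ {γ : Type*} [MeasurableSpace γ] (ρ : Measure γ) [SFinite ρ]
    {f : Circ × γ → ℂ} (hf : MemLp f 2 ((volume : Measure Circ).prod ρ)) :
    ∑' k : ℤ, ∫⁻ c, ‖∫ x : Circ, fourier (-k) x * f (x, c)‖ₑ ^ 2 ∂ρ =
      ENNReal.ofReal (2 * Real.pi) * ∫⁻ p, ‖f p‖ₑ ^ 2 ∂((volume : Measure Circ).prod ρ) := by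
  have hm : AEMeasurable (fun p => ‖f p‖ₑ ^ 2) ((volume : Measure Circ).prod ρ) :=
    hf.1.enorm.pow_const _
  rw [← lintegral_tsum fun k =>
    ((memLp_integral_fst _ _ (memLp_fourier_mul ρ (-k) hf)).1.enorm.pow_const _),
    lintegral_prod_symm _ hm, ← lintegral_const_mul' _ _ ENNReal.ofReal_ne_top]
  have hfin : ∫⁻ p, ‖f p‖ₑ ^ 2 ∂((volume : Measure Circ).prod ρ) ≠ ⊤ := by
    have h := hf.2
    rw [eLpNorm_lt_top_iff_lintegral_rpow_enorm_lt_top (by norm_num) (by norm_num)] at h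
    simpa using h.ne
  rw [lintegral_prod_symm _ hm] at hfin
  have hsec : ∀ᵐ c ∂ρ, AEStronglyMeasurable (fun a => f (a, c)) (volume : Measure Circ) :=
    hf.1.prod_swap.prodMk_left
  refine lintegral_congr_ae ?_
  filter_upwards [hsec, ae_lt_top' hm.lintegral_prod_left' hfin] with c h1 h2
  refine tsum_enorm_sq_circ ⟨h1, ?_⟩
  rw [eLpNorm_lt_top_iff_lintegral_rpow_enorm_lt_top (by norm_num) (by norm_num)]
  simpa using h2

theorem lintegral_enorm_sq_toLp {γ : Type*} [MeasurableSpace γ] {ρ : Measure γ}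
    {E : Type*} [NormedAddCommGroup E]
    (f : Lp E 2 ρ) : ∫⁻ c, ‖f c‖ₑ ^ 2 ∂ρ = ‖f‖ₑ ^ 2 := by
  rw [Lp.enorm_def, eLpNorm_eq_lintegral_rpow_enorm_toReal (by norm_num) (by norm_num)]
  simp only [ENNReal.toReal_ofNat, ENNReal.rpow_ofNat]
  rw [← ENNReal.rpow_natCast, ← ENNReal.rpow_mul]
  norm_num

/-- Parseval is applied in `x` with `(y, z)` as parameters, then in `z` with `y` as a parameter.
Each application gives `2π`, and the normalization of `modeFun` accounts for `(4π²)²`. -/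
theorem enorm_sq_eq_tsum_modes (f : L2) :
    ‖f‖ₑ ^ 2 = ENNReal.ofReal (4 * Real.pi ^ 2) * ∑' k : ℤ, ∑' l : ℤ, ‖mode f k l‖ₑ ^ 2 := by
  have h0 : MemLp (fun p : Dom => ((f p : ℝ) : ℂ)) 2
      ((volume : Measure Circ).prod (volume : Measure (ℝ × Circ))) := (Lp.memLp f).ofReal
  have h1 := lintegral_tsum_enorm_sq_circ _ h0
  have h2 : ∀ k : ℤ, ENNReal.ofReal (2 * Real.pi) *
      ∫⁻ c : ℝ × Circ, ‖∫ x : Circ, fourier (-k) x * ((f (x, c) : ℝ) : ℂ)‖ₑ ^ 2 =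
      ENNReal.ofReal ((4 * Real.pi ^ 2) ^ 2) * ∑' l : ℤ, ‖mode f k l‖ₑ ^ 2 := by
    intro k
    have hk := (memLp_integral_fst _ _ (memLp_fourier_mul _ (-k) h0)).comp_measurePreserving
      (Measure.measurePreserving_swap (μ := (volume : Measure Circ)) (ν := (volume : Measure ℝ)))
    have hk2 := lintegral_tsum_enorm_sq_circ _ hk
    have hs := (Measure.measurePreserving_swap (μ := (volume : Measure Circ))
      (ν := (volume : Measure ℝ))).lintegral_comp_emb MeasurableEquiv.prodComm.measurableEmbedding
      (fun c : ℝ × Circ => ‖∫ x : Circ, fourier (-k) x * ((f (x, c) : ℝ) : ℂ)‖ₑ ^ 2)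
    simp only [Function.comp_apply] at hk2
    rw [show ∫⁻ c : ℝ × Circ, ‖∫ x : Circ, fourier (-k) x * ((f (x, c) : ℝ) : ℂ)‖ₑ ^ 2 = _
      from hs.symm]
    refine hk2.symm.trans ?_
    rw [← ENNReal.tsum_mul_left]
    refine tsum_congr fun l => ?_
    rw [← lintegral_enorm_sq_toLp, ← lintegral_const_mul' _ _ ENNReal.ofReal_ne_top]
    refine lintegral_congr_ae ?_
    filter_upwards [(memLp_modeFun f k l).coeFn_toLp] with y hy
    rw [mode, hy, modeFun, enorm_mul, mul_pow (‖_‖ₑ), ← mul_assoc (ENNReal.ofReal _)]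
    have : ENNReal.ofReal ((4 * Real.pi ^ 2) ^ 2) * ‖(4 * Real.pi ^ 2 : ℂ)⁻¹‖ₑ ^ 2 = 1 := by
      rw [← ofReal_norm, ← ENNReal.ofReal_pow (norm_nonneg _),
        ← ENNReal.ofReal_mul (by positivity), ← mul_pow, norm_inv]
      have : ‖(4 * Real.pi ^ 2 : ℂ)‖ = 4 * Real.pi ^ 2 := by
        have : (4 * Real.pi ^ 2 : ℂ) = ((4 * Real.pi ^ 2 : ℝ) : ℂ) := by push_cast; rfl
        rw [this, Complex.norm_real, Real.norm_of_nonneg (by positivity)]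
      rw [this, mul_inv_cancel₀ (by have := Real.pi_ne_zero; positivity)]
      simp
    rw [this, one_mul]
    rfl
  have h3 : ∫⁻ p : Dom, ‖((f p : ℝ) : ℂ)‖ₑ ^ 2 = ‖f‖ₑ ^ 2 := by
    rw [← lintegral_enorm_sq_toLp]
    refine lintegral_congr fun p => ?_
    rw [← ofReal_norm, ← ofReal_norm, Complex.norm_real]
  have h4 : ENNReal.ofReal (2 * Real.pi) * (ENNReal.ofReal (2 * Real.pi) * ‖f‖ₑ ^ 2) =
      ENNReal.ofReal ((4 * Real.pi ^ 2) ^ 2) * ∑' k : ℤ, ∑' l : ℤ, ‖mode f k l‖ₑ ^ 2 := by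
    rw [← h3, ← ENNReal.tsum_mul_left, ← tsum_congr h2, ENNReal.tsum_mul_left]
    congr 1
    exact h1.symm
  have h5 : ENNReal.ofReal (4 * Real.pi ^ 2) =
      ENNReal.ofReal (2 * Real.pi) * ENNReal.ofReal (2 * Real.pi) := by
    rw [← ENNReal.ofReal_mul (by positivity)]
    congr 1
    ring
  rw [← mul_assoc, ← h5, ENNReal.ofReal_pow (by positivity), sq (ENNReal.ofReal _), mul_assoc] at h4
  exact (ENNReal.mul_right_inj (by simp) ENNReal.ofReal_ne_top).1 h4

theorem norm_mode_le (f : L2) (k l : ℤ) : ‖mode f k l‖ ≤ ‖f‖ := by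
  have h := enorm_sq_eq_tsum_modes f
  have h1 : ‖mode f k l‖ₑ ^ 2 ≤ ∑' k : ℤ, ∑' l : ℤ, ‖mode f k l‖ₑ ^ 2 :=
    (ENNReal.le_tsum l).trans (ENNReal.le_tsum (f := fun k => ∑' l : ℤ, ‖mode f k l‖ₑ ^ 2) k)
  have h2 : (1 : ℝ≥0∞) ≤ ENNReal.ofReal (4 * Real.pi ^ 2) := by
    rw [ENNReal.one_le_ofReal]
    nlinarith [Real.pi_gt_three]
  have h3 : ‖mode f k l‖ₑ ^ 2 ≤ ‖f‖ₑ ^ 2 := by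
    rw [h]
    exact h1.trans (le_mul_of_one_le_left zero_le h2)
  have h4 := (ENNReal.pow_le_pow_left_iff two_ne_zero).1 h3
  rwa [← ofReal_norm, ← ofReal_norm, ENNReal.ofReal_le_ofReal_iff (norm_nonneg _)] at h4

theorem continuous_mode (k l : ℤ) : Continuous (fun f : L2 => mode f k l) := by
  refine LipschitzWith.continuous (K := 1) (LipschitzWith.of_dist_le_mul fun f g => ?_)
  rw [dist_eq_norm, dist_eq_norm, ← mode_sub, NNReal.coe_one, one_mul]
  exact norm_mode_le _ _ _

theorem sobolevNorm_sq (s : ℝ) (f : L2) :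
    sobolevNorm s f ^ 2 = ENNReal.ofReal (4 * Real.pi ^ 2) * ∑' k : ℤ, ∑' l : ℤ, ∫⁻ ξ : ℝ,
      ENNReal.ofReal ((1 + waveSq k (2 * Real.pi * ξ) l) ^ s) * ‖fourierL2 f k l ξ‖ₑ ^ 2 := by
  rw [sobolevNorm, ← ENNReal.rpow_natCast, ← ENNReal.rpow_mul]
  norm_num

theorem enorm_sq_eq_tsum_fourierL2 (f : L2) :
    ‖f‖ₑ ^ 2 = ENNReal.ofReal (4 * Real.pi ^ 2) *
      ∑' k : ℤ, ∑' l : ℤ, ∫⁻ ξ : ℝ, ‖fourierL2 f k l ξ‖ₑ ^ 2 := by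
  rw [enorm_sq_eq_tsum_modes]
  congr 1
  refine tsum_congr fun k => tsum_congr fun l => ?_
  rw [lintegral_enorm_sq_toLp, fourierL2_eq, LinearIsometryEquiv.enorm_map]

/-! ### Modes of the projection onto nonzero frequencies -/

theorem integral_fourier_neg (k : ℤ) :
    ∫ x : Circ, fourier (-k) x = if k = 0 then (2 * Real.pi : ℂ) else 0 := by
  have h := integral_circ_eq (fun x => fourier 0 x) k
  rw [fourierCoeff_fourier] at h
  simp only [fourier_zero, mul_one] at h
  rw [h]
  by_cases hk : k = 0 <;> simp [hk]

/-- The `x`-average factors out of the `x`-integral, which leaves the integral of a character: `2π`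
at `k = 0`, zero otherwise. -/
theorem mode_nonzeroModes (f : L2) (k l : ℤ) :
    mode (nonzeroModes f) k l = if k = 0 then 0 else mode f k l := by
  have key : mode ((memLp_zeroModeFun f).toLp _) k l = if k = 0 then mode f k l else 0 := by
    refine ext_inner_left ℂ fun w => ?_
    refine mul_left_cancel₀ four_pi_sq_ne_zero ?_
    have hw : MemLp (fun y => conj (w y)) 2 (volume : Measure ℝ) := (Lp.memLp w).star
    rw [← pair_tensor_inner]
    have e1 : pair ((memLp_zeroModeFun f).toLp _) (tensor k l fun y => conj (w y)) =
        ∫ p : Dom, ((zeroModeFun f p : ℝ) : ℂ) * tensor k l (fun y => conj (w y)) p := by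
      refine integral_congr_ae ?_
      filter_upwards [(memLp_zeroModeFun f).coeFn_toLp] with p hp
      rw [hp]
    have i1 : Integrable (fun p : Dom => ((zeroModeFun f p : ℝ) : ℂ) *
        tensor k l (fun y => conj (w y)) p) :=
      MemLp.integrable_mul (MemLp.ofReal (memLp_zeroModeFun f)) (memLp_tensor k l hw)
    rw [e1, integral_dom i1]
    have e2 : ∀ y z, ∫ x : Circ, ((zeroModeFun f (x, y, z) : ℝ) : ℂ) *
        tensor k l (fun y => conj (w y)) (x, y, z) =
        if k = 0 then ∫ x : Circ, ((f (x, y, z) : ℝ) : ℂ) *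
          tensor k l (fun y => conj (w y)) (x, y, z) else 0 := by
      intro y z
      have : ∀ x : Circ, ((zeroModeFun f (x, y, z) : ℝ) : ℂ) *
          tensor k l (fun y => conj (w y)) (x, y, z) =
          fourier (-k) x * ((((2 * Real.pi)⁻¹ * ∫ x : Circ, f (x, y, z) : ℝ) : ℂ) *
            (conj (w y) * fourier (-l) z)) := by
        intro x
        simp only [zeroModeFun, tensor]
        ring
      simp only [this]
      rw [integral_mul_const, integral_fourier_neg]
      split_ifs with hk
      · subst hk
        have hpi : (Real.pi : ℂ) ≠ 0 := by exact_mod_cast Real.pi_ne_zero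
        simp only [tensor, neg_zero, fourier_zero, one_mul]
        rw [integral_mul_const, integral_complex_ofReal]
        push_cast
        field_simp
      · rw [zero_mul]
    simp only [e2]
    split_ifs with hk
    · rw [← pair_tensor_inner, pair, integral_dom (integrable_mul_tensor f k l hw)]
    · simp
  rw [nonzeroModes, mode_sub, key]
  split_ifs <;> simp

theorem fourierL2_nonzeroModes (f : L2) (k l : ℤ) :
    fourierL2 (nonzeroModes f) k l = if k = 0 then 0 else fourierL2 f k l := by
  rw [fourierL2_eq, mode_nonzeroModes, fourierL2_eq]
  split_ifs <;> simp

/-! ### Smooth compactly supported functions of one variable -/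

/-- Smooth compactly supported functions on `ℝ`. -/
structure IsBump (w : ℝ → ℂ) : Prop where
  smooth : ContDiff ℝ ∞ w
  compact : HasCompactSupport w

theorem IsBump.memLp {w : ℝ → ℂ} (hw : IsBump w) : MemLp w 2 (volume : Measure ℝ) :=
  hw.smooth.continuous.memLp_of_hasCompactSupport hw.compact

theorem IsBump.hasDerivAt {w : ℝ → ℂ} (hw : IsBump w) (y : ℝ) : HasDerivAt w (deriv w y) y :=
  (hw.smooth.differentiable (by simp)).differentiableAt.hasDerivAt

theorem IsBump.deriv {w : ℝ → ℂ} (hw : IsBump w) : IsBump (deriv w) :=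
  ⟨((contDiff_infty_iff_deriv).1 hw.smooth).2, hw.compact.deriv⟩

theorem IsBump.mul_left {w g : ℝ → ℂ} (hw : IsBump w) (hg : ContDiff ℝ ∞ g) :
    IsBump (fun y => g y * w y) :=
  ⟨hg.mul hw.smooth, hw.compact.mul_left⟩

theorem IsBump.conj {w : ℝ → ℂ} (hw : IsBump w) : IsBump (fun y => conj (w y)) :=
  ⟨Complex.conjCLE.contDiff.comp hw.smooth, hw.compact.comp_left (g := fun z : ℂ => conj z) (by simp)⟩

theorem IsBump.const_mul {w : ℝ → ℂ} (hw : IsBump w) (c : ℂ) : IsBump (fun y => c * w y) :=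
  hw.mul_left contDiff_const

theorem IsBump.add {w v : ℝ → ℂ} (hw : IsBump w) (hv : IsBump v) : IsBump (fun y => w y + v y) :=
  ⟨hw.smooth.add hv.smooth, hw.compact.add hv.compact⟩

theorem IsBump.ofReal_mul {w : ℝ → ℂ} (hw : IsBump w) : IsBump (fun y => (y : ℂ) * w y) :=
  hw.mul_left Complex.ofRealCLM.contDiff

/-- Modulation `e^{iξy} g(y)`. -/
def modulate (ξ : ℝ) (g : ℝ → ℂ) (y : ℝ) : ℂ := Complex.exp (((ξ * y : ℝ) : ℂ) * Complex.I) * g y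

theorem IsBump.modulate {g : ℝ → ℂ} (hg : IsBump g) (ξ : ℝ) : IsBump (modulate ξ g) := by
  refine hg.mul_left ?_
  refine Complex.contDiff_exp.comp (ContDiff.mul ?_ contDiff_const)
  exact Complex.ofRealCLM.contDiff.comp (contDiff_const.mul contDiff_id)

theorem norm_modulate (ξ : ℝ) (g : ℝ → ℂ) (y : ℝ) : ‖modulate ξ g y‖ = ‖g y‖ := by
  rw [modulate, norm_mul, Complex.norm_exp_ofReal_mul_I, one_mul]

theorem deriv_modulate {g : ℝ → ℂ} (hg : IsBump g) (ξ : ℝ) :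
    deriv (modulate ξ g) =
      fun y => ((ξ : ℂ) * Complex.I) * modulate ξ g y + modulate ξ (deriv g) y := by
  ext y
  have h1 : HasDerivAt (fun y : ℝ => Complex.exp (((ξ * y : ℝ) : ℂ) * Complex.I))
      (Complex.exp (((ξ * y : ℝ) : ℂ) * Complex.I) * ((ξ : ℂ) * Complex.I)) y := by
    refine HasDerivAt.cexp ?_
    have := ((hasDerivAt_id y).const_mul ξ).ofReal_comp.mul_const Complex.I
    simpa using this
  have h2 := h1.mul (hg.hasDerivAt y)
  rw [show modulate ξ g = (fun y : ℝ => Complex.exp (((ξ * y : ℝ) : ℂ) * Complex.I)) * g from rfl,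
    h2.deriv]
  simp only [modulate, Pi.mul_apply]
  ring

/-- The first term carries the symbol of the Laplacian. The others contain a derivative of `g` and
become truncation errors. -/
theorem deriv_deriv_modulate {g : ℝ → ℂ} (hg : IsBump g) (ξ : ℝ) :
    deriv (deriv (modulate ξ g)) = fun y => -((ξ : ℂ) ^ 2) * modulate ξ g y +
      ((2 * ξ * Complex.I) * modulate ξ (deriv g) y + modulate ξ (deriv (deriv g)) y) := by
  ext y
  rw [deriv_modulate hg]
  have h1 := ((hg.modulate ξ).hasDerivAt y).const_mul ((ξ : ℂ) * Complex.I)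
  have h2 := (hg.deriv.modulate ξ).hasDerivAt y
  refine (h1.add h2).deriv.trans ?_
  rw [deriv_modulate hg, deriv_modulate hg.deriv]
  ring_nf
  simp only [Complex.I_sq]
  ring

/-! ### The pairing of a function with an element of `L²(ℝ)` -/

/-- `⟨w, g⟩ = ∫ conj(w) g`. -/
def ip (w : ℝ → ℂ) (g : Lp ℂ 2 (volume : Measure ℝ)) : ℂ := ∫ y, conj (w y) * g y

theorem ip_eq_inner {w : ℝ → ℂ} (hw : MemLp w 2 (volume : Measure ℝ))
    (g : Lp ℂ 2 (volume : Measure ℝ)) : ip w g = inner ℂ (hw.toLp w) g := by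
  rw [L2.inner_def, ip]
  refine integral_congr_ae ?_
  filter_upwards [hw.coeFn_toLp] with y hy
  rw [hy, RCLike.inner_apply, mul_comm]

theorem ip_add {w v : ℝ → ℂ} (hw : MemLp w 2 (volume : Measure ℝ))
    (hv : MemLp v 2 (volume : Measure ℝ)) (g : Lp ℂ 2 (volume : Measure ℝ)) :
    ip (fun y => w y + v y) g = ip w g + ip v g := by
  rw [ip_eq_inner hw, ip_eq_inner hv, ip_eq_inner (w := fun y => w y + v y) (hw.add hv),
    ← inner_add_left]
  rfl

theorem ip_const_mul (c : ℂ) (w : ℝ → ℂ) (g : Lp ℂ 2 (volume : Measure ℝ)) :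
    ip (fun y => c * w y) g = conj c * ip w g := by
  rw [ip, ip, ← integral_const_mul]
  simp only [map_mul, mul_assoc]

/-- The `L²` norm of a function, as a real number. -/
def l2norm (w : ℝ → ℂ) : ℝ := (eLpNorm w 2 (volume : Measure ℝ)).toReal

theorem norm_ip_le {w : ℝ → ℂ} (hw : MemLp w 2 (volume : Measure ℝ))
    (g : Lp ℂ 2 (volume : Measure ℝ)) : ‖ip w g‖ ≤ l2norm w * ‖g‖ := by
  rw [ip_eq_inner hw]
  refine (norm_inner_le_norm _ _).trans (le_of_eq ?_)
  rw [Lp.norm_toLp, l2norm]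

theorem continuousOn_ip {w : ℝ → ℂ} (hw : MemLp w 2 (volume : Measure ℝ)) {s : Set ℝ}
    {g : ℝ → Lp ℂ 2 (volume : Measure ℝ)} (hg : ContinuousOn g s) :
    ContinuousOn (fun t => ip w (g t)) s := by
  simp only [ip_eq_inner hw]
  exact ContinuousOn.inner (𝕜 := ℂ) continuousOn_const hg

theorem pair_tensor_conj (f : L2) (k l : ℤ) {w : ℝ → ℂ} (hw : MemLp w 2 (volume : Measure ℝ)) :
    pair f (tensor k l (fun y => conj (w y))) = (4 * Real.pi ^ 2 : ℂ) * ip w (mode f k l) := by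
  have hw' : MemLp (fun y => conj (w y)) 2 (volume : Measure ℝ) := hw.star
  rw [pair_tensor f k l hw', ip]
  congr 1
  refine integral_congr_ae ?_
  filter_upwards [(memLp_modeFun f k l).coeFn_toLp] with y hy
  simp only [mode, hy, mul_comm]

/-! ### Separated test functions -/

theorem isTest_tensor (k l : ℤ) {ψ : ℝ → ℂ} (hψ : IsBump ψ) : IsTest (tensor k l ψ) := by
  refine ⟨?_, ?_⟩
  · have h : ∀ m : ℤ, ContDiff ℝ ∞ (fun x : ℝ => fourier m (x : Circ)) := by
      intro m
      simp_rw [fourier_coe_apply]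
      refine Complex.contDiff_exp.comp ?_
      exact (contDiff_const.mul Complex.ofRealCLM.contDiff).div_const _
    exact ((h (-k)).comp contDiff_fst).mul
      ((hψ.smooth.comp (contDiff_fst.comp contDiff_snd)).mul
        ((h (-l)).comp (contDiff_snd.comp contDiff_snd)))
  · refine HasCompactSupport.intro (K := univ ×ˢ (tsupport ψ ×ˢ univ))
      (isCompact_univ.prod (hψ.compact.isCompact.prod isCompact_univ)) fun p hp => ?_
    have : p.2.1 ∉ tsupport ψ := fun h => hp ⟨mem_univ _, h, mem_univ _⟩
    simp [tensor, image_eq_zero_of_notMem_tsupport this]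

theorem deriv_fourier_translate (k : ℤ) (x : Circ) (c : ℂ) :
    deriv (fun s : ℝ => fourier (-k) (x + (s : Circ)) * c) 0 =
      -(k * Complex.I) * (fourier (-k) x * c) := by
  have h := hasDerivAt_fourier (2 * Real.pi) (-k) 0
  have h2 : HasDerivAt (fun s : ℝ => fourier (-k) (x + (s : Circ)) * c)
      (fourier (-k) x * (-(k * Complex.I)) * c) 0 := by
    have e : (fun s : ℝ => fourier (-k) (x + (s : Circ)) * c) =
        fun s : ℝ => fourier (-k) x * fourier (-k) (s : Circ) * c := by
      ext s
      rw [fourier_apply, zsmul_add, AddCircle.toCircle_add, Circle.coe_mul, ← fourier_apply,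
        ← fourier_apply]
    rw [e]
    refine ((h.const_mul (fourier (-k) x)).mul_const c).congr_deriv ?_
    have hpi : (Real.pi : ℂ) ≠ 0 := by exact_mod_cast Real.pi_ne_zero
    rw [QuotientAddGroup.mk_zero, fourier_eval_zero]
    push_cast
    field_simp
  rw [h2.deriv]
  ring

theorem dX_tensor (k l : ℤ) (ψ : ℝ → ℂ) :
    dX (tensor k l ψ) = tensor k l (fun y => -(k * Complex.I) * ψ y) := by
  ext p
  simp only [dX, tensor]
  rw [deriv_fourier_translate]
  ring

theorem dZ_tensor (k l : ℤ) (ψ : ℝ → ℂ) :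
    dZ (tensor k l ψ) = tensor k l (fun y => -(l * Complex.I) * ψ y) := by
  ext p
  simp only [dZ, tensor]
  rw [show (fun s : ℝ => fourier (-k) p.1 * (ψ p.2.1 * fourier (-l) (p.2.2 + (s : Circ)))) =
    fun s : ℝ => fourier (-l) (p.2.2 + (s : Circ)) * (fourier (-k) p.1 * ψ p.2.1) by
      ext s; ring, deriv_fourier_translate]
  ring

theorem dY_tensor (k l : ℤ) {ψ : ℝ → ℂ} (hψ : IsBump ψ) :
    dY (tensor k l ψ) = tensor k l (deriv ψ) := by
  ext p
  simp only [dY, tensor]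
  exact (((hψ.hasDerivAt p.2.1).mul_const _).const_mul _).deriv

theorem lap_tensor (k l : ℤ) {ψ : ℝ → ℂ} (hψ : IsBump ψ) :
    lap (tensor k l ψ) =
      tensor k l (fun y => deriv (deriv ψ) y + (-((k : ℂ) ^ 2 + (l : ℂ) ^ 2)) * ψ y) := by
  ext p
  simp only [lap, dX_tensor, dZ_tensor, dY_tensor k l hψ, dY_tensor k l hψ.deriv]
  simp only [tensor]
  ring_nf
  simp only [Complex.I_sq]
  ring

theorem deriv_conj {w : ℝ → ℂ} (hw : IsBump w) :
    deriv (fun y => conj (w y)) = fun y => conj (deriv w y) := by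
  ext y
  exact ((Complex.conjCLE.toContinuousLinearMap.hasFDerivAt).comp_hasDerivAt y
    (hw.hasDerivAt y)).deriv

theorem y_dX_tensor_conj (k l : ℤ) (w : ℝ → ℂ) :
    (fun p : Dom => (p.2.1 : ℂ) * dX (tensor k l (fun y => conj (w y))) p) =
      tensor k l (fun y => conj ((k * Complex.I) * ((y : ℂ) * w y))) := by
  ext p
  rw [dX_tensor]
  simp only [tensor, map_mul, Complex.conj_I, Complex.conj_ofReal, map_intCast]
  ring

theorem lap_tensor_conj (k l : ℤ) {w : ℝ → ℂ} (hw : IsBump w) :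
    lap (tensor k l (fun y => conj (w y))) = tensor k l
      (fun y => conj (deriv (deriv w) y + (-((k : ℂ) ^ 2 + (l : ℂ) ^ 2)) * w y)) := by
  rw [lap_tensor k l hw.conj, deriv_conj hw, deriv_conj hw.deriv]
  congr 1
  ext y
  simp

/-! ### Differentiating time-dependent pairings -/

/-- A product rule in which `v` is merely continuous, and differentiable only against the frozen
vector `w s`. After writing `w r = (w r - w s) + w s`, the difference quotient of `w` converges in
norm, so continuity of `v` suffices for the first part. -/
theorem hasDerivAt_inner_of_weak {H : Type*} [NormedAddCommGroup H] [InnerProductSpace ℂ H]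
    {w v : ℝ → H} {w' : H} {D : ℂ} {s : ℝ} (hv : ContinuousAt v s) (hw : HasDerivAt w w' s)
    (hD : HasDerivAt (fun r => inner ℂ (w s) (v r)) D s) :
    HasDerivAt (fun r => inner ℂ (w r) (v r)) (inner ℂ w' (v s) + D) s := by
  have h : HasDerivAt (fun r => inner ℂ (w r - w s) (v r)) (inner ℂ w' (v s)) s := by
    rw [hasDerivAt_iff_tendsto_slope] at hw ⊢
    have h1 := hw.inner (𝕜 := ℂ) (hv.tendsto.mono_left (nhdsWithin_le_nhds (s := {s}ᶜ)))
    refine h1.congr fun r => ?_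
    simp only [slope, vsub_eq_sub, sub_self, inner_zero_left, sub_zero]
    rw [← Complex.coe_smul, inner_smul_left, Complex.conj_ofReal, Complex.real_smul]
  have h2 := h.add hD
  refine h2.congr_of_eventuallyEq (Eventually.of_forall fun r => ?_)
  simp only [Pi.add_apply, inner_sub_left, sub_add_cancel]

/-- Taylor's bound covers `|δ| ≤ 1` and the triangle inequality the rest. A bound for all `δ` is
needed because `δ` will be proportional to `y`. -/
theorem norm_exp_mul_I_sub_one_sub_le (δ : ℝ) :
    ‖Complex.exp ((δ : ℂ) * Complex.I) - 1 - (δ : ℂ) * Complex.I‖ ≤ 3 * δ ^ 2 := by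
  have hn : ‖(δ : ℂ) * Complex.I‖ = |δ| := by simp
  by_cases h : |δ| ≤ 1
  · have := Complex.norm_exp_sub_one_sub_id_le (x := (δ : ℂ) * Complex.I) (by rwa [hn])
    rw [hn, sq_abs] at this
    nlinarith [sq_nonneg δ]
  · have h1 : ‖Complex.exp ((δ : ℂ) * Complex.I) - 1 - (δ : ℂ) * Complex.I‖ ≤ 1 + 1 + |δ| := by
      refine (norm_sub_le _ _).trans ?_
      rw [hn]
      gcongr
      refine (norm_sub_le _ _).trans ?_
      rw [Complex.norm_exp_ofReal_mul_I, norm_one]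
    push Not at h
    nlinarith [sq_abs δ]

/-- The element of `L²` represented by a modulated bump. -/
def IsBump.curve {g : ℝ → ℂ} (hg : IsBump g) (ξ : ℝ) : Lp ℂ 2 (volume : Measure ℝ) :=
  (hg.modulate ξ).memLp.toLp _

/-- The derivative is taken in the norm of `L²`: the Taylor remainder is pointwise at most `3 k² (r
- s)² y² |g|`, and `y² g` is again a bump. -/
theorem hasDerivAt_modulate_curve {g : ℝ → ℂ} (hg : IsBump g) (a k s : ℝ) :
    HasDerivAt (fun r => hg.curve (a - k * r))
      (((hg.ofReal_mul.modulate (a - k * s)).const_mul (-(k * Complex.I))).memLp.toLp _) s := by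
  have hm : MemLp (fun y : ℝ => (y : ℂ) * ((y : ℂ) * g y)) 2 (volume : Measure ℝ) :=
    hg.ofReal_mul.ofReal_mul.memLp
  set W := ((hg.ofReal_mul.modulate (a - k * s)).const_mul (-(k * Complex.I))).memLp.toLp _
  have key : ∀ r, ‖hg.curve (a - k * r) - hg.curve (a - k * s) - (r - s) • W‖ ≤
      3 * k ^ 2 * (r - s) ^ 2 * ‖hm.toLp _‖ := by
    intro r
    refine Lp.norm_le_mul_norm_of_ae_le_mul ?_
    filter_upwards [Lp.coeFn_sub (hg.curve (a - k * r) - hg.curve (a - k * s)) ((r - s) • W),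
      Lp.coeFn_sub (hg.curve (a - k * r)) (hg.curve (a - k * s)), Lp.coeFn_smul (r - s) W,
      ((hg.ofReal_mul.modulate (a - k * s)).const_mul (-(k * Complex.I))).memLp.coeFn_toLp,
      (hg.modulate (a - k * r)).memLp.coeFn_toLp, (hg.modulate (a - k * s)).memLp.coeFn_toLp,
      hm.coeFn_toLp] with y h1 h2 h3 h4 h5 h6 h7
    rw [h1, Pi.sub_apply, h2, Pi.sub_apply, h3, Pi.smul_apply, h4, h7]
    rw [IsBump.curve, IsBump.curve, h5, h6]
    have e : modulate (a - k * r) g y - modulate (a - k * s) g y -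
        (r - s) • (-(k * Complex.I) * modulate (a - k * s) (fun y => (y : ℂ) * g y) y) =
        Complex.exp ((((a - k * s) * y : ℝ) : ℂ) * Complex.I) *
        ((Complex.exp (((-(k * (r - s) * y) : ℝ) : ℂ) * Complex.I) - 1 -
          ((-(k * (r - s) * y) : ℝ) : ℂ) * Complex.I) * g y) := by
      have : Complex.exp ((((a - k * r) * y : ℝ) : ℂ) * Complex.I) =
          Complex.exp ((((a - k * s) * y : ℝ) : ℂ) * Complex.I) *
          Complex.exp (((-(k * (r - s) * y) : ℝ) : ℂ) * Complex.I) := by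
        rw [← Complex.exp_add]
        congr 1
        push_cast
        ring
      simp only [modulate, this, Complex.real_smul]
      push_cast
      ring
    rw [e, norm_mul, norm_mul, Complex.norm_exp_ofReal_mul_I, one_mul]
    refine (mul_le_mul_of_nonneg_right (norm_exp_mul_I_sub_one_sub_le _) (norm_nonneg _)).trans ?_
    rw [norm_mul, norm_mul, Complex.norm_real, Real.norm_eq_abs]
    refine le_of_eq ?_
    rw [← mul_assoc |y|, abs_mul_abs_self]
    ring
  rw [hasDerivAt_iff_isLittleO]
  refine Asymptotics.IsBigO.trans_isLittleO (g := fun r => (r - s) ^ 2) ?_ ?_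
  · refine Asymptotics.IsBigO.of_bound (3 * k ^ 2 * ‖hm.toLp _‖) (Eventually.of_forall fun r => ?_)
    refine (key r).trans (le_of_eq ?_)
    rw [Real.norm_eq_abs, abs_of_nonneg (sq_nonneg _)]
    ring
  · have : Tendsto (fun r : ℝ => r - s) (𝓝 s) (𝓝 0) := by
      have : Tendsto (fun r : ℝ => r - s) (𝓝 s) (𝓝 (s - s)) := by
        exact (continuous_id.sub continuous_const).tendsto s
      simpa using this
    simpa [sq] using
      (Asymptotics.isLittleO_one_iff ℝ |>.2 this).mul_isBigO
        (Asymptotics.isBigO_refl (fun r : ℝ => r - s) (𝓝 s))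

/-- Moving the modulation produces the term with `y`, which is opposite to the contribution of the
transport `y ∂_x`; the two cancel in `hasDerivAt_ip_of_weak`. -/
theorem hasDerivAt_ip_modulate {g : ℝ → ℂ} (hg : IsBump g) (a k : ℝ) {s : ℝ}
    {v : ℝ → Lp ℂ 2 (volume : Measure ℝ)} {D : ℂ} (hv : ContinuousAt v s)
    (hD : HasDerivAt (fun r => ip (modulate (a - k * s) g) (v r)) D s) :
    HasDerivAt (fun r => ip (modulate (a - k * r) g) (v r))
      ((k * Complex.I) * ip (fun y => (y : ℂ) * modulate (a - k * s) g y) (v s) + D) s := by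
  simp only [fun r => ip_eq_inner (hg.modulate (a - k * s)).memLp (v r)] at hD
  have h := hasDerivAt_inner_of_weak hv (hasDerivAt_modulate_curve hg a k s) hD
  simp only [fun r => ip_eq_inner (hg.modulate (a - k * r)).memLp (v r)]
  refine h.congr_deriv ?_
  congr 1
  rw [← ip_eq_inner, ip_const_mul]
  have : modulate (a - k * s) (fun y => (y : ℂ) * g y) =
      fun y : ℝ => (y : ℂ) * modulate (a - k * s) g y := by
    ext y
    simp only [modulate]
    ring
  rw [this]
  simp

/-- A weak solution of a scalar transport-diffusion equation, tested against a modulated bump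
moving along characteristics. -/
theorem hasDerivAt_ip_of_weak {f : ℝ → L2} (hf : ContinuousOn f (Ici 0)) (μ : ℝ) (k l : ℤ)
    {R : ℝ → (Dom → ℂ) → ℂ} {ρ : ℝ → (ℝ → ℂ) → ℂ}
    (hweak : ∀ φ : Dom → ℂ, IsTest φ → ∀ t, 0 ≤ t → pair (f t) φ = pair (f 0) φ +
      ∫ s in (0 : ℝ)..t, (pair (f s) (fun p => (p.2.1 : ℂ) * dX φ p) + R s φ +
        μ * pair (f s) (lap φ)))
    (hR : ∀ w, IsBump w → ∀ s, 0 ≤ s →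
      R s (tensor k l (fun y => conj (w y))) = (4 * Real.pi ^ 2 : ℂ) * ρ s w)
    (hρ : ∀ w, IsBump w → ContinuousOn (fun s => ρ s w) (Ici 0))
    {g : ℝ → ℂ} (hg : IsBump g) (a : ℝ) {s : ℝ} (hs : 0 < s) :
    HasDerivAt (fun r => ip (modulate (a - k * r) g) (mode (f r) k l))
      (ρ s (modulate (a - k * s) g)
        - μ * waveSq k (a - k * s) l * ip (modulate (a - k * s) g) (mode (f s) k l)
        + μ * ip (fun y => (2 * ((a - k * s : ℝ) : ℂ) * Complex.I) *
            modulate (a - k * s) (deriv g) y +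
          modulate (a - k * s) (deriv (deriv g)) y) (mode (f s) k l)) s := by
  have hm : ContinuousOn (fun r => mode (f r) k l) (Ici 0) :=
    (continuous_mode k l).comp_continuousOn hf
  set ξ := a - k * s with hξ
  set w := modulate ξ g with hw_def
  have hw : IsBump w := hg.modulate ξ
  set w2 : ℝ → ℂ := fun y => deriv (deriv w) y + (-((k : ℂ) ^ 2 + (l : ℂ) ^ 2)) * w y
    with hw2_def
  have hw2 : IsBump w2 := hw.deriv.deriv.add (hw.const_mul _)
  set F : ℝ → ℂ := fun r => -(k * Complex.I) * ip (fun y => (y : ℂ) * w y) (mode (f r) k l)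
    + ρ r w + μ * ip w2 (mode (f r) k l) with hF
  have hFc : ContinuousOn F (Ici 0) :=
    ((continuousOn_const.mul (continuousOn_ip hw.ofReal_mul.memLp hm)).add (hρ w hw)).add
      (continuousOn_const.mul (continuousOn_ip hw2.memLp hm))
  have hint : ∀ t, 0 ≤ t → ip w (mode (f t) k l) = ip w (mode (f 0) k l) + ∫ r in (0 : ℝ)..t, F r := by
    intro t ht
    have h := hweak _ (isTest_tensor k l hw.conj) t ht
    rw [pair_tensor_conj _ _ _ hw.memLp, pair_tensor_conj _ _ _ hw.memLp] at h
    have e : ∫ r in (0 : ℝ)..t, (pair (f r) (fun p => (p.2.1 : ℂ) *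
          dX (tensor k l (fun y => conj (w y))) p) + R r (tensor k l (fun y => conj (w y))) +
          μ * pair (f r) (lap (tensor k l (fun y => conj (w y))))) =
        ∫ r in (0 : ℝ)..t, (4 * Real.pi ^ 2 : ℂ) * F r := by
      refine intervalIntegral.integral_congr fun r hr => ?_
      rw [uIcc_of_le ht] at hr
      rw [y_dX_tensor_conj, lap_tensor_conj k l hw, hR w hw r hr.1,
        pair_tensor_conj _ _ _ (hw.ofReal_mul.const_mul _).memLp,
        pair_tensor_conj (w := w2) _ _ _ hw2.memLp, ip_const_mul, hF]
      simp only [map_mul, Complex.conj_I, map_intCast]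
      ring
    rw [e, intervalIntegral.integral_const_mul, ← mul_add] at h
    exact mul_left_cancel₀ four_pi_sq_ne_zero h
  have hcs : ContinuousAt F s := hFc.continuousAt (Ici_mem_nhds hs)
  -- With the test function frozen at time `s`, the weak formulation is an integral identity with
  -- continuous integrand, so the fundamental theorem of calculus applies at the interior time `s >
  -- 0`.
  have hD : HasDerivAt (fun r => ip w (mode (f r) k l)) (F s) s := by
    have h1 : HasDerivAt (fun t => ∫ r in (0 : ℝ)..t, F r) (F s) s := by
      refine intervalIntegral.integral_hasDerivAt_right ?_ ?_ hcs
      · refine ContinuousOn.intervalIntegrable (hFc.mono ?_)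
        rw [uIcc_of_le hs.le]
        exact Icc_subset_Ici_self
      · exact ContinuousOn.stronglyMeasurableAtFilter isOpen_Ioi
          (hFc.mono Ioi_subset_Ici_self) s hs
    refine (h1.const_add (ip w (mode (f 0) k l))).congr_of_eventuallyEq ?_
    filter_upwards [Ioi_mem_nhds hs] with r hr
    exact hint r (le_of_lt hr)
  have hfin := hasDerivAt_ip_modulate hg a k (hm.continuousAt (Ici_mem_nhds hs)) hD
  refine hfin.congr_deriv ?_
  rw [← hξ, ← hw_def]
  -- The `-ξ²` from the modulation joins `-(k² + l²)` to form `-waveSq`.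
  have e2 : w2 = fun y => (-(((ξ : ℂ) ^ 2) + ((k : ℂ) ^ 2 + (l : ℂ) ^ 2))) * w y +
      ((2 * (ξ : ℂ) * Complex.I) * modulate ξ (deriv g) y + modulate ξ (deriv (deriv g)) y) := by
    ext y
    rw [hw2_def, hw_def, deriv_deriv_modulate hg]
    simp only
    ring
  have h3 : IsBump (fun y => (2 * (ξ : ℂ) * Complex.I) * modulate ξ (deriv g) y +
      modulate ξ (deriv (deriv g)) y) :=
    ((hg.deriv.modulate ξ).const_mul _).add (hg.deriv.deriv.modulate ξ)
  rw [hF]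
  simp only
  rw [e2, ip_add (hw.const_mul _).memLp h3.memLp, ip_const_mul]
  simp only [map_neg, map_add, map_pow, Complex.conj_ofReal, map_intCast, waveSq]
  push_cast
  ring

/-! ### The Fourier transform of bumps -/

theorem IsBump.fourier_eq {w : ℝ → ℂ} (hw : IsBump w) :
    Lp.fourierTransformₗᵢ ℝ ℂ (hw.memLp.toLp w) =
      (𝓕 (hw.compact.toSchwartzMap hw.smooth)).toLp 2 := by
  have h := SchwartzMap.toLp_fourier_eq (hw.compact.toSchwartzMap hw.smooth)
  rw [← h]
  rfl

theorem IsBump.fourier_coe {w : ℝ → ℂ} (hw : IsBump w) :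
    ⇑(𝓕 (hw.compact.toSchwartzMap hw.smooth) : SchwartzMap ℝ ℂ) = 𝓕 w := by
  rw [SchwartzMap.fourier_coe]
  rfl

theorem IsBump.memLp_fourier {w : ℝ → ℂ} (hw : IsBump w) :
    MemLp (𝓕 w) 2 (volume : Measure ℝ) := by
  rw [← hw.fourier_coe]
  exact (𝓕 (hw.compact.toSchwartzMap hw.smooth) : SchwartzMap ℝ ℂ).memLp 2

/-- A bump is a Schwartz function, and there the `L²` transform is the Fourier integral. -/
theorem IsBump.fourier_toLp {w : ℝ → ℂ} (hw : IsBump w) :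
    Lp.fourierTransformₗᵢ ℝ ℂ (hw.memLp.toLp w) = hw.memLp_fourier.toLp (𝓕 w) := by
  rw [hw.fourier_eq]
  refine Lp.ext ?_
  filter_upwards [hw.memLp_fourier.coeFn_toLp,
    (𝓕 (hw.compact.toSchwartzMap hw.smooth) : SchwartzMap ℝ ℂ).coeFn_toLp 2 volume] with ζ h1 h2
  rw [h1, h2, hw.fourier_coe]

theorem l2norm_eq_norm {w : ℝ → ℂ} (hw : MemLp w 2 (volume : Measure ℝ)) :
    l2norm w = ‖hw.toLp w‖ := by
  rw [Lp.norm_toLp, l2norm]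

theorem l2norm_nonneg (w : ℝ → ℂ) : 0 ≤ l2norm w := ENNReal.toReal_nonneg

theorem IsBump.l2norm_fourier {w : ℝ → ℂ} (hw : IsBump w) : l2norm (𝓕 w) = l2norm w := by
  rw [l2norm_eq_norm hw.memLp, l2norm_eq_norm hw.memLp_fourier, ← hw.fourier_toLp,
    LinearIsometryEquiv.norm_map]

theorem IsBump.ip_fourier {w : ℝ → ℂ} (hw : IsBump w) (g : Lp ℂ 2 (volume : Measure ℝ)) :
    ip (𝓕 w) (Lp.fourierTransformₗᵢ ℝ ℂ g) = ip w g := by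
  rw [ip_eq_inner hw.memLp, ip_eq_inner hw.memLp_fourier, ← hw.fourier_toLp,
    LinearIsometryEquiv.inner_map_map]

theorem l2norm_le_mul {f g : ℝ → ℂ} {C : ℝ} (hC : 0 ≤ C) (hg : MemLp g 2 (volume : Measure ℝ))
    (h : ∀ y, ‖f y‖ ≤ C * ‖g y‖) : l2norm f ≤ C * l2norm g := by
  have h1 := eLpNorm_le_mul_eLpNorm_of_ae_le_mul (μ := (volume : Measure ℝ))
    (Eventually.of_forall h) 2
  have h2 := ENNReal.toReal_mono (ENNReal.mul_ne_top ENNReal.ofReal_ne_top hg.2.ne) h1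
  rwa [ENNReal.toReal_mul, ENNReal.toReal_ofReal hC] at h2

theorem l2norm_modulate (ξ : ℝ) (g : ℝ → ℂ) : l2norm (modulate ξ g) = l2norm g := by
  rw [l2norm, l2norm]
  congr 1
  exact eLpNorm_congr_norm_ae (Eventually.of_forall fun y => norm_modulate ξ g y)

theorem IsBump.integrable {w : ℝ → ℂ} (hw : IsBump w) : Integrable w :=
  hw.smooth.continuous.integrable_of_hasCompactSupport hw.compact

/-- The derivative of the envelope measures the distance between the frequency `2πζ` and the carrier
`ξ`; this is what makes the commutator estimate work. -/
theorem fourier_modulate_deriv {g : ℝ → ℂ} (hg : IsBump g) (ξ ζ : ℝ) :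
    𝓕 (modulate ξ (deriv g)) ζ =
      ((2 * Real.pi * ζ - ξ : ℝ) : ℂ) * Complex.I * 𝓕 (modulate ξ g) ζ := by
  have hw := hg.modulate ξ
  have h := congrFun (Real.fourier_deriv hw.integrable (hw.smooth.differentiable (by simp))
    hw.deriv.integrable) ζ
  have e : modulate ξ (deriv g) =
      deriv (modulate ξ g) + (fun y => (-((ξ : ℂ) * Complex.I)) • modulate ξ g y) := by
    rw [deriv_modulate hg]
    ext y
    simp
  have e2 : 𝓕 (modulate ξ (deriv g)) ζ =
      𝓕 (deriv (modulate ξ g)) ζ + (-((ξ : ℂ) * Complex.I)) * 𝓕 (modulate ξ g) ζ := by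
    rw [e, Real.fourier_eq, Real.fourier_eq, Real.fourier_eq, ← integral_const_mul, ← integral_add]
    · congr 1
      ext y
      simp only [Pi.add_apply, smul_add, smul_eq_mul, Circle.smul_def]
      ring
    · exact (Real.fourierIntegral_convergent_iff ζ).2 hw.deriv.integrable
    · exact ((Real.fourierIntegral_convergent_iff ζ).2 hw.integrable).const_mul _
  rw [e2, h, smul_eq_mul]
  push_cast
  ring

/-- The commutator of a Lipschitz Fourier multiplier with a slowly varying cutoff is small. -/
theorem norm_ip_multiplier_sub_le {m : ℝ → ℝ} (hm : Continuous m) {B C : ℝ} (hC : 0 ≤ C)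
    (hB : ∀ a, |m a| ≤ B) (hL : ∀ a b, |m a - m b| ≤ C * |a - b|) {g : ℝ → ℂ} (hg : IsBump g)
    (ξ : ℝ) (v : Lp ℂ 2 (volume : Measure ℝ)) :
    ‖ip (fun ζ : ℝ => (m (2 * Real.pi * ζ) : ℂ) * 𝓕 (modulate ξ g) ζ)
        (Lp.fourierTransformₗᵢ ℝ ℂ v) - m ξ * ip (modulate ξ g) v‖ ≤
      C * l2norm (deriv g) * ‖v‖ := by
  have hw := hg.modulate ξ
  have hmem : MemLp (fun ζ : ℝ => (m (2 * Real.pi * ζ) : ℂ) * 𝓕 (modulate ξ g) ζ) 2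
      (volume : Measure ℝ) := by
    refine hw.memLp_fourier.of_le_mul (c := B) ?_ (Eventually.of_forall fun ζ => ?_)
    · refine AEStronglyMeasurable.mul ?_ hw.memLp_fourier.1
      exact (Complex.continuous_ofReal.comp (hm.comp (continuous_const.mul
        continuous_id))).aestronglyMeasurable
    · rw [norm_mul, Complex.norm_real]
      gcongr
      exact hB _
  have hmem2 : MemLp (fun ζ : ℝ => (-(m ξ : ℂ)) * 𝓕 (modulate ξ g) ζ) 2 (volume : Measure ℝ) :=
    hw.memLp_fourier.const_mul _
  have e : ip (fun ζ : ℝ => (m (2 * Real.pi * ζ) : ℂ) * 𝓕 (modulate ξ g) ζ)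
        (Lp.fourierTransformₗᵢ ℝ ℂ v) - m ξ * ip (modulate ξ g) v =
      ip (fun ζ : ℝ => (m (2 * Real.pi * ζ) : ℂ) * 𝓕 (modulate ξ g) ζ +
        (-(m ξ : ℂ)) * 𝓕 (modulate ξ g) ζ) (Lp.fourierTransformₗᵢ ℝ ℂ v) := by
    rw [ip_add hmem hmem2, ip_const_mul, hw.ip_fourier]
    simp only [map_neg, Complex.conj_ofReal]
    ring
  rw [e]
  refine (norm_ip_le (hmem.add hmem2) _).trans ?_
  rw [LinearIsometryEquiv.norm_map, ← l2norm_modulate ξ (deriv g),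
    ← (hg.deriv.modulate ξ).l2norm_fourier]
  refine mul_le_mul_of_nonneg_right ?_ (norm_nonneg _)
  -- Pointwise, the Lipschitz bound gives a factor `|2πζ - ξ|`, and this times the transform of the
  -- modulated `g` is, in modulus, the transform of the modulated `deriv g`.
  refine l2norm_le_mul hC (hg.deriv.modulate ξ).memLp_fourier fun ζ => ?_
  rw [fourier_modulate_deriv hg, Pi.add_apply, ← add_mul, norm_mul, norm_mul, norm_mul, Complex.norm_I, mul_one,
    ← mul_assoc, ← sub_eq_add_neg, ← Complex.ofReal_sub, Complex.norm_real, Complex.norm_real]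
  gcongr
  exact hL _ _

/-! ### The pressure multipliers -/

theorem one_le_waveSq {k : ℤ} (hk : k ≠ 0) (η : ℝ) (l : ℤ) : 1 ≤ waveSq k η l := by
  have h : (1 : ℝ) ≤ (k : ℝ) ^ 2 := by
    have : (1 : ℤ) ≤ k ^ 2 := by
      have := sq_pos_of_ne_zero hk
      omega
    exact_mod_cast this
  rw [waveSq]
  nlinarith [sq_nonneg η, sq_nonneg (l : ℝ)]

/-- The symbol `k_i k_j / |k, η, l|²`. -/
def rieszSymbol (k l : ℤ) (i j : Fin 3) (η : ℝ) : ℝ := wave k η l i * wave k η l j / waveSq k η l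

theorem abs_wave_le (k : ℤ) (η : ℝ) (l : ℤ) (i : Fin 3) :
    |wave k η l i| ≤ Real.sqrt (waveSq k η l) := by
  refine Real.abs_le_sqrt ?_
  rw [waveSq]
  fin_cases i <;> simp [wave] <;> nlinarith [sq_nonneg (k : ℝ), sq_nonneg η, sq_nonneg (l : ℝ)]

theorem continuous_waveSq (k l : ℤ) : Continuous (fun η => waveSq k η l) := by
  unfold waveSq
  fun_prop

theorem continuous_rieszSymbol {k : ℤ} (hk : k ≠ 0) (l : ℤ) (i j : Fin 3) :
    Continuous (rieszSymbol k l i j) := by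
  have h : ∀ i : Fin 3, Continuous (fun η => wave k η l i) := by
    intro i
    fin_cases i <;> simp [wave] <;> fun_prop
  exact ((h i).mul (h j)).div (continuous_waveSq k l) fun η => by
    have := one_le_waveSq hk η l
    positivity

theorem abs_rieszSymbol_le {k : ℤ} (hk : k ≠ 0) (l : ℤ) (i j : Fin 3) (η : ℝ) :
    |rieszSymbol k l i j η| ≤ 1 := by
  have h := one_le_waveSq hk η l
  rw [rieszSymbol, abs_div, abs_mul, abs_of_pos (by linarith : 0 < waveSq k η l),
    div_le_one (by linarith)]
  have := mul_le_mul (abs_wave_le k η l i) (abs_wave_le k η l j) (abs_nonneg _)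
    (Real.sqrt_nonneg _)
  rwa [Real.mul_self_sqrt (by linarith)] at this

/-- Factor the difference of squares: `|a + b|` is at most the sum of the two norms. -/
theorem abs_sqrt_waveSq_sub_le {k : ℤ} (hk : k ≠ 0) (l : ℤ) (a b : ℝ) :
    |Real.sqrt (waveSq k a l) - Real.sqrt (waveSq k b l)| ≤ |a - b| := by
  have ha := one_le_waveSq hk a l
  have hb := one_le_waveSq hk b l
  have h1 : 0 < Real.sqrt (waveSq k a l) := Real.sqrt_pos.2 (by linarith)
  have h2 : 0 < Real.sqrt (waveSq k b l) := Real.sqrt_pos.2 (by linarith)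
  have e : (Real.sqrt (waveSq k a l) - Real.sqrt (waveSq k b l)) *
      (Real.sqrt (waveSq k a l) + Real.sqrt (waveSq k b l)) = (a - b) * (a + b) := by
    have e1 := Real.sq_sqrt (by linarith : 0 ≤ waveSq k a l)
    have e2 := Real.sq_sqrt (by linarith : 0 ≤ waveSq k b l)
    have : waveSq k a l - waveSq k b l = a ^ 2 - b ^ 2 := by simp only [waveSq]; ring
    nlinarith
  have h3 : |a + b| ≤ Real.sqrt (waveSq k a l) + Real.sqrt (waveSq k b l) :=
    (abs_add_le _ _).trans (add_le_add (abs_wave_le k a l 1) (abs_wave_le k b l 1))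
  have h4 := congrArg abs e
  rw [abs_mul, abs_mul, abs_of_pos (add_pos h1 h2)] at h4
  refine le_of_mul_le_mul_right ?_ (add_pos h1 h2)
  rw [h4]
  exact mul_le_mul_of_nonneg_left h3 (abs_nonneg _)

theorem abs_unit_wave_sub_le {k : ℤ} (hk : k ≠ 0) (l : ℤ) (i : Fin 3) (a b : ℝ) :
    |wave k a l i / Real.sqrt (waveSq k a l) - wave k b l i / Real.sqrt (waveSq k b l)| ≤
      2 * |a - b| := by
  have ha := one_le_waveSq hk a l
  have hb := one_le_waveSq hk b l
  have h1 : 1 ≤ Real.sqrt (waveSq k a l) := Real.one_le_sqrt.2 ha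
  have h2 : 1 ≤ Real.sqrt (waveSq k b l) := Real.one_le_sqrt.2 hb
  have hw : |wave k a l i - wave k b l i| ≤ |a - b| := by
    fin_cases i <;> simp [wave]
  have hs := abs_sqrt_waveSq_sub_le hk l b a
  have hb' := abs_wave_le k b l i
  set A := Real.sqrt (waveSq k a l)
  set B := Real.sqrt (waveSq k b l)
  set x := wave k a l i
  set y := wave k b l i
  have e : x / A - y / B = (x - y) / A + (y / B) * ((B - A) / A) := by
    have : A ≠ 0 := by linarith
    have : B ≠ 0 := by linarith
    field_simp
    ring
  rw [e, two_mul]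
  refine (abs_add_le _ _).trans (add_le_add ?_ ?_)
  · rw [abs_div, abs_of_pos (by linarith : 0 < A)]
    exact (div_le_self (abs_nonneg _) h1).trans hw
  · rw [abs_mul, abs_div, abs_div, abs_of_pos (by linarith : 0 < A),
      abs_of_pos (by linarith : 0 < B), abs_sub_comm a b]
    refine (mul_le_of_le_one_left (by positivity) ((div_le_one (by linarith)).2 hb')).trans ?_
    exact (div_le_self (abs_nonneg _) h1).trans hs

/-- The symbol is a product of two components of a unit vector, each bounded by `1` and
`2`-Lipschitz. The condition `k ≠ 0` keeps the wave vector away from the origin, where the symbol is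
singular. -/
theorem abs_rieszSymbol_sub_le {k : ℤ} (hk : k ≠ 0) (l : ℤ) (i j : Fin 3) (a b : ℝ) :
    |rieszSymbol k l i j a - rieszSymbol k l i j b| ≤ 4 * |a - b| := by
  have e : ∀ η, rieszSymbol k l i j η = (wave k η l i / Real.sqrt (waveSq k η l)) *
      (wave k η l j / Real.sqrt (waveSq k η l)) := by
    intro η
    rw [div_mul_div_comm, Real.mul_self_sqrt (by linarith [one_le_waveSq hk η l]), rieszSymbol]
  have hu : ∀ η m, |wave k η l m / Real.sqrt (waveSq k η l)| ≤ 1 := by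
    intro η m
    have := Real.one_le_sqrt.2 (one_le_waveSq hk η l)
    rw [abs_div, abs_of_nonneg (Real.sqrt_nonneg _), div_le_one (by linarith)]
    exact abs_wave_le k η l m
  rw [e, e]
  have hi := abs_unit_wave_sub_le hk l i a b
  have hj := abs_unit_wave_sub_le hk l j a b
  have h1 := hu a j
  have h2 := hu b i
  set x := wave k a l i / Real.sqrt (waveSq k a l)
  set x' := wave k b l i / Real.sqrt (waveSq k b l)
  set y := wave k a l j / Real.sqrt (waveSq k a l)
  set y' := wave k b l j / Real.sqrt (waveSq k b l)
  have : x * y - x' * y' = (x - x') * y + x' * (y - y') := by ring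
  rw [this]
  refine (abs_add_le _ _).trans ?_
  rw [abs_mul, abs_mul]
  nlinarith [abs_nonneg (x - x'), abs_nonneg (y - y'), abs_nonneg y, abs_nonneg x']

/-- The pairing of a test function with the pressure gradient, on the Fourier side. -/
def pressurePairing (β : ℝ) (k l : ℤ) (j : Fin 3) (w : ℝ → ℂ)
    (v τ : Lp ℂ 2 (volume : Measure ℝ)) : ℂ :=
  -2 * ip (fun ζ => (rieszSymbol k l j 0 (2 * Real.pi * ζ) : ℂ) * 𝓕 w ζ)
      (Lp.fourierTransformₗᵢ ℝ ℂ v)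
    - β * ip (fun ζ => (rieszSymbol k l j 1 (2 * Real.pi * ζ) : ℂ) * 𝓕 w ζ)
      (Lp.fourierTransformₗᵢ ℝ ℂ τ)

theorem memLp_rieszSymbol_mul {k : ℤ} (hk : k ≠ 0) (l : ℤ) (i j : Fin 3) {w : ℝ → ℂ}
    (hw : IsBump w) :
    MemLp (fun ζ => (rieszSymbol k l i j (2 * Real.pi * ζ) : ℂ) * 𝓕 w ζ) 2
      (volume : Measure ℝ) := by
  refine hw.memLp_fourier.of_le ?_ (Eventually.of_forall fun ζ => ?_)
  · refine AEStronglyMeasurable.mul ?_ hw.memLp_fourier.1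
    exact (Complex.continuous_ofReal.comp ((continuous_rieszSymbol hk l i j).comp
      (continuous_const.mul continuous_id))).aestronglyMeasurable
  · rw [norm_mul, Complex.norm_real]
    exact mul_le_of_le_one_left (norm_nonneg _) (abs_rieszSymbol_le hk l i j _)

/-- The real symbol is moved onto the test function. The result is then continuous in time whenever
the modes of `v` and `θ` are, although no time regularity is required of the pressure gradient
itself. -/
theorem ip_pressureGrad {β : ℝ} {v θ g : L2} {j : Fin 3} (h : IsPressureGrad β v θ j g)
    {k : ℤ} (hk : k ≠ 0) (l : ℤ) {w : ℝ → ℂ} (hw : IsBump w) :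
    ip w (mode g k l) = pressurePairing β k l j w (mode v k l) (mode θ k l) := by
  rw [← hw.ip_fourier, ← fourierL2_eq, pressurePairing, ← fourierL2_eq, ← fourierL2_eq, ip, ip, ip,
    ← integral_const_mul, ← integral_const_mul, ← integral_sub]
  · refine integral_congr_ae ?_
    filter_upwards [h k l] with ζ hζ
    rw [hζ]
    simp only [rieszSymbol, map_mul, Complex.conj_ofReal]
    push_cast
    ring
  · exact (MemLp.integrable_mul (memLp_rieszSymbol_mul hk l j 0 hw).star
      (Lp.memLp (fourierL2 v k l))).const_mul _
  · exact (MemLp.integrable_mul (memLp_rieszSymbol_mul hk l j 1 hw).star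
      (Lp.memLp (fourierL2 θ k l))).const_mul _

theorem continuousOn_pressurePairing (β : ℝ) {k : ℤ} (hk : k ≠ 0) (l : ℤ) (j : Fin 3)
    {w : ℝ → ℂ} (hw : IsBump w) {s : Set ℝ} {v τ : ℝ → Lp ℂ 2 (volume : Measure ℝ)}
    (hv : ContinuousOn v s) (hτ : ContinuousOn τ s) :
    ContinuousOn (fun t => pressurePairing β k l j w (v t) (τ t)) s := by
  refine (continuousOn_const.mul (continuousOn_ip (memLp_rieszSymbol_mul hk l j 0 hw) ?_)).sub
    (continuousOn_const.mul (continuousOn_ip (memLp_rieszSymbol_mul hk l j 1 hw) ?_))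
  · exact (Lp.fourierTransformₗᵢ ℝ ℂ).continuous.comp_continuousOn hv
  · exact (Lp.fourierTransformₗᵢ ℝ ℂ).continuous.comp_continuousOn hτ

theorem norm_pressurePairing_sub_le (β : ℝ) {k : ℤ} (hk : k ≠ 0) (l : ℤ) (j : Fin 3)
    {g : ℝ → ℂ} (hg : IsBump g) (ξ : ℝ) (v τ : Lp ℂ 2 (volume : Measure ℝ)) :
    ‖pressurePairing β k l j (modulate ξ g) v τ -
      (-2 * rieszSymbol k l j 0 ξ * ip (modulate ξ g) v -
        β * rieszSymbol k l j 1 ξ * ip (modulate ξ g) τ)‖ ≤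
      (8 * ‖v‖ + 4 * |β| * ‖τ‖) * l2norm (deriv g) := by
  have h0 := norm_ip_multiplier_sub_le (continuous_rieszSymbol hk l j 0) (C := 4) (by norm_num)
    (abs_rieszSymbol_le hk l j 0) (abs_rieszSymbol_sub_le hk l j 0) hg ξ v
  have h1 := norm_ip_multiplier_sub_le (continuous_rieszSymbol hk l j 1) (C := 4) (by norm_num)
    (abs_rieszSymbol_le hk l j 1) (abs_rieszSymbol_sub_le hk l j 1) hg ξ τ
  rw [pressurePairing]
  set A := ip (fun ζ : ℝ => (rieszSymbol k l j 0 (2 * Real.pi * ζ) : ℂ) * 𝓕 (modulate ξ g) ζ)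
    (Lp.fourierTransformₗᵢ ℝ ℂ v)
  set B := ip (fun ζ : ℝ => (rieszSymbol k l j 1 (2 * Real.pi * ζ) : ℂ) * 𝓕 (modulate ξ g) ζ)
    (Lp.fourierTransformₗᵢ ℝ ℂ τ)
  have e : -2 * A - β * B - (-2 * rieszSymbol k l j 0 ξ * ip (modulate ξ g) v -
        β * rieszSymbol k l j 1 ξ * ip (modulate ξ g) τ) =
      -2 * (A - rieszSymbol k l j 0 ξ * ip (modulate ξ g) v) -
        β * (B - rieszSymbol k l j 1 ξ * ip (modulate ξ g) τ) := by ring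
  rw [e]
  refine (norm_sub_le _ _).trans ?_
  rw [norm_mul, norm_mul, Complex.norm_real, norm_neg, Complex.norm_ofNat, Real.norm_eq_abs]
  nlinarith [abs_nonneg β, mul_le_mul_of_nonneg_left h1 (abs_nonneg β)]

/-! ### Truncated Fourier transforms -/

/-- On `L¹ ∩ L²` both transforms satisfy the same exchange formula against bumps: one as a tempered
distribution, the other by Fubini. This determines them almost everywhere. -/
theorem fourierTransform_toLp_ae_eq {f : ℝ → ℂ} (h1 : Integrable f)
    (h2 : MemLp f 2 (volume : Measure ℝ)) :
    Lp.fourierTransformₗᵢ ℝ ℂ (h2.toLp f) =ᵐ[volume] 𝓕 f := by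
  have hc : Continuous (𝓕 f) :=
    VectorFourier.fourierIntegral_continuous Real.continuous_fourierChar
      (by exact continuous_inner) h1
  refine ae_eq_of_integral_contDiff_smul_eq
    ((Lp.memLp _).locallyIntegrable (by norm_num)) hc.locallyIntegrable fun g hg hgc => ?_
  have hb : IsBump (fun y => ((g y : ℝ) : ℂ)) :=
    ⟨Complex.ofRealCLM.contDiff.comp hg, hgc.comp_left (g := fun x : ℝ => (x : ℂ)) (by simp)⟩
  have h3 := congrArg (fun T => T (hb.compact.toSchwartzMap hb.smooth))
    (Lp.fourier_toTemperedDistribution_eq (h2.toLp f))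
  simp only [TemperedDistribution.fourier_apply, Lp.toTemperedDistribution_apply, hb.fourier_coe]
    at h3
  have h4 : ∫ x, 𝓕 (fun y => ((g y : ℝ) : ℂ)) x • (h2.toLp f) x =
      ∫ x, 𝓕 (fun y => ((g y : ℝ) : ℂ)) x • f x := by
    refine integral_congr_ae ?_
    filter_upwards [h2.coeFn_toLp] with x hx
    rw [hx]
  have h5 : ∫ x, 𝓕 (fun y => ((g y : ℝ) : ℂ)) x • f x = ∫ x, ((g x : ℝ) : ℂ) • 𝓕 f x := by
    have := VectorFourier.integral_fourierIntegral_smul_eq_flip (L := innerₗ ℝ)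
      (μ := (volume : Measure ℝ)) (ν := (volume : Measure ℝ))
      Real.continuous_fourierChar continuous_inner hb.integrable h1
    rw [flip_innerₗ] at this
    exact this
  rw [h4, h5] at h3
  refine Eq.trans ?_ (h3.symm.trans ?_)
  · refine integral_congr_ae (Eventually.of_forall fun x => ?_)
    rfl
  · simp only [Complex.real_smul, smul_eq_mul]

theorem ip_modulate_eq_fourier {g : ℝ → ℂ} (hreal : ∀ y, conj (g y) = g y) (ζ : ℝ)
    (v : Lp ℂ 2 (volume : Measure ℝ)) :
    ip (modulate (2 * Real.pi * ζ) g) v = 𝓕 (fun y => g y * v y) ζ := by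
  rw [ip, Real.fourier_real_eq_integral_exp_smul]
  congr 1
  ext y
  rw [modulate, map_mul, hreal, ← Complex.exp_conj, map_mul, Complex.conj_ofReal, Complex.conj_I,
    smul_eq_mul, mul_assoc]
  congr 2
  push_cast
  ring

/-! ### Slowly varying cutoffs -/

theorem l2norm_sq_eq_integral {w : ℝ → ℂ} (hw : MemLp w 2 (volume : Measure ℝ)) :
    l2norm w ^ 2 = ∫ y, ‖w y‖ ^ 2 := by
  have hint : Integrable (fun y => ‖w y‖ ^ 2) := hw.integrable_norm_pow (p := 2) (by norm_num)
  have h : ENNReal.ofReal (l2norm w ^ 2) = ENNReal.ofReal (∫ y, ‖w y‖ ^ 2) := by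
    rw [ofReal_integral_eq_lintegral_ofReal hint (Eventually.of_forall fun _ => by positivity),
      l2norm_eq_norm hw, ENNReal.ofReal_pow (norm_nonneg _), ofReal_norm, ← lintegral_enorm_sq_toLp]
    refine lintegral_congr_ae ?_
    filter_upwards [hw.coeFn_toLp] with y hy
    rw [hy, ENNReal.ofReal_pow (norm_nonneg _), ofReal_norm]
  exact (ENNReal.ofReal_eq_ofReal_iff (sq_nonneg _)
    (integral_nonneg fun _ => sq_nonneg _)).1 h

theorem IsBump.comp_mul_left {h : ℝ → ℂ} (hh : IsBump h) {c : ℝ} (hc : c ≠ 0) :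
    IsBump (fun y => h (c * y)) :=
  ⟨hh.smooth.comp (contDiff_const.mul contDiff_id),
    hh.compact.comp_homeomorph (Homeomorph.mulLeft₀ c hc)⟩

theorem l2norm_comp_mul_left {h : ℝ → ℂ} (hh : IsBump h) {c : ℝ} (hc : 0 < c) :
    l2norm (fun y => h (c * y)) ^ 2 = c⁻¹ * l2norm h ^ 2 := by
  rw [l2norm_sq_eq_integral (hh.comp_mul_left hc.ne').memLp, l2norm_sq_eq_integral hh.memLp,
    Measure.integral_comp_mul_left (fun y => ‖h y‖ ^ 2), abs_of_pos (inv_pos.2 hc), smul_eq_mul]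

theorem l2norm_const_mul (c : ℂ) {w : ℝ → ℂ} (hw : MemLp w 2 (volume : Measure ℝ)) :
    l2norm (fun y => c * w y) ≤ ‖c‖ * l2norm w :=
  l2norm_le_mul (norm_nonneg _) hw fun y => by rw [norm_mul]

/-- A fixed bump, equal to `1` near the origin. -/
def baseBump : ContDiffBump (0 : ℝ) := ⟨1, 2, one_pos, one_lt_two⟩

/-- A sequence of cutoffs increasing to `1`. -/
def cutoff (n : ℕ) (y : ℝ) : ℂ := ((baseBump ((n + 1 : ℝ)⁻¹ * y) : ℝ) : ℂ)

theorem isBump_baseBump : IsBump (fun y => ((baseBump y : ℝ) : ℂ)) :=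
  ⟨Complex.ofRealCLM.contDiff.comp baseBump.contDiff,
    baseBump.hasCompactSupport.comp_left (g := fun x : ℝ => (x : ℂ)) (by simp)⟩

theorem isBump_cutoff (n : ℕ) : IsBump (cutoff n) :=
  isBump_baseBump.comp_mul_left (by positivity)

theorem conj_cutoff (n : ℕ) (y : ℝ) : conj (cutoff n y) = cutoff n y := Complex.conj_ofReal _

theorem norm_cutoff_le (n : ℕ) (y : ℝ) : ‖cutoff n y‖ ≤ 1 := by
  rw [cutoff, Complex.norm_real, Real.norm_of_nonneg baseBump.nonneg]
  exact baseBump.le_one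

theorem tendsto_inv_succ : Tendsto (fun n : ℕ => (n + 1 : ℝ)⁻¹) atTop (𝓝 0) := by
  simpa using tendsto_one_div_add_atTop_nhds_zero_nat (𝕜 := ℝ)

theorem tendsto_cutoff (y : ℝ) : Tendsto (fun n => cutoff n y) atTop (𝓝 1) := by
  have h1 : Tendsto (fun n : ℕ => (n + 1 : ℝ)⁻¹ * y) atTop (𝓝 0) := by
    simpa using tendsto_inv_succ.mul_const y
  refine tendsto_const_nhds.congr' ?_
  filter_upwards [h1.eventually baseBump.eventuallyEq_one] with n hn
  simp only [cutoff, hn, Pi.one_apply, Complex.ofReal_one]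

theorem deriv_comp_const_mul (c : ℝ) (h : ℝ → ℂ) :
    deriv (fun y => h (c * y)) = fun y => (c : ℂ) * deriv h (c * y) := by
  ext y
  rw [deriv_comp_mul_left c h y, Complex.real_smul]

/-- With `c = (n + 1)⁻¹`, dilation costs `c^(-1/2)` in `L²` and each derivative of the cutoff gains
`c`, so one derivative already leaves `c^(1/2)`. -/
theorem tendsto_l2norm_scaled {h : ℝ → ℂ} (hh : IsBump h) {m : ℕ} (hm : 1 ≤ m) :
    Tendsto (fun n : ℕ => l2norm (fun y => (((n + 1 : ℝ)⁻¹ : ℝ) : ℂ) ^ m * h ((n + 1 : ℝ)⁻¹ * y)))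
      atTop (𝓝 0) := by
  have h1 : Tendsto (fun n : ℕ => Real.sqrt (n + 1 : ℝ)⁻¹ * l2norm h) atTop (𝓝 0) := by
    have := (Real.continuous_sqrt.tendsto 0).comp tendsto_inv_succ
    simpa using this.mul_const (l2norm h)
  refine squeeze_zero (fun n => l2norm_nonneg _) (fun n => ?_) h1
  have hc : (0 : ℝ) < (n + 1 : ℝ)⁻¹ := by positivity
  have hc1 : (n + 1 : ℝ)⁻¹ ≤ 1 := inv_le_one_of_one_le₀ (by linarith [Nat.cast_nonneg (α := ℝ) n])
  set c := (n + 1 : ℝ)⁻¹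
  refine (l2norm_const_mul _ (hh.comp_mul_left hc.ne').memLp).trans ?_
  rw [norm_pow, Complex.norm_real, Real.norm_of_nonneg hc.le]
  have h2 := l2norm_comp_mul_left hh hc
  have h3 : l2norm (fun y => h (c * y)) = Real.sqrt c⁻¹ * l2norm h := by
    rw [← Real.sqrt_sq (l2norm_nonneg (fun y => h (c * y))), h2,
      Real.sqrt_mul (inv_nonneg.2 hc.le), Real.sqrt_sq (l2norm_nonneg h)]
  rw [h3, ← mul_assoc]
  refine mul_le_mul_of_nonneg_right ?_ (l2norm_nonneg h)
  calc c ^ m * Real.sqrt c⁻¹ ≤ c * Real.sqrt c⁻¹ := by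
        gcongr
        exact pow_le_of_le_one hc.le hc1 (by omega)
    _ = Real.sqrt c * (Real.sqrt c * Real.sqrt c⁻¹) := by
        rw [← mul_assoc, Real.mul_self_sqrt hc.le]
    _ = Real.sqrt c := by
        rw [← Real.sqrt_mul hc.le, mul_inv_cancel₀ hc.ne', Real.sqrt_one, mul_one]

theorem deriv_cutoff (n : ℕ) : deriv (cutoff n) = fun y =>
    (((n + 1 : ℝ)⁻¹ : ℝ) : ℂ) * deriv (fun y => ((baseBump y : ℝ) : ℂ)) ((n + 1 : ℝ)⁻¹ * y) :=
  deriv_comp_const_mul _ (fun y => ((baseBump y : ℝ) : ℂ))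

theorem tendsto_l2norm_deriv_cutoff :
    Tendsto (fun n => l2norm (deriv (cutoff n))) atTop (𝓝 0) := by
  refine (tendsto_l2norm_scaled isBump_baseBump.deriv le_rfl).congr fun n => ?_
  rw [deriv_cutoff]
  simp only [pow_one]

theorem tendsto_l2norm_deriv_deriv_cutoff :
    Tendsto (fun n => l2norm (deriv (deriv (cutoff n)))) atTop (𝓝 0) := by
  refine (tendsto_l2norm_scaled isBump_baseBump.deriv.deriv one_le_two).congr fun n => ?_
  rw [deriv_cutoff]
  congr 1
  ext y
  rw [deriv_const_mul_field, congrFun (deriv_comp_const_mul _ _) y]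
  ring

/-! ### Almost everywhere convergence of truncated Fourier transforms -/

theorem memLp_cutoff_mul (n : ℕ) (v : Lp ℂ 2 (volume : Measure ℝ)) :
    MemLp (fun y => cutoff n y * v y) 2 (volume : Measure ℝ) := by
  refine (Lp.memLp v).of_le ((isBump_cutoff n).memLp.1.mul (Lp.memLp v).1)
    (Eventually.of_forall fun y => ?_)
  rw [norm_mul]
  exact mul_le_of_le_one_left (norm_nonneg _) (norm_cutoff_le n y)

theorem tendsto_cutoff_mul (v : Lp ℂ 2 (volume : Measure ℝ)) :
    Tendsto (fun n => (memLp_cutoff_mul n v).toLp _) atTop (𝓝 v) := by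
  rw [tendsto_iff_edist_tendsto_0]
  have h1 : ∀ n, edist ((memLp_cutoff_mul n v).toLp _) v =
      (∫⁻ y, ‖(cutoff n y - 1) * v y‖ₑ ^ 2) ^ (1 / 2 : ℝ) := by
    intro n
    have : ∫⁻ y, ‖(cutoff n y - 1) * v y‖ₑ ^ 2 = ‖(memLp_cutoff_mul n v).toLp _ - v‖ₑ ^ 2 := by
      rw [← lintegral_enorm_sq_toLp]
      refine lintegral_congr_ae ?_
      filter_upwards [Lp.coeFn_sub ((memLp_cutoff_mul n v).toLp _) v,
        (memLp_cutoff_mul n v).coeFn_toLp] with y h1 h2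
      rw [h1, Pi.sub_apply, h2, sub_mul, one_mul]
    rw [this, edist_eq_enorm_sub, ← ENNReal.rpow_natCast, ← ENNReal.rpow_mul]
    norm_num
  simp only [h1]
  have hv : ∫⁻ y, ‖v y‖ₑ ^ 2 ≠ ⊤ := by
    rw [lintegral_enorm_sq_toLp]
    exact ENNReal.pow_ne_top enorm_ne_top
  have h2 : Tendsto (fun n => ∫⁻ y, ‖(cutoff n y - 1) * v y‖ₑ ^ 2) atTop
      (𝓝 (∫⁻ _ : ℝ, 0)) := by
    refine tendsto_lintegral_of_dominated_convergence' (fun y => 4 * ‖v y‖ₑ ^ 2)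
      (fun n => ?_) (fun n => Eventually.of_forall fun y => ?_) ?_
      (Eventually.of_forall fun y => ?_)
    · exact (((isBump_cutoff n).smooth.continuous.aestronglyMeasurable.sub
        aestronglyMeasurable_const).mul (Lp.memLp v).1).enorm.pow_const _
    · beta_reduce
      rw [enorm_mul, mul_pow]
      gcongr
      have : ‖cutoff n y - 1‖ₑ ≤ 2 := by
        rw [← ofReal_norm]
        refine ENNReal.ofReal_le_of_le_toReal ?_
        refine (norm_sub_le _ _).trans ?_
        have := norm_cutoff_le n y
        rw [norm_one, ENNReal.toReal_ofNat]
        linarith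
      calc ‖cutoff n y - 1‖ₑ ^ 2 ≤ 2 ^ 2 := by gcongr
        _ = 4 := by norm_num
    · rw [lintegral_const_mul' _ _ (by norm_num)]
      exact ENNReal.mul_ne_top (by norm_num) hv
    · have h3 : Tendsto (fun n => (cutoff n y - 1) * v y) atTop (𝓝 0) := by
        simpa using ((tendsto_cutoff y).sub_const 1).mul_const (v y)
      have h4 := ((continuous_enorm.tendsto (0 : ℂ)).comp h3)
      rw [enorm_zero] at h4
      have h5 := ((ENNReal.continuous_pow 2).tendsto 0).comp h4
      simpa [Function.comp_def] using h5
  rw [lintegral_zero] at h2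
  have h3 := ((ENNReal.continuous_rpow_const (y := (1 / 2 : ℝ))).tendsto 0).comp h2
  simpa [Function.comp_def] using h3

/-- The Fourier transform of `v` cut off at scale `n`. -/
def truncFourier (n : ℕ) (v : Lp ℂ 2 (volume : Measure ℝ)) (ζ : ℝ) : ℂ :=
  ip (modulate (2 * Real.pi * ζ) (cutoff n)) v

theorem truncFourier_ae_eq (n : ℕ) (v : Lp ℂ 2 (volume : Measure ℝ)) :
    Lp.fourierTransformₗᵢ ℝ ℂ ((memLp_cutoff_mul n v).toLp _) =ᵐ[volume] truncFourier n v := by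
  have h1 : Integrable (fun y => cutoff n y * v y) :=
    MemLp.integrable_mul (isBump_cutoff n).memLp (Lp.memLp v)
  filter_upwards [fourierTransform_toLp_ae_eq h1 (memLp_cutoff_mul n v)] with ζ hζ
  rw [hζ, truncFourier, ip_modulate_eq_fourier (conj_cutoff n)]

theorem tendstoInMeasure_truncFourier (v : Lp ℂ 2 (volume : Measure ℝ)) :
    TendstoInMeasure volume (fun n => truncFourier n v) atTop
      (Lp.fourierTransformₗᵢ ℝ ℂ v) := by
  have h := tendstoInMeasure_of_tendsto_Lp
    (((Lp.fourierTransformₗᵢ ℝ ℂ).continuous.tendsto v).comp (tendsto_cutoff_mul v))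
  exact h.congr_left fun n => truncFourier_ae_eq n v

/-- Convergence in `L²` gives almost everywhere convergence only along a subsequence. Successive
extraction yields one subsequence common to finitely many functions. -/
theorem exists_seq_tendsto_truncFourier {ι : Type*} [Fintype ι]
    (v : ι → Lp ℂ 2 (volume : Measure ℝ)) :
    ∃ ns : ℕ → ℕ, StrictMono ns ∧ ∀ᵐ ζ : ℝ, ∀ i,
      Tendsto (fun n => truncFourier (ns n) (v i) ζ) atTop
        (𝓝 (Lp.fourierTransformₗᵢ ℝ ℂ (v i) ζ)) := by
  classical
  suffices H : ∀ s : Finset ι, ∃ ns : ℕ → ℕ, StrictMono ns ∧ ∀ i ∈ s, ∀ᵐ ζ : ℝ,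
      Tendsto (fun n => truncFourier (ns n) (v i) ζ) atTop
        (𝓝 (Lp.fourierTransformₗᵢ ℝ ℂ (v i) ζ)) by
    obtain ⟨ns, h1, h2⟩ := H Finset.univ
    exact ⟨ns, h1, ae_all_iff.2 fun i => h2 i (Finset.mem_univ i)⟩
  intro s
  induction s using Finset.induction_on with
  | empty => exact ⟨id, strictMono_id, by simp⟩
  | insert i s _ ih =>
    obtain ⟨ns, h1, h2⟩ := ih
    obtain ⟨ms, h3, h4⟩ :=
      ((tendstoInMeasure_truncFourier (v i)).comp h1.tendsto_atTop).exists_seq_tendsto_ae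
    refine ⟨ns ∘ ms, h1.comp h3, fun j hj => ?_⟩
    rcases Finset.mem_insert.1 hj with rfl | hj
    · exact h4
    · filter_upwards [h2 j hj] with ζ hζ
      exact hζ.comp h3.tendsto_atTop

/-! ### The hypocoercive energy -/

/-- The energy of a mode, with `r = |k, ξ, l|` and `q = k² + l²`. -/
def energy (β k q ξ r x₁ x₂ x₃ τ : ℝ) : ℝ :=
  x₁ ^ 2 + x₃ ^ 2 + r ^ 3 * x₂ ^ 2 + q * r * τ ^ 2 - k * ξ * r / β * (x₂ * τ)

/-- The coercive part of the energy. -/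
def energySum (q r x₁ x₂ x₃ τ : ℝ) : ℝ := x₁ ^ 2 + x₃ ^ 2 + (r ^ 3 * x₂ ^ 2 + q * r * τ ^ 2)

/-- The derivative of the energy along `x'`, when `r' = -kξ/r` and `ξ' = -k`. -/
def energyDeriv (β k q ξ r x₁ x₂ x₃ τ y₁ y₂ y₃ σ : ℝ) : ℝ :=
  2 * x₁ * y₁ + 2 * x₃ * y₃ + (-(3 * r * (k * ξ)) * x₂ ^ 2 + 2 * r ^ 3 * x₂ * y₂)
    + (-(q * (k * ξ) / r) * τ ^ 2 + 2 * q * r * τ * σ)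
    - ((-(k ^ 2) * r - (k * ξ) ^ 2 / r) / β * (x₂ * τ) + k * ξ * r / β * (y₂ * τ + x₂ * σ))

/-! ### Coercivity and damping of the energy of one mode -/

section Algebra

variable {β ν κ k l q ξ r x₁ x₂ x₃ τ : ℝ}

/-- Young's inequality for `(ξ x₂)(k τ)`, with `ξ² ≤ r²` and `k² ≤ q`. After division by `2β` this
is the coercivity of the energy, and it also bounds the viscous cross term. -/
theorem two_mul_abs_cross_le (hq : q = k ^ 2 + l ^ 2) (hr : 0 < r) (hr2 : r ^ 2 = q + ξ ^ 2) :
    2 * |k * ξ * r * (x₂ * τ)| ≤ r ^ 3 * x₂ ^ 2 + q * r * τ ^ 2 := by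
  have h : 2 * |(ξ * x₂) * (k * τ)| ≤ (ξ * x₂) ^ 2 + (k * τ) ^ 2 := by
    rw [abs_mul, ← sq_abs (ξ * x₂), ← sq_abs (k * τ)]
    nlinarith [sq_nonneg (|ξ * x₂| - |k * τ|)]
  have e : k * ξ * r * (x₂ * τ) = r * ((ξ * x₂) * (k * τ)) := by ring
  rw [e, abs_mul, abs_of_pos hr]
  have h1 : (ξ * x₂) ^ 2 + (k * τ) ^ 2 ≤ r ^ 2 * x₂ ^ 2 + q * τ ^ 2 := by
    rw [hr2, hq]
    nlinarith [sq_nonneg (k * x₂), sq_nonneg (l * x₂), sq_nonneg (l * τ)]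
  calc 2 * (r * |ξ * x₂ * (k * τ)|) = r * (2 * |ξ * x₂ * (k * τ)|) := by ring
    _ ≤ r * (r ^ 2 * x₂ ^ 2 + q * τ ^ 2) := mul_le_mul_of_nonneg_left (h.trans h1) hr.le
    _ = _ := by ring

theorem abs_energy_sub_le (hβ : 1 / 2 < β) (hq : q = k ^ 2 + l ^ 2) (hr : 0 < r)
    (hr2 : r ^ 2 = q + ξ ^ 2) :
    |energy β k q ξ r x₁ x₂ x₃ τ - energySum q r x₁ x₂ x₃ τ| ≤
      1 / (2 * β) * (r ^ 3 * x₂ ^ 2 + q * r * τ ^ 2) := by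
  have hb : 0 < β := by linarith
  have e : energy β k q ξ r x₁ x₂ x₃ τ - energySum q r x₁ x₂ x₃ τ =
      -(1 / (2 * β) * (2 * (k * ξ * r * (x₂ * τ)))) := by
    rw [energy, energySum]
    field_simp
    ring
  rw [e, abs_neg, abs_mul, abs_of_pos (by positivity : 0 < 1 / (2 * β)), abs_mul 2,
    abs_of_pos (two_pos : (0 : ℝ) < 2)]
  exact mul_le_mul_of_nonneg_left (two_mul_abs_cross_le hq hr hr2) (by positivity)

theorem energySum_le (hβ : 1 / 2 < β) (hq : q = k ^ 2 + l ^ 2) (hr : 0 < r)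
    (hr2 : r ^ 2 = q + ξ ^ 2) :
    (1 - 1 / (2 * β)) * energySum q r x₁ x₂ x₃ τ ≤ energy β k q ξ r x₁ x₂ x₃ τ := by
  have h := (abs_le.1 (abs_energy_sub_le (x₁ := x₁) (x₂ := x₂) (x₃ := x₃) (τ := τ)
    hβ hq hr hr2)).1
  have hb : 0 < 1 / (2 * β) := by
    have : 0 < β := by linarith
    positivity
  have : energySum q r x₁ x₂ x₃ τ - (r ^ 3 * x₂ ^ 2 + q * r * τ ^ 2) = x₁ ^ 2 + x₃ ^ 2 := by
    rw [energySum]; ring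
  nlinarith [sq_nonneg x₁, sq_nonneg x₃]

theorem energy_le (hβ : 1 / 2 < β) (hq : q = k ^ 2 + l ^ 2) (hr : 0 < r)
    (hr2 : r ^ 2 = q + ξ ^ 2) :
    energy β k q ξ r x₁ x₂ x₃ τ ≤
      x₁ ^ 2 + x₃ ^ 2 + 2 * (r ^ 3 * x₂ ^ 2 + q * r * τ ^ 2) := by
  have h := (abs_le.1 (abs_energy_sub_le (x₁ := x₁) (x₂ := x₂) (x₃ := x₃) (τ := τ)
    hβ hq hr hr2)).2
  have hb : 1 / (2 * β) ≤ 1 := by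
    rw [div_le_one (by linarith)]
    linarith
  have h0 : 0 ≤ r ^ 3 * x₂ ^ 2 + q * r * τ ^ 2 := by
    have : 0 ≤ q := by rw [hq]; positivity
    positivity
  have h1 := mul_le_mul_of_nonneg_right hb h0
  rw [energySum] at h
  linarith

/-- Weighted Young inequality. The smallness `B` of `b` relative to `√c` is shared equally between
both factors, so it multiplies the whole energy. -/
theorem two_mul_abs_mul_le {B c a b : ℝ} (hB : 0 < B) (h : b ^ 2 ≤ B ^ 2 * c) :
    2 * |a * b| ≤ B * a ^ 2 + B * c := by
  have h1 : 2 * |a * b| ≤ B * a ^ 2 + b ^ 2 / B := by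
    have : B * a ^ 2 + b ^ 2 / B - 2 * |a * b| = (B * |a| - |b|) ^ 2 / B := by
      rw [abs_mul, ← sq_abs a, ← sq_abs b]
      field_simp
      ring
    have : 0 ≤ (B * |a| - |b|) ^ 2 / B := by positivity
    linarith
  have h2 : b ^ 2 / B ≤ B * c := by
    rw [div_le_iff₀ hB]
    linarith
  linarith

/-- The key cancellation. The terms `kξ r x₂²` and `(q kξ/r) τ²` produced by the moving weights and
the pressure are absent, removed by the cross term. What survives is the forcing of `x₁, x₃`, one
term of relative size `k²/r²`, the viscous cross term and the dissipation. -/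
theorem energyDeriv_eq (hβ : 0 < β) (hr : 0 < r) (hr2 : r ^ 2 = q + ξ ^ 2) :
    energyDeriv β k q ξ r x₁ x₂ x₃ τ
      (-x₂ + 2 * (k * k / r ^ 2) * x₂ + β * (k * ξ / r ^ 2) * τ - ν * r ^ 2 * x₁)
      (2 * (ξ * k / r ^ 2) * x₂ + β * (ξ * ξ / r ^ 2) * τ - β * τ - ν * r ^ 2 * x₂)
      (2 * (l * k / r ^ 2) * x₂ + β * (l * ξ / r ^ 2) * τ - ν * r ^ 2 * x₃)
      (β * x₂ - κ * r ^ 2 * τ) =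
    (2 * (x₁ * ((2 * (k * k / r ^ 2) - 1) * x₂)) + β * (2 * (x₁ * (k * ξ / r ^ 2 * τ))))
      + (2 * (x₃ * (2 * (l * k / r ^ 2) * x₂)) + β * (2 * (x₃ * (l * ξ / r ^ 2 * τ))))
      + k ^ 2 / (β * r ^ 2) * (q * r * (x₂ * τ))
      + (ν + κ) * r ^ 2 / β * (k * ξ * r * (x₂ * τ))
      - 2 * ν * r ^ 2 * (x₁ ^ 2 + x₃ ^ 2)
      - 2 * r ^ 2 * (ν * (r ^ 3 * x₂ ^ 2) + κ * (q * r * τ ^ 2)) := by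
  obtain rfl : q = r ^ 2 - ξ ^ 2 := by linarith
  rw [energyDeriv]
  field_simp
  ring

/-- The constant in front of the time-integrable part of the energy growth. -/
def growthConst (β : ℝ) : ℝ := (2 * (1 + β) + 1 / (2 * β)) / (1 - 1 / (2 * β))

theorem one_sub_pos (hβ : 1 / 2 < β) : 0 < 1 - 1 / (2 * β) := by
  rw [sub_pos, div_lt_one (by linarith)]
  linarith

theorem growth_term_le {B : ℝ} (hβ : 0 < β) (hq : 0 ≤ q) (hqr : q ≤ r ^ 2) (hr : 0 < r)
    (hB : k ^ 2 ≤ B * r ^ 2) :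
    k ^ 2 / (β * r ^ 2) * (q * r * (x₂ * τ)) ≤
      1 / (2 * β) * (B * (r ^ 3 * x₂ ^ 2 + q * r * τ ^ 2)) := by
  have h1 : q * r * (x₂ * τ) ≤ (r ^ 3 * x₂ ^ 2 + q * r * τ ^ 2) / 2 := by
    have h0 : 2 * (x₂ * τ) ≤ x₂ ^ 2 + τ ^ 2 := by linarith [two_mul_le_add_sq x₂ τ]
    have h1 : q * r * (2 * (x₂ * τ)) ≤ q * r * (x₂ ^ 2 + τ ^ 2) :=
      mul_le_mul_of_nonneg_left h0 (by positivity)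
    have h2 : q * (r * x₂ ^ 2) ≤ r ^ 2 * (r * x₂ ^ 2) :=
      mul_le_mul_of_nonneg_right hqr (by positivity)
    linarith
  have h2 : k ^ 2 / (β * r ^ 2) ≤ B / β := by
    rw [div_le_div_iff₀ (by positivity) hβ]
    have := mul_le_mul_of_nonneg_right hB hβ.le
    linarith
  calc _ ≤ k ^ 2 / (β * r ^ 2) * ((r ^ 3 * x₂ ^ 2 + q * r * τ ^ 2) / 2) :=
        mul_le_mul_of_nonneg_left h1 (by positivity)
    _ ≤ B / β * ((r ^ 3 * x₂ ^ 2 + q * r * τ ^ 2) / 2) :=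
        mul_le_mul_of_nonneg_right h2 (by positivity)
    _ = _ := by field_simp

theorem sq_two_mul_sub_one_le (hr : 0 < r) (h : k ^ 2 ≤ r ^ 2) :
    (2 * (k * k / r ^ 2) - 1) ^ 2 ≤ 1 := by
  have h0 : 0 ≤ k * k / r ^ 2 := div_nonneg (mul_self_nonneg k) (sq_nonneg r)
  have h1 : k * k / r ^ 2 ≤ 1 := by
    rw [div_le_one (by positivity)]
    linarith
  rw [sq_le_one_iff_abs_le_one, abs_le]
  constructor <;> linarith

theorem sq_two_mul_div_le (hr : 0 < r) (h : k ^ 2 + l ^ 2 ≤ r ^ 2) :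
    (2 * (l * k / r ^ 2)) ^ 2 ≤ 1 := by
  rw [sq_le_one_iff_abs_le_one, show 2 * (l * k / r ^ 2) = 2 * l * k / r ^ 2 by ring, abs_div,
    abs_of_pos (by positivity : 0 < r ^ 2), div_le_one (by positivity), abs_le]
  constructor <;> linarith [sq_nonneg (l + k), sq_nonneg (l - k)]

/-- `B` stands for the time-integrable rate: it dominates `k²/r²` and `r^(-3/2)`, hence every
nonviscous term. Viscosity yields at least `2 lam r²` times the `(x₂, τ)` part, since the cross term
consumes `(ν + κ)/(2β)` of `2 min ν κ`. As the energy is at most twice that part plus `x₁² + x₃²`,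
the rate `lam r²` results. -/
theorem energyDeriv_le (hβ : 1 / 2 < β) (hν : 0 < ν) (hκ : 0 < κ)
    {lam : ℝ} (hlam : lam = min ν κ - (ν + κ) / (4 * β)) (hlam0 : 0 < lam)
    (hq : q = k ^ 2 + l ^ 2) (hr : 0 < r) (hr2 : r ^ 2 = q + ξ ^ 2)
    {B : ℝ} (hB : 0 < B) (hB1 : k ^ 2 ≤ B * r ^ 2) (hB2 : 1 ≤ B ^ 2 * r ^ 3) :
    energyDeriv β k q ξ r x₁ x₂ x₃ τ
      (-x₂ + 2 * (k * k / r ^ 2) * x₂ + β * (k * ξ / r ^ 2) * τ - ν * r ^ 2 * x₁)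
      (2 * (ξ * k / r ^ 2) * x₂ + β * (ξ * ξ / r ^ 2) * τ - β * τ - ν * r ^ 2 * x₂)
      (2 * (l * k / r ^ 2) * x₂ + β * (l * ξ / r ^ 2) * τ - ν * r ^ 2 * x₃)
      (β * x₂ - κ * r ^ 2 * τ) ≤
    (-lam * r ^ 2 + growthConst β * B) * energy β k q ξ r x₁ x₂ x₃ τ := by
  have hb : 0 < β := by linarith
  have hq0 : 0 ≤ q := by rw [hq]; positivity
  have hr2' : 0 < r ^ 2 := by positivity
  have hkq : k ^ 2 ≤ q := by rw [hq]; nlinarith [sq_nonneg l]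
  have hlq : l ^ 2 ≤ q := by rw [hq]; nlinarith [sq_nonneg k]
  have hqr : q ≤ r ^ 2 := by rw [hr2]; nlinarith [sq_nonneg ξ]
  have hξr : ξ ^ 2 ≤ r ^ 2 := by rw [hr2]; linarith
  rw [energyDeriv_eq hb hr hr2]
  set X := r ^ 3 * x₂ ^ 2 with hX
  set Y := q * r * τ ^ 2 with hY
  have hX0 : 0 ≤ X := by positivity
  have hY0 : 0 ≤ Y := by positivity
  have hx2 : ∀ c : ℝ, c ^ 2 ≤ 1 → (c * x₂) ^ 2 ≤ B ^ 2 * X := by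
    intro c hc
    have h1 : (c * x₂) ^ 2 ≤ x₂ ^ 2 := by
      rw [mul_pow]
      exact mul_le_of_le_one_left (sq_nonneg _) hc
    have h2 := mul_le_mul_of_nonneg_right hB2 (sq_nonneg x₂)
    rw [hX]
    linarith
  have hτ : ∀ c : ℝ, c ^ 2 ≤ q → (c * ξ / r ^ 2 * τ) ^ 2 ≤ B ^ 2 * Y := by
    intro c hc
    have h1 : (c * ξ / r ^ 2 * τ) ^ 2 ≤ q * r ^ 2 / r ^ 4 * τ ^ 2 := by
      rw [mul_pow, div_pow, mul_pow, ← pow_mul]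
      gcongr
    have h2 : q * r ^ 2 / r ^ 4 * τ ^ 2 * r ^ 3 = q * r * τ ^ 2 := by
      field_simp
    have h3 := mul_le_mul_of_nonneg_left hB2 (by positivity : 0 ≤ q * r ^ 2 / r ^ 4 * τ ^ 2)
    rw [hY, ← h2]
    linarith
  have c1 : (2 * (k * k / r ^ 2) - 1) ^ 2 ≤ 1 := sq_two_mul_sub_one_le hr (hkq.trans hqr)
  have c3 : (2 * (l * k / r ^ 2)) ^ 2 ≤ 1 := sq_two_mul_div_le hr (by linarith)
  have s1 := (le_abs_self (x₁ * ((2 * (k * k / r ^ 2) - 1) * x₂)))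
  have s1' := two_mul_abs_mul_le (a := x₁) hB (hx2 _ c1)
  have s2 := (le_abs_self (x₁ * (k * ξ / r ^ 2 * τ)))
  have s2' := two_mul_abs_mul_le (a := x₁) hB (hτ k hkq)
  have s3 := (le_abs_self (x₃ * (2 * (l * k / r ^ 2) * x₂)))
  have s3' := two_mul_abs_mul_le (a := x₃) hB (hx2 _ c3)
  have s4 := (le_abs_self (x₃ * (l * ξ / r ^ 2 * τ)))
  have s4' := two_mul_abs_mul_le (a := x₃) hB (hτ l hlq)
  have t2 : β * (2 * (x₁ * (k * ξ / r ^ 2 * τ))) ≤ β * (B * x₁ ^ 2 + B * Y) :=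
    mul_le_mul_of_nonneg_left (by linarith) hb.le
  have t4 : β * (2 * (x₃ * (l * ξ / r ^ 2 * τ))) ≤ β * (B * x₃ ^ 2 + B * Y) :=
    mul_le_mul_of_nonneg_left (by linarith) hb.le
  have t5 : k ^ 2 / (β * r ^ 2) * (q * r * (x₂ * τ)) ≤ 1 / (2 * β) * (B * (X + Y)) :=
    growth_term_le hb hq0 hqr hr hB1
  have t6 : (ν + κ) * r ^ 2 / β * (k * ξ * r * (x₂ * τ)) ≤ (ν + κ) / (2 * β) * (r ^ 2 * (X + Y)) := by
    have h1 := two_mul_abs_cross_le (x₂ := x₂) (τ := τ) hq hr hr2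
    have h2 := le_abs_self (k * ξ * r * (x₂ * τ))
    calc _ ≤ (ν + κ) * r ^ 2 / β * ((X + Y) / 2) :=
          mul_le_mul_of_nonneg_left (by linarith) (by positivity)
      _ = _ := by field_simp
  have t7 : min ν κ * (X + Y) ≤ ν * X + κ * Y := by
    linarith [mul_le_mul_of_nonneg_right (min_le_left ν κ) hX0,
      mul_le_mul_of_nonneg_right (min_le_right ν κ) hY0]
  have hlν : lam ≤ ν := by
    have : 0 ≤ (ν + κ) / (4 * β) := by positivity
    linarith [min_le_left ν κ]
  have hL := energySum_le (x₁ := x₁) (x₂ := x₂) (x₃ := x₃) (τ := τ) hβ hq hr hr2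
  have hU := energy_le (x₁ := x₁) (x₂ := x₂) (x₃ := x₃) (τ := τ) hβ hq hr hr2
  have hγ := one_sub_pos hβ
  rw [energySum, ← hX, ← hY] at hL
  rw [← hX, ← hY] at hU
  set E := energy β k q ξ r x₁ x₂ x₃ τ
  -- The numerator of `growthConst` dominates the coefficient of each square; its denominator is the
  -- coercivity constant.
  have g1 : (2 * (1 + β) + 1 / (2 * β)) * B * (x₁ ^ 2 + x₃ ^ 2 + (X + Y)) ≤
      growthConst β * B * E := by
    have : growthConst β * B * ((1 - 1 / (2 * β)) * (x₁ ^ 2 + x₃ ^ 2 + (X + Y))) ≤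
        growthConst β * B * E := by
      refine mul_le_mul_of_nonneg_left hL ?_
      have : 0 ≤ growthConst β := div_nonneg (by positivity) hγ.le
      positivity
    have hmul : ∀ A γ S : ℝ, γ ≠ 0 → A * B * S = A / γ * B * (γ * S) := by
      intro A γ S h
      field_simp
    exact (hmul _ _ _ hγ.ne').trans_le this
  have d1 : lam * r ^ 2 * E ≤ lam * r ^ 2 * (x₁ ^ 2 + x₃ ^ 2 + 2 * (X + Y)) :=
    mul_le_mul_of_nonneg_left hU (by positivity)
  have d2 : lam * (r ^ 2 * (x₁ ^ 2 + x₃ ^ 2)) ≤ 2 * ν * (r ^ 2 * (x₁ ^ 2 + x₃ ^ 2)) :=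
    mul_le_mul_of_nonneg_right (by linarith) (by positivity)
  have d3 : r ^ 2 * (min ν κ * (X + Y)) ≤ r ^ 2 * (ν * X + κ * Y) :=
    mul_le_mul_of_nonneg_left t7 hr2'.le
  have d4 : (ν + κ) / (2 * β) = 2 * (min ν κ - lam) := by
    rw [hlam]
    field_simp
    ring
  rw [d4] at t6
  have w1 : 0 ≤ B * (x₁ ^ 2 + x₃ ^ 2) := by positivity
  have w2 : 0 ≤ B * X := by positivity
  have w3 : 0 ≤ B * Y := by positivity
  have w4 : 0 ≤ β * (B * (x₁ ^ 2 + x₃ ^ 2)) := by positivity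
  have w5 : 0 ≤ β * (B * X) := by positivity
  have w6 : 0 ≤ 1 / (2 * β) * (B * (x₁ ^ 2 + x₃ ^ 2)) := by positivity
  linarith

/-- Only linearity in `δ` matters, as `δ → 0` with `R` fixed. The summand `1` appears because the
errors enter linearly in the unknowns, through `2|x| ≤ 1 + x²`. -/
theorem abs_energyDeriv_error_le (hβ : 1 / 2 < β) (hq : q = k ^ 2 + l ^ 2) (hr : 1 ≤ r)
    (hk : 1 ≤ k ^ 2)
    (hr2 : r ^ 2 = q + ξ ^ 2) {R δ e₁ e₂ e₃ e₄ : ℝ} (hR : r ≤ R) (h₁ : |e₁| ≤ δ) (h₂ : |e₂| ≤ δ)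
    (h₃ : |e₃| ≤ δ) (h₄ : |e₄| ≤ δ) :
    2 * x₁ * e₁ + 2 * x₃ * e₃ + 2 * r ^ 3 * x₂ * e₂ + 2 * q * r * τ * e₄
      - k * ξ * r / β * (e₂ * τ + x₂ * e₄) ≤
      12 * R ^ 3 * δ * (1 + energySum q r x₁ x₂ x₃ τ) := by
  have hb : 0 < β := by linarith
  have hδ : 0 ≤ δ := (abs_nonneg _).trans h₁
  have hq1 : 1 ≤ q := by rw [hq]; nlinarith [sq_nonneg l]
  have hqr : q ≤ r ^ 2 := by rw [hr2]; nlinarith [sq_nonneg ξ]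
  have hr0 : 0 < r := by linarith
  set S := 1 + energySum q r x₁ x₂ x₃ τ with hS
  have hr3 : 1 ≤ r ^ 3 := one_le_pow₀ hr
  have hX : x₂ ^ 2 ≤ r ^ 3 * x₂ ^ 2 := le_mul_of_one_le_left (sq_nonneg _) hr3
  have hY : τ ^ 2 ≤ q * r * τ ^ 2 := le_mul_of_one_le_left (sq_nonneg _) (by nlinarith)
  have hsq : ∀ x : ℝ, 2 * |x| ≤ 1 + x ^ 2 := fun x => by
    nlinarith [sq_nonneg (|x| - 1), sq_abs x]
  have b1 : 2 * |x₁| ≤ S := by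
    rw [hS, energySum]
    linarith [hsq x₁, sq_nonneg x₁, sq_nonneg x₂, sq_nonneg x₃, sq_nonneg τ]
  have b2 : 2 * |x₂| ≤ S := by
    rw [hS, energySum]
    linarith [hsq x₂, sq_nonneg x₁, sq_nonneg x₂, sq_nonneg x₃, sq_nonneg τ]
  have b3 : 2 * |x₃| ≤ S := by
    rw [hS, energySum]
    linarith [hsq x₃, sq_nonneg x₁, sq_nonneg x₂, sq_nonneg x₃, sq_nonneg τ]
  have b4 : 2 * |τ| ≤ S := by
    rw [hS, energySum]
    linarith [hsq τ, sq_nonneg x₁, sq_nonneg x₂, sq_nonneg x₃, sq_nonneg τ]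
  have hR3 : r ^ 3 ≤ R ^ 3 := pow_le_pow_left₀ hr0.le hR 3
  have hS0 : 0 ≤ S := (by positivity : 0 ≤ 2 * |x₁|).trans b1
  have prod : ∀ {x e : ℝ}, 2 * |x| ≤ S → |e| ≤ δ → ∀ c : ℝ, |c| ≤ R ^ 3 →
      2 * (c * (x * e)) ≤ R ^ 3 * (S * δ) := by
    intro x e hx he c hc
    have h0 := le_abs_self (c * (x * e))
    rw [abs_mul, abs_mul] at h0
    have h1 : (2 * |x|) * |e| ≤ S * δ := mul_le_mul hx he (abs_nonneg _) hS0
    have h2 : |c| * ((2 * |x|) * |e|) ≤ R ^ 3 * (S * δ) :=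
      mul_le_mul hc h1 (by positivity) ((abs_nonneg _).trans hc)
    linarith
  have hc1 : |(1 : ℝ)| ≤ R ^ 3 := by rw [abs_one]; linarith
  have hc2 : |r ^ 3| ≤ R ^ 3 := by rw [abs_of_pos (by positivity)]; exact hR3
  have hc3 : |q * r| ≤ R ^ 3 := by
    rw [abs_of_pos (mul_pos (by linarith) hr0)]
    have := mul_le_mul_of_nonneg_right hqr hr0.le
    linarith
  have hc4 : |-(k * ξ * r / (2 * β))| ≤ R ^ 3 := by
    have h1 : |k * ξ| ≤ r ^ 2 := by
      rw [abs_le, hr2, hq]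
      constructor <;> nlinarith [sq_nonneg (k + ξ), sq_nonneg (k - ξ), sq_nonneg l]
    rw [abs_neg, abs_div, abs_mul (k * ξ), abs_of_pos hr0, abs_of_pos (by positivity : 0 < 2 * β)]
    refine (div_le_self (by positivity) (by linarith)).trans ?_
    have := mul_le_mul_of_nonneg_right h1 hr0.le
    linarith
  have p1 := prod b1 h₁ 1 hc1
  have p2 := prod b2 h₂ _ hc2
  have p3 := prod b3 h₃ 1 hc1
  have p4 := prod b4 h₄ _ hc3
  have p5 := prod b4 h₂ _ hc4
  have p6 := prod b2 h₄ _ hc4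
  have e : k * ξ * r / β * (e₂ * τ + x₂ * e₄) =
      -(2 * (-(k * ξ * r / (2 * β)) * (τ * e₂))) - 2 * (-(k * ξ * r / (2 * β)) * (x₂ * e₄)) := by
    field_simp
    ring
  rw [e]
  have : 0 ≤ R ^ 3 * (S * δ) := by positivity
  linarith

theorem energyDeriv_add (y₁ y₂ y₃ σ e₁ e₂ e₃ e₄ : ℝ) :
    energyDeriv β k q ξ r x₁ x₂ x₃ τ (y₁ + e₁) (y₂ + e₂) (y₃ + e₃) (σ + e₄) =
      energyDeriv β k q ξ r x₁ x₂ x₃ τ y₁ y₂ y₃ σ +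
      (2 * x₁ * e₁ + 2 * x₃ * e₃ + 2 * r ^ 3 * x₂ * e₂ + 2 * q * r * τ * e₄
        - k * ξ * r / β * (e₂ * τ + x₂ * e₄)) := by
  rw [energyDeriv, energyDeriv]
  ring

end Algebra

theorem hasDerivAt_energy {β k q : ℝ} {ξ r x₁ x₂ x₃ τ : ℝ → ℝ} {y₁ y₂ y₃ σ s : ℝ}
    (hr0 : r s ≠ 0) (hξ : HasDerivAt ξ (-k) s) (hr : HasDerivAt r (-(k * ξ s) / r s) s)
    (h₁ : HasDerivAt x₁ y₁ s) (h₂ : HasDerivAt x₂ y₂ s) (h₃ : HasDerivAt x₃ y₃ s)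
    (h₄ : HasDerivAt τ σ s) :
    HasDerivAt (fun s => energy β k q (ξ s) (r s) (x₁ s) (x₂ s) (x₃ s) (τ s))
      (energyDeriv β k q (ξ s) (r s) (x₁ s) (x₂ s) (x₃ s) (τ s) y₁ y₂ y₃ σ) s := by
  have h := (((((h₁.pow 2).add (h₃.pow 2)).add ((hr.pow 3).mul (h₂.pow 2))).add
    ((hr.const_mul q).mul (h₄.pow 2))).sub
      ((((hξ.const_mul k).mul hr).div_const β).mul (h₂.mul h₄)))
  refine h.congr_deriv ?_
  simp only [Pi.pow_apply, Pi.mul_apply, energyDeriv]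
  push_cast
  -- Division by zero gives zero, so for `β = 0` the cross terms vanish on both sides.
  by_cases hβ : β = 0
  · subst hβ
    field_simp
    ring
  · field_simp
    ring

/-! ### A Grönwall inequality with source -/

/-- With the integrating factor, `exp(∫ a) L - ε K s` is nonincreasing; `K` bounds that factor on
the interval. -/
theorem exp_integral_mul_le_of_deriv_le {a L L' : ℝ → ℝ} {t ε K : ℝ} (ht : 0 ≤ t)
    (ha : Continuous a) (hε : 0 ≤ ε) (hL : ContinuousOn L (Icc 0 t))
    (hL' : ∀ s ∈ Ioo 0 t, HasDerivAt L (L' s) s) (hle : ∀ s ∈ Ioo 0 t, L' s ≤ -a s * L s + ε)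
    (hK : ∀ s ∈ Ioo 0 t, Real.exp (∫ r in (0 : ℝ)..s, a r) ≤ K) :
    Real.exp (∫ r in (0 : ℝ)..t, a r) * L t ≤ L 0 + ε * K * t := by
  have hA : ∀ s, HasDerivAt (fun s => ∫ r in (0 : ℝ)..s, a r) (a s) s := fun s =>
    intervalIntegral.integral_hasDerivAt_right (ha.intervalIntegrable _ _)
      (ha.stronglyMeasurableAtFilter _ _) ha.continuousAt
  have hanti : AntitoneOn (fun s => Real.exp (∫ r in (0 : ℝ)..s, a r) * L s - ε * K * s)
      (Icc 0 t) := by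
    refine antitoneOn_of_hasDerivWithinAt_nonpos (convex_Icc 0 t)
      (f' := fun s => Real.exp (∫ r in (0 : ℝ)..s, a r) * a s * L s +
        Real.exp (∫ r in (0 : ℝ)..s, a r) * L' s - ε * K * 1) ?_ ?_ ?_
    · refine ContinuousOn.sub (ContinuousOn.mul ?_ hL) (by fun_prop)
      exact (Real.continuous_exp.comp
        (continuous_iff_continuousAt.2 fun s => (hA s).continuousAt)).continuousOn
    · intro s hs
      rw [interior_Icc] at hs
      exact ((((hA s).exp.mul (hL' s hs))).sub ((hasDerivAt_id s).const_mul _)).hasDerivWithinAt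
    · intro s hs
      rw [interior_Icc] at hs
      have h1 := mul_le_mul_of_nonneg_left (hle s hs)
        (Real.exp_pos (∫ r in (0 : ℝ)..s, a r)).le
      have h2 := mul_le_mul_of_nonneg_left (hK s hs) hε
      linarith
  have h := hanti (left_mem_Icc.2 ht) (right_mem_Icc.2 ht) ht
  simp only [intervalIntegral.integral_same, Real.exp_zero, one_mul, mul_zero, sub_zero] at h
  linarith

/-! ### The time-integrable growth rate -/

/-- `(1 + s²)^{-3/4}`. -/
def decay (s : ℝ) : ℝ := (1 + s ^ 2) ^ (-3 / 4 : ℝ)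

theorem decay_pos (s : ℝ) : 0 < decay s := Real.rpow_pos_of_pos (by positivity) _

theorem continuous_decay : Continuous decay :=
  Continuous.rpow_const (by fun_prop) fun s => Or.inl (by positivity)

theorem integrable_decay : Integrable decay := by
  have h := integrable_rpow_neg_one_add_norm_sq (E := ℝ) (μ := volume) (r := 3 / 2)
    (by rw [Module.finrank_self]; norm_num)
  refine h.congr (Eventually.of_forall fun s => ?_)
  simp only [decay, Real.norm_eq_abs, sq_abs]
  norm_num

/-- The bound is uniform in the critical time `c`, which will be `η/k`; this makes the growth factor
independent of the mode. -/
theorem integral_decay_le (c : ℝ) {t : ℝ} (ht : 0 ≤ t) :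
    ∫ s in (0 : ℝ)..t, decay (s - c) ≤ ∫ s, decay s := by
  rw [intervalIntegral.integral_of_le ht, ← integral_sub_right_eq_self decay c]
  exact setIntegral_le_integral (integrable_decay.comp_sub_right c)
    (Eventually.of_forall fun s => (decay_pos _).le)

theorem le_decay_mul {k l η s : ℝ} (hk : 1 ≤ k ^ 2) :
    k ^ 2 ≤ decay (s - η / k) * (k ^ 2 + (η - k * s) ^ 2 + l ^ 2) := by
  have hk0 : k ≠ 0 := by rintro rfl; norm_num at hk
  have e : η - k * s = -(k * (s - η / k)) := by field_simp; ring
  rw [e]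
  set σ := s - η / k
  have h1 : (1 + σ ^ 2)⁻¹ ≤ decay σ := by
    rw [decay, ← Real.rpow_neg_one]
    exact Real.rpow_le_rpow_of_exponent_le (by linarith [sq_nonneg σ]) (by norm_num)
  have h2 : k ^ 2 * (1 + σ ^ 2) ≤ k ^ 2 + (-(k * σ)) ^ 2 + l ^ 2 := by
    linarith [sq_nonneg l]
  calc k ^ 2 = (1 + σ ^ 2)⁻¹ * (k ^ 2 * (1 + σ ^ 2)) := by field_simp
    _ ≤ _ := mul_le_mul h1 h2 (by positivity) (decay_pos σ).le

/-- Here the exponent `-3/4` is sharp: with `σ = s - η/k` one has `r² ≥ 1 + σ²`, so `r⁻³ ≤ (1 +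
σ²)^(-3/2) = decay σ ^ 2`. -/
theorem one_le_decay_sq_mul {k l η s r : ℝ} (hk : 1 ≤ k ^ 2) (hr : 0 < r)
    (hr2 : r ^ 2 = k ^ 2 + (η - k * s) ^ 2 + l ^ 2) :
    1 ≤ decay (s - η / k) ^ 2 * r ^ 3 := by
  have hk0 : k ≠ 0 := by rintro rfl; norm_num at hk
  have e : η - k * s = -(k * (s - η / k)) := by field_simp; ring
  rw [e] at hr2
  set σ := s - η / k
  have h2 : 1 + σ ^ 2 ≤ r ^ 2 := by
    rw [hr2]
    have := mul_le_mul_of_nonneg_right hk (sq_nonneg σ)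
    linarith [sq_nonneg l]
  have h3 : r ^ 3 = (r ^ 2) ^ (3 / 2 : ℝ) := by
    rw [← Real.rpow_natCast, ← Real.rpow_natCast, ← Real.rpow_mul hr.le]
    norm_num
  have h4 : decay σ ^ 2 = (1 + σ ^ 2) ^ (-(3 / 2) : ℝ) := by
    rw [decay, ← Real.rpow_natCast, ← Real.rpow_mul (by positivity)]
    norm_num
  have h0 : 0 < 1 + σ ^ 2 := by positivity
  rw [h3, h4]
  calc (1 : ℝ) = (1 + σ ^ 2) ^ (-(3 / 2) : ℝ) * (1 + σ ^ 2) ^ (3 / 2 : ℝ) := by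
        rw [← Real.rpow_add h0]; norm_num
    _ ≤ _ := by gcongr

/-- Completing the square in `η` exhibits the cubic lower bound `k² t³/12` for `t ≥ 0`, with
equality at `η = k t/2`: the source of the enhanced rate. -/
theorem integral_shear_sq (k η t : ℝ) :
    ∫ s in (0 : ℝ)..t, (η - k * s) ^ 2 = t * (η - k * t / 2) ^ 2 + k ^ 2 * t ^ 3 / 12 := by
  have h : ∀ s ∈ uIcc 0 t, HasDerivAt
      (fun s => η ^ 2 * s - η * k * s ^ 2 + k ^ 2 / 3 * s ^ 3) ((η - k * s) ^ 2) s := by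
    intro s _
    refine ((((hasDerivAt_id s).const_mul (η ^ 2)).sub
      ((hasDerivAt_pow 2 s).const_mul (η * k))).add
      ((hasDerivAt_pow 3 s).const_mul (k ^ 2 / 3))).congr_deriv ?_
    norm_num
    ring
  rw [intervalIntegral.integral_eq_sub_of_hasDerivAt h (Continuous.intervalIntegrable (by fun_prop) _ _)]
  ring

/-! ### Approximate solutions of the mode equations -/

/-- A solution on `[0, t]` of the equations of a real mode, up to an error `δ`. -/
structure IsApproxMode (β ν κ k l η t δ : ℝ) (x₁ x₂ x₃ τ : ℝ → ℝ) : Prop where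
  cont₁ : ContinuousOn x₁ (Icc 0 t)
  cont₂ : ContinuousOn x₂ (Icc 0 t)
  cont₃ : ContinuousOn x₃ (Icc 0 t)
  cont₄ : ContinuousOn τ (Icc 0 t)
  deriv : ∀ s ∈ Ioo 0 t, ∀ ξ p : ℝ, ξ = η - k * s → p = k ^ 2 + ξ ^ 2 + l ^ 2 →
    ∃ e₁ e₂ e₃ e₄ : ℝ, (|e₁| ≤ δ ∧ |e₂| ≤ δ ∧ |e₃| ≤ δ ∧ |e₄| ≤ δ) ∧
    HasDerivAt x₁ (-x₂ s + 2 * (k * k / p) * x₂ s + β * (k * ξ / p) * τ s - ν * p * x₁ s + e₁) s ∧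
    HasDerivAt x₂ (2 * (ξ * k / p) * x₂ s + β * (ξ * ξ / p) * τ s - β * τ s - ν * p * x₂ s + e₂) s ∧
    HasDerivAt x₃ (2 * (l * k / p) * x₂ s + β * (l * ξ / p) * τ s - ν * p * x₃ s + e₃) s ∧
    HasDerivAt τ (β * x₂ s - κ * p * τ s + e₄) s

/-- `|k, ξ, l|` as a function of real arguments. -/
def waveNorm (k ξ l : ℝ) : ℝ := Real.sqrt (k ^ 2 + ξ ^ 2 + l ^ 2)

theorem waveNorm_sq (k ξ l : ℝ) : waveNorm k ξ l ^ 2 = k ^ 2 + ξ ^ 2 + l ^ 2 :=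
  Real.sq_sqrt (by positivity)

theorem one_le_waveNorm {k : ℝ} (hk : 1 ≤ k ^ 2) (ξ l : ℝ) : 1 ≤ waveNorm k ξ l :=
  Real.one_le_sqrt.2 (by linarith [sq_nonneg ξ, sq_nonneg l])

theorem hasDerivAt_waveNorm {k : ℝ} (hk : 1 ≤ k ^ 2) (l η s : ℝ) :
    HasDerivAt (fun s => waveNorm k (η - k * s) l)
      (-(k * (η - k * s)) / waveNorm k (η - k * s) l) s := by
  have h1 : HasDerivAt (fun s => η - k * s) (-k) s := by
    simpa using ((hasDerivAt_id s).const_mul k).const_sub η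
  have h2 := ((h1.pow 2).const_add (k ^ 2)).add_const (l ^ 2)
  have h3 := h2.sqrt (by
    have := sq_nonneg (η - k * s)
    simp only [Pi.pow_apply]
    linarith [sq_nonneg l])
  refine h3.congr_deriv ?_
  simp only [waveNorm, Pi.pow_apply]
  have : Real.sqrt (k ^ 2 + (η - k * s) ^ 2 + l ^ 2) ≠ 0 := by
    have := one_le_waveNorm hk (η - k * s) l
    rw [waveNorm] at this
    linarith
  field_simp
  norm_num
  ring

/-- The truncation error contributes at most `M δ (1 + L/γ)` by coercivity. The part proportional to
`L` is absorbed into the rate `a`, the constant part is the Grönwall source. -/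
theorem exp_mul_energy_le {β ν κ k l η t δ : ℝ} {x₁ x₂ x₃ τ : ℝ → ℝ} (hβ : 1 / 2 < β) (hν : 0 < ν)
    (hκ : 0 < κ) {lam : ℝ} (hlam : lam = min ν κ - (ν + κ) / (4 * β)) (hlam0 : 0 < lam)
    (hk : 1 ≤ k ^ 2) (ht : 0 ≤ t) (hδ : 0 ≤ δ)
    (h : IsApproxMode β ν κ k l η t δ x₁ x₂ x₃ τ) {M A K : ℝ}
    (hM : M = 12 * (|k| + |l| + (|η| + |k| * t)) ^ 3)
    (hA : A = ∫ s in (0 : ℝ)..t, (lam * (k ^ 2 + (η - k * s) ^ 2 + l ^ 2) -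
      growthConst β * decay (s - η / k)))
    (hK : K = Real.exp (∫ s in (0 : ℝ)..t, lam * (k ^ 2 + (η - k * s) ^ 2 + l ^ 2))) :
    Real.exp (A - M * δ / (1 - 1 / (2 * β)) * t) *
        energy β k (k ^ 2 + l ^ 2) (η - k * t) (waveNorm k (η - k * t) l)
          (x₁ t) (x₂ t) (x₃ t) (τ t) ≤
      energy β k (k ^ 2 + l ^ 2) η (waveNorm k η l) (x₁ 0) (x₂ 0) (x₃ 0) (τ 0) +
        M * δ * K * t := by
  have hγ := one_sub_pos hβ
  set γ := 1 - 1 / (2 * β) with hγ_def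
  have hg0 : 0 ≤ growthConst β := by
    have : 0 < β := by linarith
    exact div_nonneg (by positivity) hγ.le
  set q := k ^ 2 + l ^ 2 with hq
  set a : ℝ → ℝ := fun s => lam * (k ^ 2 + (η - k * s) ^ 2 + l ^ 2) -
    growthConst β * decay (s - η / k) - M * δ / γ with ha_def
  have hM0 : 0 ≤ M := by rw [hM]; positivity
  have hpc : Continuous fun s => lam * (k ^ 2 + (η - k * s) ^ 2 + l ^ 2) := by fun_prop
  have hdc : Continuous fun s => growthConst β * decay (s - η / k) :=
    continuous_const.mul (continuous_decay.comp (by fun_prop))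
  have ha : Continuous a := (hpc.sub hdc).sub continuous_const
  have hAint : ∫ s in (0 : ℝ)..t, a s = A - M * δ / γ * t := by
    have hadd := intervalIntegral.integral_sub (μ := volume) (a := 0) (b := t)
      ((hpc.sub hdc).intervalIntegrable _ _)
      ((continuous_const (y := M * δ / γ)).intervalIntegrable _ _)
    rw [intervalIntegral.integral_const, smul_eq_mul, sub_zero, mul_comm t] at hadd
    rw [hA]
    exact hadd
  have hξd : ∀ s, HasDerivAt (fun s => η - k * s) (-k) s := fun s => by
    simpa using ((hasDerivAt_id s).const_mul k).const_sub η
  have hr1 : ∀ s, 1 ≤ waveNorm k (η - k * s) l := fun s => one_le_waveNorm hk _ _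
  have hr2 : ∀ s, waveNorm k (η - k * s) l ^ 2 = q + (η - k * s) ^ 2 := fun s => by
    rw [waveNorm_sq, hq]
    ring
  have hp : ∀ s, k ^ 2 + (η - k * s) ^ 2 + l ^ 2 = waveNorm k (η - k * s) l ^ 2 := fun s =>
    (waveNorm_sq _ _ _).symm
  set L : ℝ → ℝ := fun s => energy β k q (η - k * s) (waveNorm k (η - k * s) l)
    (x₁ s) (x₂ s) (x₃ s) (τ s) with hL_def
  have hLc : ContinuousOn L (Icc 0 t) := by
    have hw : ContinuousOn (fun s => waveNorm k (η - k * s) l) (Icc 0 t) := by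
      unfold waveNorm
      fun_prop
    have h1 := h.cont₁
    have h2 := h.cont₂
    have h3 := h.cont₃
    have h4 := h.cont₄
    simp only [hL_def, energy]
    fun_prop
  have key : ∀ s ∈ Ioo 0 t, ∃ L', HasDerivAt L L' s ∧ L' ≤ -a s * L s + M * δ := by
    intro s hs
    obtain ⟨e₁, e₂, e₃, e₄, ⟨b1, b2, b3, b4⟩, d1, d2, d3, d4⟩ :=
      h.deriv s hs _ _ rfl (hp s).symm
    have hr0 : 0 < waveNorm k (η - k * s) l := by linarith [hr1 s]
    refine ⟨_, hasDerivAt_energy (ξ := fun s => η - k * s)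
      (r := fun s => waveNorm k (η - k * s) l) hr0.ne' (hξd s)
      (hasDerivAt_waveNorm hk l η s) d1 d2 d3 d4, ?_⟩
    rw [energyDeriv_add]
    have hmain := energyDeriv_le (x₁ := x₁ s) (x₂ := x₂ s) (x₃ := x₃ s) (τ := τ s) hβ hν hκ hlam
      hlam0 hq hr0 (hr2 s) (decay_pos (s - η / k)) ((hp s) ▸ le_decay_mul hk)
      (one_le_decay_sq_mul hk hr0 (hp s).symm)
    -- One bound for the wave number on all of `[0, t]`, so that `M` does not depend on `s`.
    have hR : waveNorm k (η - k * s) l ≤ |k| + |l| + (|η| + |k| * t) := by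
      refine Real.sqrt_le_iff.2 ⟨by positivity, ?_⟩
      have h1 : |η - k * s| ≤ |η| + |k| * t := by
        refine (abs_sub _ _).trans ?_
        rw [abs_mul, abs_of_pos hs.1]
        gcongr
        exact hs.2.le
      have h2 : (η - k * s) ^ 2 ≤ (|η| + |k| * t) ^ 2 := by
        rw [← sq_abs]
        exact pow_le_pow_left₀ (abs_nonneg _) h1 2
      have h3 : 0 ≤ |η| + |k| * t := by positivity
      have h4 : 0 ≤ |k| * |l| := by positivity
      have h5 : 0 ≤ (|k| + |l|) * (|η| + |k| * t) := by positivity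
      rw [← sq_abs k, ← sq_abs l]
      linarith
    have herr := abs_energyDeriv_error_le (x₁ := x₁ s) (x₂ := x₂ s) (x₃ := x₃ s) (τ := τ s) hβ hq
      (hr1 s) hk (hr2 s) hR b1 b2 b3 b4
    rw [← hM] at herr
    have hS : energySum q (waveNorm k (η - k * s) l) (x₁ s) (x₂ s) (x₃ s) (τ s) ≤ L s / γ := by
      rw [le_div_iff₀ hγ, mul_comm]
      exact energySum_le hβ hq hr0 (hr2 s)
    have h6 := mul_le_mul_of_nonneg_left hS (mul_nonneg hM0 hδ)
    have h7 : -a s * L s + M * δ = (-lam * waveNorm k (η - k * s) l ^ 2 +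
        growthConst β * decay (s - η / k)) * L s + M * δ * (L s / γ) + M * δ := by
      simp only [ha_def, hp]
      field_simp
      ring
    rw [h7]
    refine (add_le_add hmain herr).trans ?_
    simp only [hL_def] at h6 ⊢
    linarith
  choose! L' hL1 hL2 using key
  have hfin := exp_integral_mul_le_of_deriv_le ht ha (mul_nonneg hM0 hδ) hLc hL1 hL2 (K := K) ?_
  · rw [hAint] at hfin
    simpa [hL_def] using hfin
  · intro s hs
    rw [hK]
    refine Real.exp_le_exp.2 ?_
    have i1 : ∫ r in (0 : ℝ)..s, a r ≤
        ∫ r in (0 : ℝ)..s, lam * (k ^ 2 + (η - k * r) ^ 2 + l ^ 2) := by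
      refine intervalIntegral.integral_mono_on hs.1.le (ha.intervalIntegrable _ _)
        (hpc.intervalIntegrable _ _) fun r _ => ?_
      have h1 : 0 ≤ growthConst β * decay (r - η / k) := mul_nonneg hg0 (decay_pos _).le
      have h2 : 0 ≤ M * δ / γ := div_nonneg (mul_nonneg hM0 hδ) hγ.le
      simp only [ha_def]
      linarith
    refine i1.trans ?_
    refine intervalIntegral.integral_mono_interval le_rfl hs.1.le hs.2.le
      (Eventually.of_forall fun r => ?_) (hpc.intervalIntegrable _ _)
    simp only [Pi.zero_apply]
    positivity

/-- The constant by which the time-integrable growth can increase the energy. -/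
def growthFactor (β : ℝ) : ℝ := Real.exp (growthConst β * ∫ s, decay s)

/-- In the limit of vanishing errors, the energy decays at the enhanced rate. -/
theorem exp_mul_energy_le_of_tendsto {β ν κ k l η t : ℝ} {δ : ℕ → ℝ} {x₁ x₂ x₃ τ : ℕ → ℝ → ℝ}
    (hβ : 1 / 2 < β) (hν : 0 < ν) (hκ : 0 < κ) {lam : ℝ}
    (hlam : lam = min ν κ - (ν + κ) / (4 * β)) (hlam0 : 0 < lam) (hk : 1 ≤ k ^ 2) (ht : 0 ≤ t)
    (hδ : ∀ n, 0 ≤ δ n) (hδ0 : Tendsto δ atTop (𝓝 0))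
    (h : ∀ n, IsApproxMode β ν κ k l η t (δ n) (x₁ n) (x₂ n) (x₃ n) (τ n))
    {a₁ a₂ a₃ a₄ b₁ b₂ b₃ b₄ : ℝ}
    (ha₁ : Tendsto (fun n => x₁ n 0) atTop (𝓝 a₁)) (ha₂ : Tendsto (fun n => x₂ n 0) atTop (𝓝 a₂))
    (ha₃ : Tendsto (fun n => x₃ n 0) atTop (𝓝 a₃)) (ha₄ : Tendsto (fun n => τ n 0) atTop (𝓝 a₄))
    (hb₁ : Tendsto (fun n => x₁ n t) atTop (𝓝 b₁)) (hb₂ : Tendsto (fun n => x₂ n t) atTop (𝓝 b₂))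
    (hb₃ : Tendsto (fun n => x₃ n t) atTop (𝓝 b₃)) (hb₄ : Tendsto (fun n => τ n t) atTop (𝓝 b₄)) :
    Real.exp (lam * t ^ 3 / 12) *
        energy β k (k ^ 2 + l ^ 2) (η - k * t) (waveNorm k (η - k * t) l) b₁ b₂ b₃ b₄ ≤
      growthFactor β *
        energy β k (k ^ 2 + l ^ 2) η (waveNorm k η l) a₁ a₂ a₃ a₄ := by
  set A := ∫ s in (0 : ℝ)..t, (lam * (k ^ 2 + (η - k * s) ^ 2 + l ^ 2) -
      growthConst β * decay (s - η / k)) with hA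
  set K := Real.exp (∫ s in (0 : ℝ)..t, lam * (k ^ 2 + (η - k * s) ^ 2 + l ^ 2)) with hK
  set M := 12 * (|k| + |l| + (|η| + |k| * t)) ^ 3 with hM
  have hγ := one_sub_pos hβ
  have hg0 : 0 ≤ growthConst β := by
    have : 0 < β := by linarith
    exact div_nonneg (by positivity) hγ.le
  have hn := fun n => exp_mul_energy_le hβ hν hκ hlam hlam0 hk ht (hδ n) (h n) hM hA hK
  have henergy : ∀ (ξ r : ℝ) {y₁ y₂ y₃ y₄ : ℕ → ℝ} {c₁ c₂ c₃ c₄ : ℝ}, Tendsto y₁ atTop (𝓝 c₁) →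
      Tendsto y₂ atTop (𝓝 c₂) → Tendsto y₃ atTop (𝓝 c₃) → Tendsto y₄ atTop (𝓝 c₄) →
      Tendsto (fun n => energy β k (k ^ 2 + l ^ 2) ξ r (y₁ n) (y₂ n) (y₃ n) (y₄ n)) atTop
        (𝓝 (energy β k (k ^ 2 + l ^ 2) ξ r c₁ c₂ c₃ c₄)) := by
    intro ξ r y₁ y₂ y₃ y₄ c₁ c₂ c₃ c₄ h₁ h₂ h₃ h₄
    exact ((((h₁.pow 2).add (h₃.pow 2)).add ((h₂.pow 2).const_mul _)).add
      ((h₄.pow 2).const_mul _)).sub ((h₂.mul h₄).const_mul _)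
  have hexp : Tendsto (fun n => Real.exp (A - M * δ n / (1 - 1 / (2 * β)) * t)) atTop
      (𝓝 (Real.exp A)) := by
    refine (Real.continuous_exp.tendsto A).comp ?_
    simpa using (((hδ0.const_mul M).div_const (1 - 1 / (2 * β))).mul_const t).const_sub A
  have hsrc : Tendsto (fun n => M * δ n * K * t) atTop (𝓝 0) := by
    simpa using ((hδ0.const_mul M).mul_const K).mul_const t
  have hlim := le_of_tendsto_of_tendsto'
    (hexp.mul (henergy (η - k * t) (waveNorm k (η - k * t) l) hb₁ hb₂ hb₃ hb₄))
    ((henergy η (waveNorm k η l) ha₁ ha₂ ha₃ ha₄).add hsrc) hn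
  rw [add_zero] at hlim
  have hpc : Continuous fun s => lam * (k ^ 2 + (η - k * s) ^ 2 + l ^ 2) := by fun_prop
  have hdc : Continuous fun s => growthConst β * decay (s - η / k) :=
    continuous_const.mul (continuous_decay.comp (by fun_prop))
  -- Only `(η - k s)²` is kept from `r²`, and `k² ≥ 1` is used in its integral.
  have hAle : lam * t ^ 3 / 12 - growthConst β * ∫ s, decay s ≤ A := by
    rw [hA, intervalIntegral.integral_sub (hpc.intervalIntegrable _ _)
      (hdc.intervalIntegrable _ _), intervalIntegral.integral_const_mul,
      intervalIntegral.integral_const_mul]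
    refine sub_le_sub ?_ (mul_le_mul_of_nonneg_left (integral_decay_le _ ht) hg0)
    rw [mul_div_assoc]
    refine mul_le_mul_of_nonneg_left ?_ hlam0.le
    have h1 : ∫ s in (0 : ℝ)..t, (η - k * s) ^ 2 ≤
        ∫ s in (0 : ℝ)..t, (k ^ 2 + (η - k * s) ^ 2 + l ^ 2) := by
      refine intervalIntegral.integral_mono_on ht
        (Continuous.intervalIntegrable (by fun_prop) _ _)
        (Continuous.intervalIntegrable (by fun_prop) _ _) fun s _ => ?_
      linarith [sq_nonneg k, sq_nonneg l]
    refine le_trans ?_ h1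
    rw [integral_shear_sq]
    have h2 : 0 ≤ t * (η - k * t / 2) ^ 2 := by positivity
    have h3 := mul_le_mul_of_nonneg_right hk (by positivity : 0 ≤ t ^ 3)
    linarith
  -- Nonnegativity of the energy permits replacing the exponent `A` by its lower bound.
  have hE : 0 ≤ energy β k (k ^ 2 + l ^ 2) (η - k * t) (waveNorm k (η - k * t) l) b₁ b₂ b₃ b₄ := by
    have hr := one_le_waveNorm hk (η - k * t) l
    refine le_trans (mul_nonneg hγ.le ?_) (energySum_le hβ rfl (by linarith) ?_)
    · rw [energySum]
      positivity
    · rw [waveNorm_sq]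
      ring
  have h1 : Real.exp (lam * t ^ 3 / 12) = growthFactor β *
      Real.exp (lam * t ^ 3 / 12 - growthConst β * ∫ s, decay s) := by
    rw [growthFactor, ← Real.exp_add]
    congr 1
    ring
  rw [h1, mul_assoc]
  refine mul_le_mul_of_nonneg_left (le_trans ?_ hlim) (Real.exp_pos _).le
  exact mul_le_mul_of_nonneg_right (Real.exp_le_exp.2 hAle) hE

/-! ### The mode equations satisfied by truncated Fourier transforms -/

/-- The Fourier transform of `f` at `(k, ·, l)`, truncated at scale `n`, along the characteristic
issued from `η`. -/
def charTransform (k l : ℤ) (η : ℝ) (n : ℕ) (f : ℝ → L2) (s : ℝ) : ℂ :=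
  ip (modulate (η - k * s) (cutoff n)) (mode (f s) k l)

/-- The size of the errors made by truncating. -/
def truncError (β μ Ξ K : ℝ) (n : ℕ) : ℝ :=
  K * ((8 + 4 * |β|) * l2norm (deriv (cutoff n)) +
    μ * (2 * Ξ * l2norm (deriv (cutoff n)) + l2norm (deriv (deriv (cutoff n)))))

theorem tendsto_truncError (β μ Ξ K : ℝ) : Tendsto (truncError β μ Ξ K) atTop (𝓝 0) := by
  have h1 := tendsto_l2norm_deriv_cutoff
  have h2 := tendsto_l2norm_deriv_deriv_cutoff
  have h := ((h1.const_mul (8 + 4 * |β|)).add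
    (((h1.const_mul (2 * Ξ)).add h2).const_mul μ)).const_mul K
  refine Tendsto.congr (fun n => rfl) (h.trans (le_of_eq ?_))
  simp

theorem truncError_nonneg (β : ℝ) {μ Ξ K : ℝ} (hμ : 0 ≤ μ) (hΞ : 0 ≤ Ξ) (hK : 0 ≤ K) (n : ℕ) :
    0 ≤ truncError β μ Ξ K n := by
  have h1 := l2norm_nonneg (deriv (cutoff n))
  have h2 := l2norm_nonneg (deriv (deriv (cutoff n)))
  unfold truncError
  positivity

theorem norm_diffusion_error_le {ξ Ξ K : ℝ} (hξ : |ξ| ≤ Ξ) (n : ℕ)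
    {v : Lp ℂ 2 (volume : Measure ℝ)} (hv : ‖v‖ ≤ K) :
    ‖ip (fun y => (2 * (ξ : ℂ) * Complex.I) * modulate ξ (deriv (cutoff n)) y +
      modulate ξ (deriv (deriv (cutoff n))) y) v‖ ≤
      K * (2 * Ξ * l2norm (deriv (cutoff n)) + l2norm (deriv (deriv (cutoff n)))) := by
  have hb := (isBump_cutoff n).deriv
  have h1 := norm_ip_le (hb.modulate ξ).memLp v
  have h2 := norm_ip_le (hb.deriv.modulate ξ).memLp v
  rw [l2norm_modulate] at h1 h2
  rw [ip_add ((hb.modulate ξ).const_mul _).memLp (hb.deriv.modulate ξ).memLp, ip_const_mul]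
  refine (norm_add_le _ _).trans ?_
  have e : ‖conj (2 * (ξ : ℂ) * Complex.I)‖ = 2 * |ξ| := by
    rw [RCLike.norm_conj, norm_mul, norm_mul, Complex.norm_I, Complex.norm_real]
    simp
  rw [norm_mul, e]
  have n1 := l2norm_nonneg (deriv (cutoff n))
  have n2 := l2norm_nonneg (deriv (deriv (cutoff n)))
  have hΞ : 0 ≤ Ξ := (abs_nonneg _).trans hξ
  have a1 : ‖ip (modulate ξ (deriv (cutoff n))) v‖ ≤ l2norm (deriv (cutoff n)) * K :=
    h1.trans (mul_le_mul_of_nonneg_left hv n1)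
  have a2 : ‖ip (modulate ξ (deriv (deriv (cutoff n)))) v‖ ≤
      l2norm (deriv (deriv (cutoff n))) * K := h2.trans (mul_le_mul_of_nonneg_left hv n2)
  have a3 : 2 * |ξ| * ‖ip (modulate ξ (deriv (cutoff n))) v‖ ≤
      2 * Ξ * (l2norm (deriv (cutoff n)) * K) := by gcongr
  linarith

section Solution

variable {β ν κ : ℝ} {u : ℝ → Fin 3 → L2} {θ : ℝ → L2}

/-- The error has two sources: freezing the pressure symbol at the moving frequency, and derivatives
of the cutoff in the Laplacian. Measuring it with `ν + κ` lets velocity and temperature share one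
bound. -/
theorem IsSolution.hasDerivAt_charTransform_u (h : IsSolution β ν κ u θ) {k : ℤ} (hk : k ≠ 0)
    (l : ℤ) (η : ℝ) (n : ℕ) (j : Fin 3) {s Ξ K : ℝ} (hs : 0 < s) (hν : 0 ≤ ν) (hκ : 0 ≤ κ)
    (hΞ : |η - k * s| ≤ Ξ)
    (hu : ∀ i, ‖mode (u s i) k l‖ ≤ K) (hθ : ‖mode (θ s) k l‖ ≤ K) :
    ∃ e : ℂ, ‖e‖ ≤ truncError β (ν + κ) Ξ K n ∧
      HasDerivAt (charTransform k l η n (fun s => u s j))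
        (-(if j = 0 then charTransform k l η n (fun s => u s 1) s else 0)
          + ((2 * rieszSymbol k l j 0 (η - k * s) : ℝ) : ℂ) *
              charTransform k l η n (fun s => u s 1) s
          + ((β * rieszSymbol k l j 1 (η - k * s) : ℝ) : ℂ) * charTransform k l η n θ s
          - (if j = 1 then (β : ℂ) * charTransform k l η n θ s else 0)
          - ((ν * waveSq k (η - k * s) l : ℝ) : ℂ) * charTransform k l η n (fun s => u s j) s
          + e) s := by
  obtain ⟨G, hG, hweak⟩ := h.momentum
  have hmu : ∀ i, ContinuousOn (fun r => mode (u r i) k l) (Ici 0) := fun i =>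
    (continuous_mode k l).comp_continuousOn (h.continuous_u i)
  have hmθ : ContinuousOn (fun r => mode (θ r) k l) (Ici 0) :=
    (continuous_mode k l).comp_continuousOn h.continuous_θ
  have hd := hasDerivAt_ip_of_weak (h.continuous_u j) ν k l
    (R := fun s φ => -(if j = 0 then pair (u s 1) φ else 0) - pair (G s j) φ
      - (if j = 1 then β * pair (θ s) φ else 0))
    (ρ := fun s w => -(if j = 0 then ip w (mode (u s 1) k l) else 0)
      - pressurePairing β k l j w (mode (u s 1) k l) (mode (θ s) k l)
      - (if j = 1 then β * ip w (mode (θ s) k l) else 0)) ?_ ?_ ?_ (isBump_cutoff n) η hs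
  · set ξ := η - k * s
    set P := pressurePairing β k l j (modulate ξ (cutoff n)) (mode (u s 1) k l) (mode (θ s) k l)
    set D := ip (fun y => (2 * (ξ : ℂ) * Complex.I) * modulate ξ (deriv (cutoff n)) y +
      modulate ξ (deriv (deriv (cutoff n))) y) (mode (u s j) k l)
    have hK : 0 ≤ K := (norm_nonneg _).trans hθ
    have hΞ0 : 0 ≤ Ξ := (abs_nonneg _).trans hΞ
    have hP := norm_pressurePairing_sub_le β hk l j (isBump_cutoff n) ξ (mode (u s 1) k l)
      (mode (θ s) k l)
    have hD : ‖D‖ ≤ _ := norm_diffusion_error_le hΞ n (hu j)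
    set Q := -2 * (rieszSymbol k l j 0 ξ : ℂ) * ip (modulate ξ (cutoff n)) (mode (u s 1) k l) -
      β * rieszSymbol k l j 1 ξ * ip (modulate ξ (cutoff n)) (mode (θ s) k l) with hQ
    refine ⟨-(P - Q) + ν * D, ?_, ?_⟩
    · refine (norm_add_le _ _).trans ?_
      rw [norm_neg, norm_mul, Complex.norm_real, Real.norm_of_nonneg hν, truncError]
      have n1 := l2norm_nonneg (deriv (cutoff n))
      have n2 := l2norm_nonneg (deriv (deriv (cutoff n)))
      have hP' : ‖P - Q‖ ≤ (8 * K + 4 * |β| * K) * l2norm (deriv (cutoff n)) := by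
        refine hP.trans (mul_le_mul_of_nonneg_right ?_ n1)
        have := mul_le_mul_of_nonneg_left hθ (by positivity : 0 ≤ 4 * |β|)
        have := hu 1
        linarith
      have hD' := mul_le_mul_of_nonneg_left hD hν
      have hD'' : 0 ≤ κ * (K * (2 * Ξ * l2norm (deriv (cutoff n)) +
          l2norm (deriv (deriv (cutoff n))))) := by positivity
      linarith
    · refine hd.congr_deriv ?_
      simp only [charTransform]
      rw [hQ]
      push_cast
      ring
  · intro φ hφ t ht
    rw [hweak φ hφ t ht j]
    congr 1
    refine intervalIntegral.integral_congr fun r _ => ?_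
    ring
  · intro w hw s hs
    rw [pair_tensor_conj _ _ _ hw.memLp, pair_tensor_conj _ _ _ hw.memLp,
      pair_tensor_conj _ _ _ hw.memLp, ip_pressureGrad (hG s hs j) hk l hw]
    split_ifs <;> ring
  · intro w hw
    refine (ContinuousOn.sub (ContinuousOn.neg ?_)
      (continuousOn_pressurePairing β hk l j hw (hmu 1) hmθ)).sub ?_
    · split_ifs
      · exact continuousOn_ip hw.memLp (hmu 1)
      · exact continuousOn_const
    · split_ifs
      · exact continuousOn_const.mul (continuousOn_ip hw.memLp hmθ)
      · exact continuousOn_const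

theorem IsSolution.hasDerivAt_charTransform_θ (h : IsSolution β ν κ u θ) (k l : ℤ) (η : ℝ)
    (n : ℕ) {s Ξ K : ℝ} (hs : 0 < s) (hν : 0 ≤ ν) (hκ : 0 ≤ κ) (hΞ : |η - k * s| ≤ Ξ)
    (hθ : ‖mode (θ s) k l‖ ≤ K) :
    ∃ e : ℂ, ‖e‖ ≤ truncError β (ν + κ) Ξ K n ∧
      HasDerivAt (charTransform k l η n θ)
        ((β : ℂ) * charTransform k l η n (fun s => u s 1) s
          - ((κ * waveSq k (η - k * s) l : ℝ) : ℂ) * charTransform k l η n θ s + e) s := by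
  have hmu : ContinuousOn (fun r => mode (u r 1) k l) (Ici 0) :=
    (continuous_mode k l).comp_continuousOn (h.continuous_u 1)
  have hd := hasDerivAt_ip_of_weak h.continuous_θ κ k l
    (R := fun s φ => β * pair (u s 1) φ)
    (ρ := fun s w => β * ip w (mode (u s 1) k l)) h.temperature ?_ ?_ (isBump_cutoff n) η hs
  · set ξ := η - k * s
    set D := ip (fun y => (2 * (ξ : ℂ) * Complex.I) * modulate ξ (deriv (cutoff n)) y +
      modulate ξ (deriv (deriv (cutoff n))) y) (mode (θ s) k l)
    have hK : 0 ≤ K := (norm_nonneg _).trans hθ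
    have hΞ0 : 0 ≤ Ξ := (abs_nonneg _).trans hΞ
    have hD : ‖D‖ ≤ _ := norm_diffusion_error_le hΞ n hθ
    refine ⟨κ * D, ?_, ?_⟩
    · rw [norm_mul, Complex.norm_real, Real.norm_of_nonneg hκ, truncError]
      have n1 := l2norm_nonneg (deriv (cutoff n))
      have n2 := l2norm_nonneg (deriv (deriv (cutoff n)))
      have hD' := mul_le_mul_of_nonneg_left hD hκ
      have h1 : 0 ≤ ν * (K * (2 * Ξ * l2norm (deriv (cutoff n)) +
          l2norm (deriv (deriv (cutoff n))))) := by positivity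
      have h2 : 0 ≤ K * ((8 + 4 * |β|) * l2norm (deriv (cutoff n))) := by positivity
      linarith
    · refine hd.congr_deriv ?_
      simp only [charTransform]
      push_cast
      ring
  · intro w hw s _
    rw [pair_tensor_conj _ _ _ hw.memLp]
    ring
  · intro w hw
    exact continuousOn_const.mul (continuousOn_ip hw.memLp hmu)

/-- The mode equations hold only for `s > 0`; continuity up to `s = 0` brings in the initial data.
-/
theorem continuousOn_charTransform {f : ℝ → L2} (hf : ContinuousOn f (Ici 0)) (k l : ℤ) (η : ℝ)
    (n : ℕ) : ContinuousOn (charTransform k l η n f) (Ici 0) := by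
  have hm : ContinuousOn (fun r => mode (f r) k l) (Ici 0) :=
    (continuous_mode k l).comp_continuousOn hf
  have hc : Continuous (fun r => (isBump_cutoff n).curve (η - k * r)) :=
    continuous_iff_continuousAt.2 fun s =>
      (hasDerivAt_modulate_curve (isBump_cutoff n) η k s).continuousAt
  refine (ContinuousOn.inner (𝕜 := ℂ) hc.continuousOn hm).congr fun r _ => ?_
  rw [charTransform, ip_eq_inner ((isBump_cutoff n).modulate _).memLp]
  rfl

/-- The mode equations have real coefficients, so any real-linear functional `π` commutes with them.
Real and imaginary parts are thereby treated at once. -/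
theorem IsSolution.isApproxMode (h : IsSolution β ν κ u θ) (hν : 0 ≤ ν) (hκ : 0 ≤ κ) {k : ℤ}
    (hk : k ≠ 0) (l : ℤ) (η : ℝ) (n : ℕ) {t K : ℝ}
    (hu : ∀ s ∈ Icc 0 t, ∀ i, ‖mode (u s i) k l‖ ≤ K)
    (hθ : ∀ s ∈ Icc 0 t, ‖mode (θ s) k l‖ ≤ K) {π : ℂ →L[ℝ] ℝ} (hπ : ∀ z, |π z| ≤ ‖z‖) :
    IsApproxMode β ν κ k l η t (truncError β (ν + κ) (|η| + |(k : ℝ)| * t) K n)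
      (fun s => π (charTransform k l η n (fun s => u s 0) s))
      (fun s => π (charTransform k l η n (fun s => u s 1) s))
      (fun s => π (charTransform k l η n (fun s => u s 2) s))
      (fun s => π (charTransform k l η n θ s)) := by
  have hc : ∀ {f : ℝ → L2}, ContinuousOn f (Ici 0) →
      ContinuousOn (fun s => π (charTransform k l η n f s)) (Icc 0 t) := fun hf =>
    π.continuous.comp_continuousOn
      ((continuousOn_charTransform hf k l η n).mono Icc_subset_Ici_self)
  refine ⟨hc (h.continuous_u 0), hc (h.continuous_u 1), hc (h.continuous_u 2),
    hc h.continuous_θ, ?_⟩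
  rintro s hs ξ p rfl rfl
  have hs' : s ∈ Icc 0 t := Ioo_subset_Icc_self hs
  have hΞ : |η - k * s| ≤ |η| + |(k : ℝ)| * t := by
    refine (abs_sub _ _).trans ?_
    rw [abs_mul, abs_of_pos hs.1]
    gcongr
    exact hs.2.le
  have hd := fun j => h.hasDerivAt_charTransform_u hk l η n j hs.1 hν hκ hΞ (hu s hs') (hθ s hs')
  obtain ⟨e₀, b₀, d₀⟩ := hd 0
  obtain ⟨e₁, b₁, d₁⟩ := hd 1
  obtain ⟨e₂, b₂, d₂⟩ := hd 2
  obtain ⟨e₃, b₃, d₃⟩ := h.hasDerivAt_charTransform_θ k l η n hs.1 hν hκ hΞ (hθ s hs')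
  have hmul : ∀ (c : ℝ) (z : ℂ), π ((c : ℂ) * z) = c * π z := fun c z => by
    rw [← Complex.real_smul, map_smul, smul_eq_mul]
  refine ⟨π e₀, π e₁, π e₂, π e₃, ⟨(hπ _).trans b₀, (hπ _).trans b₁, (hπ _).trans b₂,
    (hπ _).trans b₃⟩, ?_, ?_, ?_, ?_⟩
  · refine ((π.hasFDerivAt).comp_hasDerivAt s d₀).congr_deriv ?_
    simp only [map_add, map_sub, map_neg, hmul, if_true, Fin.isValue]
    simp [rieszSymbol, wave, waveSq]
  · refine ((π.hasFDerivAt).comp_hasDerivAt s d₁).congr_deriv ?_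
    simp only [map_add, map_sub, map_neg, hmul, if_true, Fin.isValue]
    simp [rieszSymbol, wave, waveSq]
  · refine ((π.hasFDerivAt).comp_hasDerivAt s d₂).congr_deriv ?_
    simp only [map_add, map_sub, map_neg, hmul, Fin.isValue]
    simp [rieszSymbol, wave, waveSq]
  · refine ((π.hasFDerivAt).comp_hasDerivAt s d₃).congr_deriv ?_
    simp only [map_add, map_sub, hmul, waveSq]

end Solution

/-! ### Pointwise decay of the Fourier transform -/

theorem rate_eq {β ν κ : ℝ} (hν : 0 < ν) (hκ : 0 < κ) :
    rate β ν κ = min ν κ - (ν + κ) / (4 * β) := by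
  have hm : min ν κ ≠ 0 := (lt_min hν hκ).ne'
  have h : min ν κ * (1 / (4 * β) * (max ν κ / min ν κ)) = max ν κ / (4 * β) := by
    field_simp
  rw [rate, mul_sub, h, ← min_add_max ν κ]
  ring

theorem rate_pos {β ν κ : ℝ} (hβ : 1 / 2 < β) (hν : 0 < ν) (hκ : 0 < κ)
    (h : max ν κ / min ν κ < 4 * β - 1) : 0 < rate β ν κ := by
  refine mul_pos (lt_min hν hκ) ?_
  have hb : 0 < 4 * β := by linarith
  have e : 1 - 1 / (4 * β) - 1 / (4 * β) * (max ν κ / min ν κ) =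
      (4 * β - 1 - max ν κ / min ν κ) / (4 * β) := by
    field_simp
  rw [e]
  exact div_pos (by linarith) hb

/-- The constant in the pointwise decay estimate. -/
def decayConst (β : ℝ) : ℝ := 6 * growthFactor β / (1 - 1 / (2 * β))

theorem decayConst_pos {β : ℝ} (hβ : 1 / 2 < β) : 0 < decayConst β :=
  div_pos (mul_pos (by norm_num) (Real.exp_pos _)) (one_sub_pos hβ)

/-- Here `m` plays the time bracket and `M` the initial Sobolev weight. Replacing `r` by `m` costs
at most `M³`, and bounding the initial energy weights costs another `M³`; the product `M⁶` is the
squared `H³` weight. -/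
theorem weighted_sum_le {γ G E A a₂ a₄ B b₂ b₄ r q r₀ m M : ℝ} (hγ : 0 < γ) (hG : 0 ≤ G)
    (hE : 0 < E) (hA : 0 ≤ A) (ha₂ : 0 ≤ a₂) (ha₄ : 0 ≤ a₄) (hB : 0 ≤ B) (hb₂ : 0 ≤ b₂)
    (hb₄ : 0 ≤ b₄) (hr : 1 ≤ r) (hq : 1 ≤ q) (hqr : q ≤ r₀ ^ 2) (hr₀ : 1 ≤ r₀) (hm : 1 ≤ m)
    (hM : 0 < M) (hM2 : M ^ 2 = 1 + r₀ ^ 2) (hmr : m ^ 2 ≤ 2 * (r * M) ^ 2)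
    (h : E * (γ * (A + (r ^ 3 * a₂ + q * r * a₄))) ≤
      G * (B + 2 * (r₀ ^ 3 * b₂ + q * r₀ * b₄))) :
    A + m ^ 3 * a₂ + m * a₄ ≤ 6 * G / γ * E⁻¹ * (M ^ 6 * (B + b₂ + b₄)) := by
  have hM1 : 1 ≤ M := by nlinarith
  have hr0M : r₀ ≤ M := by nlinarith
  have hM3 : 1 ≤ M ^ 3 := one_le_pow₀ hM1
  have hMM : M ≤ M ^ 3 := le_self_pow₀ hM1 (by norm_num)
  have hrM : 0 < r * M := by positivity
  -- `1.42` exceeds `√2`, and its cube is below `3`.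
  have hm1 : m ≤ 1.42 * (r * M) := by
    refine le_of_sq_le_sq ?_ (by positivity)
    nlinarith
  have hm3 : m ^ 3 ≤ 3 * M ^ 3 * r ^ 3 := by
    calc m ^ 3 ≤ (1.42 * (r * M)) ^ 3 := pow_le_pow_left₀ (by linarith) hm1 3
      _ = 1.42 ^ 3 * (M ^ 3 * r ^ 3) := by ring
      _ ≤ 3 * (M ^ 3 * r ^ 3) := by
        gcongr
        norm_num
      _ = _ := by ring
  have hm4 : m ≤ 3 * M ^ 3 * (q * r) := by
    have h1 : r * M ≤ (q * r) * M ^ 3 := by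
      refine mul_le_mul ?_ hMM hM.le (by positivity)
      exact le_mul_of_one_le_left (by linarith) hq
    linarith
  have h1 : A + m ^ 3 * a₂ + m * a₄ ≤ 3 * M ^ 3 * (A + (r ^ 3 * a₂ + q * r * a₄)) := by
    have := mul_le_mul_of_nonneg_right hm3 ha₂
    have := mul_le_mul_of_nonneg_right hm4 ha₄
    have := mul_le_mul_of_nonneg_right hM3 hA
    linarith
  have h2 : B + 2 * (r₀ ^ 3 * b₂ + q * r₀ * b₄) ≤ 2 * M ^ 3 * (B + b₂ + b₄) := by
    have e1 : r₀ ^ 3 ≤ M ^ 3 := pow_le_pow_left₀ (by linarith) hr0M 3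
    have e2 : q * r₀ ≤ M ^ 3 := by
      have : q * r₀ ≤ r₀ ^ 2 * r₀ := mul_le_mul_of_nonneg_right hqr (by linarith)
      linarith
    have := mul_le_mul_of_nonneg_right e1 hb₂
    have := mul_le_mul_of_nonneg_right e2 hb₄
    have := mul_le_mul_of_nonneg_right hM3 hB
    linarith
  have h3 : A + (r ^ 3 * a₂ + q * r * a₄) ≤ G / γ * E⁻¹ * (2 * M ^ 3 * (B + b₂ + b₄)) := by
    have h4 := h.trans (mul_le_mul_of_nonneg_left h2 hG)
    have e : G / γ * E⁻¹ * (2 * M ^ 3 * (B + b₂ + b₄)) =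
        G * (2 * M ^ 3 * (B + b₂ + b₄)) / (E * γ) := by
      field_simp
    rw [e, le_div_iff₀ (by positivity)]
    linarith
  calc _ ≤ _ := h1
    _ ≤ 3 * M ^ 3 * (G / γ * E⁻¹ * (2 * M ^ 3 * (B + b₂ + b₄))) := by gcongr
    _ = _ := by ring

theorem bracket_sq (t : ℝ) : bracket t ^ 2 = 1 + t ^ 2 := Real.sq_sqrt (by positivity)

theorem one_le_bracket (t : ℝ) : 1 ≤ bracket t :=
  Real.one_le_sqrt.2 (by linarith [sq_nonneg t])

theorem energyNorm_le {β k l η t lam : ℝ} (hβ : 1 / 2 < β) (hk : 1 ≤ k ^ 2)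
    {a₁ a₂ a₃ a₄ b₁ b₂ b₃ b₄ : ℂ}
    (h : ∀ π : ℂ →L[ℝ] ℝ, (∀ z, |π z| ≤ ‖z‖) → Real.exp (lam * t ^ 3 / 12) *
        energy β k (k ^ 2 + l ^ 2) (η - k * t) (waveNorm k (η - k * t) l)
          (π b₁) (π b₂) (π b₃) (π b₄) ≤
      growthFactor β *
        energy β k (k ^ 2 + l ^ 2) η (waveNorm k η l) (π a₁) (π a₂) (π a₃) (π a₄)) :
    (‖b₁‖ ^ 2 + ‖b₃‖ ^ 2) + bracket t ^ 3 * ‖b₂‖ ^ 2 + bracket t * ‖b₄‖ ^ 2 ≤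
      decayConst β * Real.exp (-(1 / 12) * lam * t ^ 3) * ((1 + (k ^ 2 + η ^ 2 + l ^ 2)) ^ 3 *
        ((‖a₁‖ ^ 2 + ‖a₃‖ ^ 2) + ‖a₂‖ ^ 2 + ‖a₄‖ ^ 2)) := by
  have hγ := one_sub_pos hβ
  have hG : 0 < growthFactor β := Real.exp_pos _
  have hE := Real.exp_pos (lam * t ^ 3 / 12)
  have hr := one_le_waveNorm hk (η - k * t) l
  have hr0 := one_le_waveNorm hk η l
  have hr2 := waveNorm_sq k (η - k * t) l
  have hr02 := waveNorm_sq k η l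
  have hπ : ∀ π : ℂ →L[ℝ] ℝ, (∀ z, |π z| ≤ ‖z‖) → Real.exp (lam * t ^ 3 / 12) *
      ((1 - 1 / (2 * β)) * energySum (k ^ 2 + l ^ 2) (waveNorm k (η - k * t) l)
        (π b₁) (π b₂) (π b₃) (π b₄)) ≤ growthFactor β *
      ((π a₁) ^ 2 + (π a₃) ^ 2 + 2 * (waveNorm k η l ^ 3 * (π a₂) ^ 2 +
        (k ^ 2 + l ^ 2) * waveNorm k η l * (π a₄) ^ 2)) := by
    intro π h0
    refine le_trans ?_ ((h π h0).trans ?_)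
    · exact mul_le_mul_of_nonneg_left
        (energySum_le hβ rfl (by linarith) (by rw [hr2]; ring)) hE.le
    · exact mul_le_mul_of_nonneg_left
        (energy_le hβ rfl (by linarith) (by rw [hr02]; ring)) hG.le
  -- The estimates for real and imaginary parts add up to one for squared moduli.
  have h1 := hπ Complex.reCLM Complex.abs_re_le_norm
  have h2 := hπ Complex.imCLM Complex.abs_im_le_norm
  have hn : ∀ z : ℂ, ‖z‖ ^ 2 = z.re ^ 2 + z.im ^ 2 := fun z => by
    rw [← Complex.normSq_eq_norm_sq, Complex.normSq_apply]
    ring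
  set M := Real.sqrt (1 + (k ^ 2 + η ^ 2 + l ^ 2)) with hM
  have hMsq : M ^ 2 = 1 + waveNorm k η l ^ 2 := by
    rw [hM, Real.sq_sqrt (by positivity), hr02]
  have hMpos : 0 < M := Real.sqrt_pos.2 (by positivity)
  have hmain := weighted_sum_le (γ := 1 - 1 / (2 * β)) (G := growthFactor β)
    (E := Real.exp (lam * t ^ 3 / 12)) (A := ‖b₁‖ ^ 2 + ‖b₃‖ ^ 2) (a₂ := ‖b₂‖ ^ 2)
    (a₄ := ‖b₄‖ ^ 2) (B := ‖a₁‖ ^ 2 + ‖a₃‖ ^ 2) (b₂ := ‖a₂‖ ^ 2) (b₄ := ‖a₄‖ ^ 2)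
    (r := waveNorm k (η - k * t) l) (q := k ^ 2 + l ^ 2) (r₀ := waveNorm k η l) (m := bracket t)
    (M := M) hγ hG.le hE (by positivity) (by positivity) (by positivity) (by positivity)
    (by positivity) (by positivity) hr (by linarith [sq_nonneg l])
    (by rw [hr02]; linarith [sq_nonneg η]) hr0 (one_le_bracket t) hMpos hMsq ?_ ?_
  · have e1 : Real.exp (-(1 / 12) * lam * t ^ 3) = (Real.exp (lam * t ^ 3 / 12))⁻¹ := by
      rw [← Real.exp_neg]
      congr 1
      ring
    have e2 : M ^ 6 = (1 + (k ^ 2 + η ^ 2 + l ^ 2)) ^ 3 := by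
      rw [show M ^ 6 = (M ^ 2) ^ 3 by ring, hM, Real.sq_sqrt (by positivity)]
    rw [e1, ← e2, decayConst]
    exact hmain
  -- Either the initial frequency `η` or the current one `η - k t` is of size `|k| t`, so `⟨t⟩² ≤ 2
  -- (1 + (η - k t)²)(1 + η²)`.
  · rw [mul_pow, hMsq, hr2, hr02, bracket_sq]
    have h3 : t ^ 2 ≤ k ^ 2 * t ^ 2 := le_mul_of_one_le_left (sq_nonneg t) hk
    have h4 : k ^ 2 * t ^ 2 ≤ 2 * (η - k * t) ^ 2 + 2 * η ^ 2 := by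
      linarith [sq_nonneg (2 * η - k * t)]
    have h5 : (1 + (η - k * t) ^ 2) * (1 + η ^ 2) ≤
        (k ^ 2 + (η - k * t) ^ 2 + l ^ 2) * (1 + (k ^ 2 + η ^ 2 + l ^ 2)) :=
      mul_le_mul (by linarith [sq_nonneg l]) (by linarith [sq_nonneg l, sq_nonneg k])
        (by positivity) (by positivity)
    have h6 : 0 ≤ (η - k * t) ^ 2 * η ^ 2 := by positivity
    linarith
  · simp only [hn]
    simp only [energySum, Complex.reCLM_apply, Complex.imCLM_apply] at h1 h2
    linarith

/-- The characteristic starting at `2πζ` reaches `2πζ - k t` at time `t`, which explains the shift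
of `ζ` by `k t/(2π)`. -/
theorem IsSolution.ae_fourierL2_le {β ν κ : ℝ} {u : ℝ → Fin 3 → L2} {θ : ℝ → L2}
    (h : IsSolution β ν κ u θ) (hβ : 1 / 2 < β) (hν : 0 < ν) (hκ : 0 < κ)
    (hrate : 0 < rate β ν κ) {k : ℤ} (hk : k ≠ 0) (l : ℤ) {t : ℝ} (ht : 0 ≤ t) :
    ∀ᵐ ζ : ℝ,
      (‖fourierL2 (u t 0) k l (ζ - k * t / (2 * Real.pi))‖ ^ 2 +
          ‖fourierL2 (u t 2) k l (ζ - k * t / (2 * Real.pi))‖ ^ 2) +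
        bracket t ^ 3 * ‖fourierL2 (u t 1) k l (ζ - k * t / (2 * Real.pi))‖ ^ 2 +
        bracket t * ‖fourierL2 (θ t) k l (ζ - k * t / (2 * Real.pi))‖ ^ 2 ≤
      decayConst β * Real.exp (-(1 / 12) * rate β ν κ * t ^ 3) *
        ((1 + waveSq k (2 * Real.pi * ζ) l) ^ 3 *
          ((‖fourierL2 (u 0 0) k l ζ‖ ^ 2 + ‖fourierL2 (u 0 2) k l ζ‖ ^ 2) +
            ‖fourierL2 (u 0 1) k l ζ‖ ^ 2 + ‖fourierL2 (θ 0) k l ζ‖ ^ 2)) := by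
  have hk1 : (1 : ℝ) ≤ (k : ℝ) ^ 2 := by
    have : (1 : ℤ) ≤ k ^ 2 := by
      have := sq_pos_of_ne_zero hk
      omega
    exact_mod_cast this
  have hbound : ∀ {f : ℝ → L2}, ContinuousOn f (Ici 0) →
      ∃ K, 0 ≤ K ∧ ∀ s ∈ Icc 0 t, ‖mode (f s) k l‖ ≤ K := by
    intro f hf
    have hc : ContinuousOn (fun s => mode (f s) k l) (Icc 0 t) :=
      (continuous_mode k l).comp_continuousOn (hf.mono Icc_subset_Ici_self)
    obtain ⟨K, hK⟩ := isCompact_Icc.exists_bound_of_continuousOn hc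
    exact ⟨K, (norm_nonneg _).trans (hK 0 ⟨le_rfl, ht⟩), hK⟩
  choose Ku hKu0 hKu using fun j => hbound (h.continuous_u j)
  obtain ⟨Kθ, hKθ0, hKθ⟩ := hbound h.continuous_θ
  set K := ∑ j, Ku j + Kθ with hK
  have hKj : ∀ j, Ku j ≤ K := fun j => by
    have := Finset.single_le_sum (fun i _ => hKu0 i) (Finset.mem_univ j)
    linarith
  have hKsum : 0 ≤ ∑ j, Ku j := Finset.sum_nonneg fun j _ => hKu0 j
  -- One subsequence for eight functions: the Boolean selects time `t` or `0`, and `none` stands for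
  -- the temperature.
  obtain ⟨ns, hns, hconv⟩ := exists_seq_tendsto_truncFourier
    (fun i : Bool × Option (Fin 3) => mode
      (i.2.elim (θ (if i.1 then t else 0)) (u (if i.1 then t else 0))) k l)
  set c : ℝ := k * t / (2 * Real.pi) with hc
  -- Translations preserve null sets, so the same subsequence converges at the shifted frequency.
  have hconv' : ∀ᵐ ζ : ℝ, ∀ i : Bool × Option (Fin 3), Tendsto (fun n => truncFourier (ns n)
      (mode (i.2.elim (θ (if i.1 then t else 0)) (u (if i.1 then t else 0))) k l) (ζ - c)) atTop
      (𝓝 (Lp.fourierTransformₗᵢ ℝ ℂ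
        (mode (i.2.elim (θ (if i.1 then t else 0)) (u (if i.1 then t else 0))) k l) (ζ - c))) :=
    (measurePreserving_sub_right volume c).quasiMeasurePreserving.ae hconv
  filter_upwards [hconv, hconv'] with ζ h0 ht'
  have hη : 2 * Real.pi * (ζ - c) = 2 * Real.pi * ζ - k * t := by
    have := Real.pi_ne_zero
    rw [hc]
    field_simp
  have hlim0 : ∀ f : ℝ → L2, Tendsto (fun n => truncFourier (ns n) (mode (f 0) k l) ζ) atTop
      (𝓝 (fourierL2 (f 0) k l ζ)) → Tendsto (fun n => charTransform k l (2 * Real.pi * ζ) (ns n)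
        f 0) atTop (𝓝 (fourierL2 (f 0) k l ζ)) := by
    intro f hf
    refine hf.congr fun n => ?_
    rw [charTransform, mul_zero, sub_zero, truncFourier]
  have hlimt : ∀ f : ℝ → L2, Tendsto (fun n => truncFourier (ns n) (mode (f t) k l) (ζ - c)) atTop
      (𝓝 (fourierL2 (f t) k l (ζ - c))) → Tendsto (fun n => charTransform k l (2 * Real.pi * ζ)
        (ns n) f t) atTop (𝓝 (fourierL2 (f t) k l (ζ - c))) := by
    intro f hf
    refine hf.congr fun n => ?_
    rw [charTransform, truncFourier, hη]
  have z0 : ∀ j, _ := fun j : Fin 3 => hlim0 (fun s => u s j) (h0 (false, some j))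
  have zt : ∀ j, _ := fun j : Fin 3 => hlimt (fun s => u s j) (ht' (true, some j))
  have zθ0 := hlim0 θ (h0 (false, none))
  have zθt := hlimt θ (ht' (true, none))
  refine energyNorm_le hβ hk1 fun π hπ => ?_
  have hΞ0 : 0 ≤ |2 * Real.pi * ζ| + |(k : ℝ)| * t := by positivity
  exact exp_mul_energy_le_of_tendsto hβ hν hκ (rate_eq hν hκ) hrate hk1 ht
    (fun n => truncError_nonneg β (add_pos hν hκ).le hΞ0 (by positivity) (ns n))
    ((tendsto_truncError β (ν + κ) _ K).comp hns.tendsto_atTop)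
    (fun n => h.isApproxMode hν.le hκ.le hk l (2 * Real.pi * ζ) (ns n)
      (fun s hs j => (hKu j s hs).trans (hKj j))
      (fun s hs => (hKθ s hs).trans (by linarith)) hπ)
    ((π.continuous.tendsto _).comp (z0 0)) ((π.continuous.tendsto _).comp (z0 1))
    ((π.continuous.tendsto _).comp (z0 2)) ((π.continuous.tendsto _).comp zθ0)
    ((π.continuous.tendsto _).comp (zt 0)) ((π.continuous.tendsto _).comp (zt 1))
    ((π.continuous.tendsto _).comp (zt 2)) ((π.continuous.tendsto _).comp zθt)

/-! ### Summation over the modes -/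

theorem enorm_sq_eq_ofReal (z : ℂ) : ‖z‖ₑ ^ 2 = ENNReal.ofReal (‖z‖ ^ 2) := by
  rw [← ofReal_norm, ENNReal.ofReal_pow (norm_nonneg _)]

/-- Translation invariance of Lebesgue measure absorbs the frequency shift. For `k = 0` the left
side vanishes. -/
theorem IsSolution.lintegral_fourierL2_le {β ν κ : ℝ} {u : ℝ → Fin 3 → L2} {θ : ℝ → L2}
    (h : IsSolution β ν κ u θ) (hβ : 1 / 2 < β) (hν : 0 < ν) (hκ : 0 < κ)
    (hrate : 0 < rate β ν κ) (k l : ℤ) {t : ℝ} (ht : 0 ≤ t) :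
    ((∫⁻ ξ : ℝ, ‖fourierL2 (nonzeroModes (u t 0)) k l ξ‖ₑ ^ 2) +
      ∫⁻ ξ : ℝ, ‖fourierL2 (nonzeroModes (u t 2)) k l ξ‖ₑ ^ 2) +
      ENNReal.ofReal (bracket t ^ 3) * (∫⁻ ξ : ℝ, ‖fourierL2 (nonzeroModes (u t 1)) k l ξ‖ₑ ^ 2) +
      ENNReal.ofReal (bracket t) * (∫⁻ ξ : ℝ, ‖fourierL2 (nonzeroModes (θ t)) k l ξ‖ₑ ^ 2) ≤
    ENNReal.ofReal (decayConst β * Real.exp (-(1 / 12) * rate β ν κ * t ^ 3)) *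
      ((∑ j, ∫⁻ ξ : ℝ, ENNReal.ofReal ((1 + waveSq k (2 * Real.pi * ξ) l) ^ (3 : ℝ)) *
        ‖fourierL2 (nonzeroModes (u 0 j)) k l ξ‖ₑ ^ 2) +
      ∫⁻ ξ : ℝ, ENNReal.ofReal ((1 + waveSq k (2 * Real.pi * ξ) l) ^ (3 : ℝ)) *
        ‖fourierL2 (nonzeroModes (θ 0)) k l ξ‖ₑ ^ 2) := by
  have hmeas : ∀ f : Lp ℂ 2 (volume : Measure ℝ), AEMeasurable (fun ξ => ‖f ξ‖ₑ ^ 2) volume :=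
    fun f => (Lp.memLp f).1.enorm.pow_const _
  by_cases hk : k = 0
  · have hz : ∀ f : L2, ∫⁻ ξ : ℝ, ‖fourierL2 (nonzeroModes f) k l ξ‖ₑ ^ 2 = 0 := by
      intro f
      rw [lintegral_enorm_sq_toLp, fourierL2_nonzeroModes, if_pos hk]
      simp
    simp [hz]
  set c : ℝ := k * t / (2 * Real.pi)
  have hshift : ∀ f : L2, ∫⁻ ξ : ℝ, ‖fourierL2 (nonzeroModes f) k l ξ‖ₑ ^ 2 =
      ∫⁻ ξ : ℝ, ‖fourierL2 f k l (ξ - c)‖ₑ ^ 2 := by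
    intro f
    rw [fourierL2_nonzeroModes, if_neg hk]
    exact (lintegral_sub_right_eq_self (fun ξ => ‖fourierL2 f k l ξ‖ₑ ^ 2) c).symm
  have hmeas' : ∀ f : L2, AEMeasurable (fun ξ => ‖fourierL2 f k l (ξ - c)‖ₑ ^ 2) volume :=
    fun f => (hmeas (fourierL2 f k l)).comp_quasiMeasurePreserving
      (measurePreserving_sub_right volume c).quasiMeasurePreserving
  have hw : Measurable (fun ξ : ℝ =>
      ENNReal.ofReal ((1 + waveSq k (2 * Real.pi * ξ) l) ^ (3 : ℝ))) := by
    have hc := continuous_waveSq k l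
    exact ((((hc.comp (continuous_const.mul continuous_id)).const_add 1).rpow_const
      fun ξ => Or.inr (by norm_num)).measurable).ennreal_ofReal
  have hwm : ∀ f : Lp ℂ 2 (volume : Measure ℝ), AEMeasurable (fun ξ =>
      ENNReal.ofReal ((1 + waveSq k (2 * Real.pi * ξ) l) ^ (3 : ℝ)) * ‖f ξ‖ₑ ^ 2) volume :=
    fun f => hw.aemeasurable.mul (hmeas f)
  simp only [hshift]
  simp only [fourierL2_nonzeroModes, if_neg hk]
  rw [← lintegral_const_mul' _ _ ENNReal.ofReal_ne_top,
    ← lintegral_const_mul' _ _ ENNReal.ofReal_ne_top, ← lintegral_add_left' (hmeas' _),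
    ← lintegral_add_right' _ ((hmeas' _).const_mul _),
    ← lintegral_add_right' _ ((hmeas' _).const_mul _),
    ← lintegral_finsetSum' _ (fun j _ => hwm _),
    ← lintegral_add_right' _ (hwm _),
    ← lintegral_const_mul' _ _ ENNReal.ofReal_ne_top]
  refine lintegral_mono_ae ?_
  filter_upwards [h.ae_fourierL2_le hβ hν hκ hrate hk l ht] with ζ hζ
  have hb : 0 ≤ bracket t := Real.sqrt_nonneg _
  have hW : 0 ≤ 1 + waveSq k (2 * Real.pi * ζ) l := by
    linarith [one_le_waveSq hk (2 * Real.pi * ζ) l]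
  have hD := (decayConst_pos hβ).le
  rw [Fin.sum_univ_three, Real.rpow_ofNat]
  simp only [enorm_sq_eq_ofReal]
  rw [← ENNReal.ofReal_mul (by positivity), ← ENNReal.ofReal_mul hb,
    ← ENNReal.ofReal_add (by positivity) (by positivity),
    ← ENNReal.ofReal_add (by positivity) (by positivity),
    ← ENNReal.ofReal_add (by positivity) (by positivity),
    ← ENNReal.ofReal_mul (by positivity), ← ENNReal.ofReal_mul (by positivity),
    ← ENNReal.ofReal_mul (by positivity), ← ENNReal.ofReal_mul (by positivity),
    ← ENNReal.ofReal_add (by positivity) (by positivity),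
    ← ENNReal.ofReal_add (by positivity) (by positivity),
    ← ENNReal.ofReal_add (by positivity) (by positivity), ← ENNReal.ofReal_mul (by positivity)]
  refine ENNReal.ofReal_le_ofReal (hζ.trans (le_of_eq ?_))
  ring

theorem sobolevNormVec_sq (s : ℝ) (v : Fin 3 → L2) :
    sobolevNormVec s v ^ 2 = ∑ j, sobolevNorm s (v j) ^ 2 := by
  rw [sobolevNormVec, ← ENNReal.rpow_natCast, ← ENNReal.rpow_mul]
  norm_num

theorem IsSolution.enorm_nonzeroModes_le {β ν κ : ℝ} {u : ℝ → Fin 3 → L2} {θ : ℝ → L2}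
    (h : IsSolution β ν κ u θ) (hβ : 1 / 2 < β) (hν : 0 < ν) (hκ : 0 < κ)
    (hrate : 0 < rate β ν κ) {t : ℝ} (ht : 0 ≤ t) :
    (‖nonzeroModes (u t 0)‖ₑ ^ 2 + ‖nonzeroModes (u t 2)‖ₑ ^ 2) +
      ENNReal.ofReal (bracket t ^ 3) * ‖nonzeroModes (u t 1)‖ₑ ^ 2 +
      ENNReal.ofReal (bracket t) * ‖nonzeroModes (θ t)‖ₑ ^ 2 ≤
    ENNReal.ofReal (decayConst β * Real.exp (-(1 / 12) * rate β ν κ * t ^ 3)) *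
      (sobolevNormVec 3 (fun j => nonzeroModes (u 0 j)) ^ 2 +
        sobolevNorm 3 (nonzeroModes (θ 0)) ^ 2) := by
  have hsum := ENNReal.tsum_le_tsum fun k : ℤ => ENNReal.tsum_le_tsum fun l : ℤ =>
    h.lintegral_fourierL2_le hβ hν hκ hrate k l ht
  rw [sobolevNormVec_sq]
  simp only [sobolevNorm_sq, enorm_sq_eq_tsum_fourierL2, Fin.sum_univ_three] at hsum ⊢
  simp only [ENNReal.tsum_add, ENNReal.tsum_mul_left] at hsum
  have := mul_le_mul_right hsum (ENNReal.ofReal (4 * Real.pi ^ 2))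
  refine le_trans (le_of_eq ?_) (this.trans (le_of_eq ?_)) <;> ring

theorem add_three_le_of_sq_le {a b c Z S : ℝ} (hZ : 0 ≤ Z) (hS : 0 ≤ S)
    (h : a ^ 2 + b ^ 2 + c ^ 2 ≤ (Z * S) ^ 2) : a + b + c ≤ 3 * Z * S := by
  have h0 : 0 ≤ Z * S := by positivity
  have h1 : a ≤ Z * S := le_of_sq_le_sq (by linarith [sq_nonneg b, sq_nonneg c]) h0
  have h2 : b ≤ Z * S := le_of_sq_le_sq (by linarith [sq_nonneg a, sq_nonneg c]) h0
  have h3 : c ≤ Z * S := le_of_sq_le_sq (by linarith [sq_nonneg a, sq_nonneg b]) h0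
  linarith

end Boussinesq

end

/-! ### Conclusion: from squared norms to norms -/

theorem theorem1p1 (β : ℝ) (hβ : 1 / 2 < β) :
    ∃ C : ℝ, 0 < C ∧
      ∀ ν κ : ℝ, 0 < ν → 0 < κ → max ν κ / min ν κ < 4 * β - 1 →
        0 < Boussinesq.rate β ν κ ∧
        ∀ (u : ℝ → Fin 3 → Boussinesq.L2) (θ : ℝ → Boussinesq.L2),
          Boussinesq.IsSolution β ν κ u θ →
          ∀ t : ℝ, 0 ≤ t →
            ENNReal.ofReal
              (Real.sqrt (‖Boussinesq.nonzeroModes (u t 0)‖ ^ 2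
                  + ‖Boussinesq.nonzeroModes (u t 2)‖ ^ 2)
                + Boussinesq.bracket t ^ (3 / 2 : ℝ) * ‖Boussinesq.nonzeroModes (u t 1)‖
                + Boussinesq.bracket t ^ (1 / 2 : ℝ) * ‖Boussinesq.nonzeroModes (θ t)‖)
            ≤ ENNReal.ofReal (C * Real.exp (-(1 / 24) * Boussinesq.rate β ν κ * t ^ 3)) *
                (Boussinesq.sobolevNormVec 3 (fun j => Boussinesq.nonzeroModes (u 0 j))
                  + Boussinesq.sobolevNorm 3 (Boussinesq.nonzeroModes (θ 0))) := by
  have hD := Boussinesq.decayConst_pos hβ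
  -- The factor `3` comes from bounding each of the three summands by the square root of the total.
  refine ⟨3 * Real.sqrt (Boussinesq.decayConst β), by positivity, fun ν κ hν hκ hratio => ?_⟩
  have hrate := Boussinesq.rate_pos hβ hν hκ hratio
  refine ⟨hrate, fun u θ h t ht => ?_⟩
  have hmain := h.enorm_nonzeroModes_le hβ hν hκ hrate ht
  set S₁ := Boussinesq.sobolevNormVec 3 (fun j => Boussinesq.nonzeroModes (u 0 j))
  set S₂ := Boussinesq.sobolevNorm 3 (Boussinesq.nonzeroModes (θ 0))
  set n₀ := ‖Boussinesq.nonzeroModes (u t 0)‖ with hn₀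
  set n₁ := ‖Boussinesq.nonzeroModes (u t 1)‖ with hn₁
  set n₂ := ‖Boussinesq.nonzeroModes (u t 2)‖ with hn₂
  set n₃ := ‖Boussinesq.nonzeroModes (θ t)‖ with hn₃
  set E := Real.exp (-(1 / 24) * Boussinesq.rate β ν κ * t ^ 3) with hE
  have hE0 : 0 < E := Real.exp_pos _
  -- For data outside `H³` the right side is infinite, because the exponential factor is positive.
  by_cases hS : S₁ + S₂ = ⊤
  · rw [hS, ENNReal.mul_top (by
      rw [Ne, ENNReal.ofReal_eq_zero, not_le]
      positivity)]
    exact le_top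
  have hS₁ : S₁ ≠ ⊤ := fun h => hS (by rw [h, top_add])
  have hS₂ : S₂ ≠ ⊤ := fun h => hS (by rw [h, add_top])
  lift S₁ to NNReal using hS₁ with a₁
  lift S₂ to NNReal using hS₂ with a₂
  have hb : 0 < Boussinesq.bracket t := by linarith [Boussinesq.one_le_bracket t]
  have hE2 : Real.exp (-(1 / 12) * Boussinesq.rate β ν κ * t ^ 3) = E ^ 2 := by
    rw [hE, ← Real.exp_nat_mul]
    congr 1
    push_cast
    ring
  have hreal : n₀ ^ 2 + n₂ ^ 2 + Boussinesq.bracket t ^ 3 * n₁ ^ 2 + Boussinesq.bracket t * n₃ ^ 2 ≤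
      Boussinesq.decayConst β * E ^ 2 * ((a₁ : ℝ) ^ 2 + (a₂ : ℝ) ^ 2) := by
    rw [hE2] at hmain
    simp only [← ofReal_norm, ← hn₀, ← hn₁, ← hn₂, ← hn₃] at hmain
    rw [← ENNReal.ofReal_coe_nnreal (p := a₁), ← ENNReal.ofReal_coe_nnreal (p := a₂)] at hmain
    rw [← ENNReal.ofReal_pow (by positivity), ← ENNReal.ofReal_pow (by positivity),
      ← ENNReal.ofReal_pow (by positivity), ← ENNReal.ofReal_pow (by positivity),
      ← ENNReal.ofReal_pow (by positivity), ← ENNReal.ofReal_pow (by positivity),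
      ← ENNReal.ofReal_mul (by positivity), ← ENNReal.ofReal_mul (by positivity),
      ← ENNReal.ofReal_add (by positivity) (by positivity),
      ← ENNReal.ofReal_add (by positivity) (by positivity),
      ← ENNReal.ofReal_add (by positivity) (by positivity),
      ← ENNReal.ofReal_add (by positivity) (by positivity),
      ← ENNReal.ofReal_mul (by positivity),
      ENNReal.ofReal_le_ofReal_iff (by positivity)] at hmain
    exact hmain
  rw [← ENNReal.ofReal_coe_nnreal (p := a₁), ← ENNReal.ofReal_coe_nnreal (p := a₂),
    ← ENNReal.ofReal_add (by positivity) (by positivity), ← ENNReal.ofReal_mul (by positivity)]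
  refine ENNReal.ofReal_le_ofReal ?_
  rw [mul_assoc 3]
  refine Boussinesq.add_three_le_of_sq_le (by positivity) (by positivity) ?_
  rw [Real.sq_sqrt (by positivity), mul_pow, mul_pow, mul_pow, mul_pow,
    Real.sq_sqrt hD.le, ← Real.rpow_natCast (Boussinesq.bracket t ^ (3 / 2 : ℝ)),
    ← Real.rpow_natCast (Boussinesq.bracket t ^ (1 / 2 : ℝ)), ← Real.rpow_mul hb.le,
    ← Real.rpow_mul hb.le]
  norm_num
  refine hreal.trans ?_
  have : 0 ≤ (a₁ : ℝ) * a₂ := by positivity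
  have h2 : (a₁ : ℝ) ^ 2 + (a₂ : ℝ) ^ 2 ≤ ((a₁ : ℝ) + a₂) ^ 2 := by linarith
  gcongr
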